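/- Let projective 3-space $\mathbb P^3$ have coordinates $(x:y:z:w)$, let the Euclidean absolute be the conic $C_A:\ w=x^2+y^2+z^2=0$, and let $T\subset\mathbb P^3$ be the torus $$(x^2+y^2+z^2+aw^2)^2-b(x^2+y^2)w^2=0,$$ where $a,b>0$ are real and $b\neq 4a$. All varieties are taken over $\mathbb C$. The dual $X^\ast$ of a variety $X$ in a projective space is the Zariski closure, in the dual projective space, of the set of hyperplanes that contain the tangent space of $X$ at some nonsingular point. Dual coordinates on $(\mathbb P^3)^\ast$ are denoted by $\bar x,\bar y,\bar z,\bar w$. 1. The dual $T^\ast$ of the torus is the surface $$16(a\bar x^2+a\bar y^2+a\bar z^2+\bar w^2)^2-8b(\bar x^2+\bar y^2)(a\bar z^2+2\bar w^2)+(b^2-8ab)\bar z^4-8b\bar z^2\bar w^2=0.$$ 2. The intersection $T^\ast\cap C_A^\ast$ is the curve $\bar x^2+\bar y^2+\bar z^2=b\bar z^2+4\bar w^2=0$. It has degree four, and the intersection multiplicity of $T^\ast$ and $C_A^\ast$ along each of its irreducible components is two. 3. For a central projection $\pi:\mathbb P^3\setminus\{o\}\to\mathbb P^2$ given by a real $3\times4$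 matrix with kernel $o$, let the picture $T'$ be the Zariski closure of the set of critical values of the restriction of $\pi$ to the nonsingular part of $T$, and let the dual picture be $T'^\ast$. Let $C_E=\pi(C_A)$ be the elliptic absolute, $C_E^\ast$ its dual, and let $o^\ast\subset(\mathbb P^3)^\ast$ be the plane whose points are the planes through $o$. For all real centers $o$ outside a proper algebraic subset of $\mathbb P^3$ (depending only on $a,b$) and every real projection matrix with center $o$, the following holds. The dual picture $T'^\ast$ is a plane quartic curve. Under the identification of the lines in the image plane with the planes through $o$, one has $T'^\ast=T^\ast\cap o^\ast$ and $C_E^\ast=C_A^\ast\cap o^\ast$. At every point of $T'^\ast\cap C_E^\ast$, both curves are nonsingular and have the same tangent line. -/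

import Mathlib

open MvPolynomial

noncomputable section

namespace TorusPicture

/-- Complex projective `n`-space. The dual projective space is identified with it through dual
coordinates: a point `h` stands for the hyperplane `∑ i, h i * x i = 0`. -/
abbrev PSpace (n : ℕ) : Type := Projectivization ℂ (Fin (n + 1) → ℂ)

/-- The set of forms (homogeneous polynomials) that vanish on `X`. -/
def formsVanishingOn {n : ℕ} (X : Set (PSpace n)) : Set (MvPolynomial (Fin (n + 1)) ℂ) :=
  {f | (∃ d : ℕ, f.IsHomogeneous d) ∧ ∀ p ∈ X, eval p.rep f = 0}

/-- The projective zero set of a form. -/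
def zeroSet {n : ℕ} (f : MvPolynomial (Fin (n + 1)) ℂ) : Set (PSpace n) :=
  {p | eval p.rep f = 0}

/-- The Zariski closure of a set of points. -/
def zariskiClosure {n : ℕ} (X : Set (PSpace n)) : Set (PSpace n) :=
  {p | ∀ f ∈ formsVanishingOn X, eval p.rep f = 0}

/-- The homogeneous vanishing ideal of a set of points. -/
def homogeneousIdeal {n : ℕ} (X : Set (PSpace n)) : Ideal (MvPolynomial (Fin (n + 1)) ℂ) :=
  Ideal.span (formsVanishingOn X)

/-- The linear subspace of `ℂ^(n+1)` whose projectivization is the (embedded, Zariski) tangent space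
of `X` at `p`. -/
def tangentSpace {n : ℕ} (X : Set (PSpace n)) (p : PSpace n) :
    Submodule ℂ (Fin (n + 1) → ℂ) where
  carrier := {v | ∀ f ∈ formsVanishingOn X, ∑ i, eval p.rep (pderiv i f) * v i = 0}
  zero_mem' := by
    intro f _
    simp
  add_mem' := by
    intro u v hu hv f hf
    simp only [Pi.add_apply, mul_add, Finset.sum_add_distrib, hu f hf, hv f hf, add_zero]
  smul_mem' := by
    intro c v hv f hf
    have h := congrArg (fun t => c * t) (hv f hf)
    simp only [Finset.mul_sum, mul_zero] at h
    rw [← h]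
    refine Finset.sum_congr rfl fun i _ => ?_
    simp only [Pi.smul_apply, smul_eq_mul]
    ring

/-- `p` is a nonsingular point of the `d`-dimensional algebraic set `X`: the projective tangent
space at `p` has dimension `d`. -/
def IsNonsingularPoint {n : ℕ} (d : ℕ) (X : Set (PSpace n)) (p : PSpace n) : Prop :=
  p ∈ X ∧ Module.finrank ℂ (tangentSpace X p) = d + 1

/-- The dual of a `d`-dimensional algebraic set `X`: the Zariski closure of the set of hyperplanes
that contain the tangent space of `X` at some nonsingular point. For a surface in 3-space these are
the tangent planes, for a plane curve the tangent lines, and for a curve in 3-space the planes that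
contain a tangent line. -/
def dual {n : ℕ} (d : ℕ) (X : Set (PSpace n)) : Set (PSpace n) :=
  zariskiClosure {h | ∃ p, IsNonsingularPoint d X p ∧ ∀ v ∈ tangentSpace X p, h.rep ⬝ᵥ v = 0}

/-- The image of `X` under the rational map of projective spaces given by the matrix `A`
(points of `X` at which the map is undefined are ignored). -/
def projImage {m n : ℕ} (A : Matrix (Fin (m + 1)) (Fin (n + 1)) ℂ) (X : Set (PSpace n)) :
    Set (PSpace m) :=
  {q | ∃ p ∈ X, ∃ hp : A.mulVec p.rep ≠ 0, q = Projectivization.mk ℂ (A.mulVec p.rep) hp}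

/-- The critical points of the restriction of the projection with matrix `A` to the nonsingular part
of a surface `S`: the differential of the projection maps the tangent plane of `S` at `p` to the
tangent plane of the image plane non-surjectively. In homogeneous coordinates the differential is
given by `A`, and the tangent plane of the image plane corresponds to all of `ℂ³`. -/
def criticalPoints (A : Matrix (Fin 3) (Fin 4) ℂ) (S : Set (PSpace 3)) : Set (PSpace 3) :=
  {p | IsNonsingularPoint 2 S p ∧ (tangentSpace S p).map A.mulVecLin ≠ ⊤}

/-- The picture of a surface: the Zariski closure of the critical value set. -/
def picture (A : Matrix (Fin 3) (Fin 4) ℂ) (S : Set (PSpace 3)) : Set (PSpace 2) :=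
  zariskiClosure (projImage A (criticalPoints A S))

/-- The dual picture of a surface: the dual of its picture, a set of lines in the image plane. -/
def dualPicture (A : Matrix (Fin 3) (Fin 4) ℂ) (S : Set (PSpace 3)) : Set (PSpace 2) :=
  dual 1 (picture A S)

/-- `X` is a plane curve of degree `d`: the zero set of a form of degree `d` without multiple
factors. -/
def IsPlaneCurveOfDegree (d : ℕ) (X : Set (PSpace 2)) : Prop :=
  ∃ f : MvPolynomial (Fin 3) ℂ, f ≠ 0 ∧ f.IsHomogeneous d ∧ Squarefree f ∧ X = zeroSet f

/-- The curve `X` in 3-space has degree `d`: a generic plane meets it in exactly `d` points. -/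
def HasCurveDegree (d : ℕ) (X : Set (PSpace 3)) : Prop :=
  ∃ G : MvPolynomial (Fin 4) ℂ, G ≠ 0 ∧ (∃ k : ℕ, G.IsHomogeneous k) ∧
    ∀ h : PSpace 3, eval h.rep G ≠ 0 → {p ∈ X | h.rep ⬝ᵥ p.rep = 0}.encard = d

/-- The plane curves `X` and `Y` meet tangentially at every intersection point: both are nonsingular
there and have the same tangent line. -/
def MeetTangentially (X Y : Set (PSpace 2)) : Prop :=
  ∀ p ∈ X ∩ Y, IsNonsingularPoint 1 X p ∧ IsNonsingularPoint 1 Y p ∧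
    tangentSpace X p = tangentSpace Y p

/-- The intersection multiplicity of two hypersurfaces `X` and `Y` along the subvariety with
homogeneous prime ideal `P`: the length of the local ring at `P` modulo the ideals of `X`, `Y`. -/
def multiplicityAlong {n : ℕ} (X Y : Set (PSpace n)) (P : Ideal (MvPolynomial (Fin (n + 1)) ℂ))
    [P.IsPrime] : ℕ∞ :=
  Module.length (Localization.AtPrime P)
    (Localization.AtPrime P ⧸
      (homogeneousIdeal X ⊔ homogeneousIdeal Y).map
        (algebraMap (MvPolynomial (Fin (n + 1)) ℂ) (Localization.AtPrime P)))

/-- The property `p` holds for a generic point of real projective 3-space, that is, on the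
complement of a proper algebraic subset. -/
def ForGenericPoint (p : Projectivization ℝ (Fin 4 → ℝ) → Prop) : Prop :=
  ∃ G : MvPolynomial (Fin 4) ℝ, G ≠ 0 ∧ (∃ k : ℕ, G.IsHomogeneous k) ∧
    ∀ o : Projectivization ℝ (Fin 4 → ℝ), eval o.rep G ≠ 0 → p o

/-- The real matrix `M` defines a central projection with center `o`. -/
def IsProjectionFrom (M : Matrix (Fin 3) (Fin 4) ℝ) (o : Projectivization ℝ (Fin 4 → ℝ)) : Prop :=
  LinearMap.ker M.mulVecLin = o.submodule

/-- A real projection matrix, considered as a complex one. -/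
def complexify (M : Matrix (Fin 3) (Fin 4) ℝ) : Matrix (Fin 3) (Fin 4) ℂ :=
  M.map (fun t : ℝ => (t : ℂ))

/-- The plane `o*` in the dual space: the set of planes through `o`. -/
def planesThrough (o : Projectivization ℝ (Fin 4 → ℝ)) : Set (PSpace 3) :=
  {h | ∑ i, h.rep i * (o.rep i : ℂ) = 0}

/-- The form `(x² + y² + z² + a w²)² - b (x² + y²) w²`, with `(x, y, z, w) = (X 0, X 1, X 2, X 3)`. -/
def torusForm (a b : ℝ) : MvPolynomial (Fin 4) ℂ :=
  (X 0 ^ 2 + X 1 ^ 2 + X 2 ^ 2 + C (a : ℂ) * X 3 ^ 2) ^ 2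
    - C (b : ℂ) * (X 0 ^ 2 + X 1 ^ 2) * X 3 ^ 2

/-- The torus with parameters `a`, `b`. -/
def torus (a b : ℝ) : Set (PSpace 3) := zeroSet (torusForm a b)

/-- The form that defines the dual of the torus, in dual coordinates. -/
def dualTorusForm (a b : ℝ) : MvPolynomial (Fin 4) ℂ :=
  16 * (C (a : ℂ) * X 0 ^ 2 + C (a : ℂ) * X 1 ^ 2 + C (a : ℂ) * X 2 ^ 2 + X 3 ^ 2) ^ 2
    - 8 * C (b : ℂ) * (X 0 ^ 2 + X 1 ^ 2) * (C (a : ℂ) * X 2 ^ 2 + 2 * X 3 ^ 2)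
    + C ((b : ℂ) ^ 2 - 8 * a * b) * X 2 ^ 4
    - 8 * C (b : ℂ) * X 2 ^ 2 * X 3 ^ 2

/-- The Euclidean absolute, the conic `w = x² + y² + z² = 0`. -/
def euclideanAbsolute : Set (PSpace 3) :=
  zeroSet (X 3) ∩ zeroSet (X 0 ^ 2 + X 1 ^ 2 + X 2 ^ 2)

/-- The elliptic absolute, the image of the Euclidean absolute in the image plane. -/
def ellipticAbsolute (A : Matrix (Fin 3) (Fin 4) ℂ) : Set (PSpace 2) :=
  projImage A euclideanAbsolute

end TorusPicture

end

open MvPolynomial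

noncomputable section

namespace TorusPicture

/-! ### Forms on projective space -/

/-! Put b = 4R² and a = R² − r², with r possibly imaginary. The torus is a tube of radius r around a
circle of radius R. So a general plane (x : y : z : w), with u² = x² + y² and u'² = x² + y² + z²,
touches it exactly if w = −(Ru + ru') for some choice of the signs of u and u'; the point of contact
is then explicit (`IsRadii.torus_point`). The product over the four sign choices is the dual quartic
D, up to the factor 16 (`IsRadii.exists_sqrts`). The formula degenerates only on hypersurfaces that
have no component in common with D, so the Nullstellensatz shows that the closure of the set of
tangent planes is all of D = 0.

The dual of the absolute is q = x² + y² + z² = 0, and `dualTorusForm_eq` writes D = l² + q·k with l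
= bz² + 4w². Hence the two duals meet in q = l = 0, with multiplicity two because l enters squared.
Where q and l vanish, the gradient of D is k times that of q, with k = 4b(b − 4a)z². This
proportionality survives in the slice by o* and gives the tangency.

It remains to see that the dual picture is the slice of D by o*. The conic u² + z² = u'² is rational
in a parameter t, and incidence with o leaves one square root y² = g(t). Thus the tangent planes
through o, and their points of contact, are functions on a double cover of the t-line (`planeFun`,
`contactFun`). The projected contact point Q and its derivative DQ are both orthogonal to the
projected plane u. Any form that vanishes on the picture therefore has along Q a gradient
proportional to u, by Euler's identity and the chain rule; this identifies the dual
(`dual_eq_zeroSet_of_parametrization`). Two nondegeneracy facts are needed: the function ring is a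
domain, and Q × DQ ≠ 0. Both are read off at one branch point of the cover (`exists_branch_point`).

Squarefreeness and coprimality of the forms involved are tested on single lines. -/

theorem eval_smul_of_isHomogeneous {σ : Type*} {f : MvPolynomial σ ℂ} {d : ℕ}
    (hf : f.IsHomogeneous d) (c : ℂ) (v : σ → ℂ) : eval (c • v) f = c ^ d * eval v f := by
  simp only [eval_eq, Pi.smul_apply, smul_eq_mul, mul_pow, Finset.prod_mul_distrib,
    Finset.mul_sum, Finset.prod_pow_eq_pow_sum]
  refine Finset.sum_congr rfl fun m hm => ?_
  rw [hf.degree_eq_sum_deg_support hm]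
  ring

theorem exists_rep_mk {n : ℕ} {v : Fin (n + 1) → ℂ} (hv : v ≠ 0) :
    ∃ c : ℂ, c ≠ 0 ∧ (Projectivization.mk ℂ v hv).rep = c • v := by
  obtain ⟨c, hc⟩ := Projectivization.exists_smul_eq_mk_rep ℂ v hv
  exact ⟨c, c.ne_zero, hc.symm⟩

theorem eval_rep_mk_eq_zero_iff {n d : ℕ} {f : MvPolynomial (Fin (n + 1)) ℂ}
    (hf : f.IsHomogeneous d) {v : Fin (n + 1) → ℂ} (hv : v ≠ 0) :
    eval (Projectivization.mk ℂ v hv).rep f = 0 ↔ eval v f = 0 := by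
  obtain ⟨c, hc, h⟩ := exists_rep_mk hv
  rw [h, eval_smul_of_isHomogeneous hf, mul_eq_zero, or_iff_right (pow_ne_zero _ hc)]

theorem mk_mem_zeroSet {n d : ℕ} {f : MvPolynomial (Fin (n + 1)) ℂ}
    (hf : f.IsHomogeneous d) {v : Fin (n + 1) → ℂ} (hv : v ≠ 0) :
    Projectivization.mk ℂ v hv ∈ zeroSet f ↔ eval v f = 0 :=
  eval_rep_mk_eq_zero_iff hf hv

theorem subset_zariskiClosure {n : ℕ} (X : Set (PSpace n)) : X ⊆ zariskiClosure X :=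
  fun _ hp _ hf => hf.2 _ hp

theorem zariskiClosure_subset_zeroSet {n d : ℕ} {X : Set (PSpace n)}
    {f : MvPolynomial (Fin (n + 1)) ℂ} (hf : f.IsHomogeneous d) (h : X ⊆ zeroSet f) :
    zariskiClosure X ⊆ zeroSet f :=
  fun _ hp => hp f ⟨⟨d, hf⟩, fun _ hx => h hx⟩

/-! ### Restriction of forms to lines -/

/-- The restriction of a polynomial to the line `v + t v'`. -/
def lineMap {σ : Type*} (v v' : σ → ℂ) : MvPolynomial σ ℂ →ₐ[ℂ] Polynomial ℂ :=
  aeval fun i => Polynomial.C (v i) + Polynomial.X * Polynomial.C (v' i)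

theorem natDegree_linear_le (c c' : ℂ) :
    (Polynomial.C c + Polynomial.X * Polynomial.C c').natDegree ≤ 1 := by
  compute_degree

theorem natDegree_lineMap_le {σ : Type*} (v v' : σ → ℂ) (f : MvPolynomial σ ℂ) :
    (lineMap v v' f).natDegree ≤ f.totalDegree := by
  have := aeval_natDegree_le f le_rfl
    (fun i => Polynomial.C (v i) + Polynomial.X * Polynomial.C (v' i))
    (fun i => natDegree_linear_le (v i) (v' i))
  simpa [lineMap] using this

theorem eval_lineMap {σ : Type*} (v v' : σ → ℂ) (f : MvPolynomial σ ℂ) (t : ℂ) :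
    (lineMap v v' f).eval t = eval (v + t • v') f := by
  rw [lineMap, ← Polynomial.coe_aeval_eq_eval, ← AlgHom.comp_apply, comp_aeval]
  simp only [map_add, map_mul, Polynomial.aeval_C, Polynomial.aeval_X]
  rw [← MvPolynomial.coe_aeval_eq_eval]
  rfl

theorem coeff_prod_of_natDegree_le_sum {ι : Type*} (s : Finset ι) (p : ι → Polynomial ℂ)
    (n : ι → ℕ) (h : ∀ i, (p i).natDegree ≤ n i) :
    (∏ i ∈ s, p i).coeff (∑ i ∈ s, n i) = ∏ i ∈ s, (p i).coeff (n i) := by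
  classical
  induction s using Finset.induction_on with
  | empty => simp
  | insert i s hi ih =>
    rw [Finset.prod_insert hi, Finset.sum_insert hi, Finset.prod_insert hi,
      Polynomial.coeff_mul_add_eq_of_natDegree_le (h i), ih]
    exact (Polynomial.natDegree_prod_le _ _).trans (Finset.sum_le_sum fun i _ => h i)

theorem coeff_lineMap {σ : Type*} (v v' : σ → ℂ) {f : MvPolynomial σ ℂ} {d : ℕ}
    (hf : f.IsHomogeneous d) : (lineMap v v' f).coeff d = eval v' f := by
  rw [lineMap, aeval_def, eval₂_eq, eval_eq, Polynomial.finsetSum_coeff]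
  refine Finset.sum_congr rfl fun m hm => ?_
  have hdeg (i : σ) (k : ℕ) :
      ((Polynomial.C (v i) + Polynomial.X * Polynomial.C (v' i)) ^ k).natDegree ≤ k := by
    simpa using Polynomial.natDegree_pow_le_of_le k (natDegree_linear_le (v i) (v' i))
  rw [Polynomial.algebraMap_eq, Polynomial.coeff_C_mul, hf.degree_eq_sum_deg_support hm,
    coeff_prod_of_natDegree_le_sum _ _ _ fun i => hdeg i (m i)]
  congr 1
  refine Finset.prod_congr rfl fun i _ => ?_
  have := Polynomial.coeff_pow_of_natDegree_le (m := m i) (natDegree_linear_le (v i) (v' i))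
  simpa using this

section Line

variable {σ : Type*} {v v' : σ → ℂ} {f : MvPolynomial σ ℂ} {d : ℕ}

/-- The coefficient of t^d in f(v + tv') is f(v'), so f keeps its degree on the line. Degrees of
factors add up, so no factor can lose degree either, and nonunit factors remain nonunits on the
line. -/
theorem natDegree_lineMap_of_dvd (hf : f.IsHomogeneous d) (hv' : eval v' f ≠ 0)
    {p : MvPolynomial σ ℂ} (hp : p ∣ f) : (lineMap v v' p).natDegree = p.totalDegree := by
  obtain ⟨p', rfl⟩ := hp
  have hne : p * p' ≠ 0 := by
    rintro h
    simp [h] at hv'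
  have hc : (lineMap v v' (p * p')).coeff d ≠ 0 := by rwa [coeff_lineMap v v' hf]
  have hd : (lineMap v v' (p * p')).natDegree = (p * p').totalDegree := by
    refine le_antisymm (natDegree_lineMap_le _ _ _) ?_
    rw [hf.totalDegree hne]
    exact Polynomial.le_natDegree_of_ne_zero hc
  have hl : lineMap v v' p * lineMap v v' p' ≠ 0 := by
    intro h
    rw [map_mul, h] at hc
    simp at hc
  rw [totalDegree_mul_of_isDomain (left_ne_zero_of_mul hne) (right_ne_zero_of_mul hne), map_mul,
    Polynomial.natDegree_mul (left_ne_zero_of_mul hl) (right_ne_zero_of_mul hl)] at hd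
  have h1 := natDegree_lineMap_le v v' p
  have h2 := natDegree_lineMap_le v v' p'
  omega

theorem isUnit_of_isUnit_lineMap (hf : f.IsHomogeneous d) (hv' : eval v' f ≠ 0)
    {p : MvPolynomial σ ℂ} (hp : p ∣ f) (hu : IsUnit (lineMap v v' p)) : IsUnit p := by
  have h := natDegree_lineMap_of_dvd (v := v) hf hv' hp
  rw [Polynomial.natDegree_eq_zero_of_isUnit hu] at h
  rw [MvPolynomial.isUnit_iff_totalDegree_of_isReduced]
  refine ⟨?_, h.symm⟩
  have hp0 := totalDegree_eq_zero_iff_eq_C.mp h.symm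
  rw [isUnit_iff_ne_zero]
  intro h0
  rw [h0, map_zero] at hp0
  rw [hp0, map_zero] at hu
  exact not_isUnit_zero hu

theorem squarefree_of_squarefree_lineMap (hf : f.IsHomogeneous d) (hv' : eval v' f ≠ 0)
    (h : Squarefree (lineMap v v' f)) : Squarefree f := fun p hp =>
  isUnit_of_isUnit_lineMap hf hv' (dvd_of_mul_left_dvd hp)
    (h _ (by rw [← map_mul]; exact map_dvd _ hp))

theorem isRelPrime_of_isCoprime_lineMap (hf : f.IsHomogeneous d) (hv' : eval v' f ≠ 0)
    {g : MvPolynomial σ ℂ} (h : IsCoprime (lineMap v v' f) (lineMap v v' g)) : IsRelPrime f g :=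
  fun _ hpf hpg => isUnit_of_isUnit_lineMap hf hv' hpf
    (h.isRelPrime (map_dvd _ hpf) (map_dvd _ hpg))

theorem exists_eval_line_eq_zero (hf : f.IsHomogeneous d) (hd : d ≠ 0) (hv' : eval v' f ≠ 0) :
    ∃ t : ℂ, eval (v + t • v') f = 0 := by
  have hc : (lineMap v v' f).coeff d ≠ 0 := by rwa [coeff_lineMap v v' hf]
  have hdeg : (lineMap v v' f).degree ≠ 0 := by
    intro h
    have := Polynomial.le_natDegree_of_ne_zero hc
    rw [Polynomial.natDegree_eq_of_degree_eq_some h] at this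
    exact hd (Nat.le_zero.mp this)
  obtain ⟨t, ht⟩ := IsAlgClosed.exists_root _ hdeg
  exact ⟨t, by rwa [← eval_lineMap]⟩

end Line

/-- The biquadratic `α t ^ 4 + β t ^ 2 + γ` has no multiple roots if its discriminant is nonzero. -/
theorem squarefree_biquadratic {α β γ : ℂ} (hγ : γ ≠ 0)
    (h : β ^ 2 - 4 * α * γ ≠ 0) :
    Squarefree (Polynomial.C α * Polynomial.X ^ 4 + Polynomial.C β * Polynomial.X ^ 2
      + Polynomial.C γ) := by
  refine Polynomial.Separable.squarefree ?_
  rw [Polynomial.separable_def, Polynomial.isCoprime_iff_aeval_ne_zero_of_isAlgClosed ℂ ℂ]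
  intro t
  by_contra! hc
  obtain ⟨h1, h2⟩ := hc
  simp at h1 h2
  have h3 : t * (2 * α * t ^ 2 + β) = 0 := by linear_combination h2 / 2
  rcases mul_eq_zero.mp h3 with h3 | h3
  · apply hγ
    simpa [h3] using h1
  · apply h
    linear_combination (-4 * α) * h1 + (2 * α * t ^ 2 + β) * h3

/-! ### Hypersurfaces without multiple components -/

theorem zeroSet_nonempty {n d : ℕ} {f : MvPolynomial (Fin (n + 2)) ℂ} (hf : f.IsHomogeneous d)
    (hd : d ≠ 0) : (zeroSet f).Nonempty := by
  by_cases h0 : eval (Pi.single 0 1) f = 0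
  · exact ⟨.mk ℂ (Pi.single 0 1) (by simp), (mk_mem_zeroSet hf _).mpr h0⟩
  · obtain ⟨t, ht⟩ := exists_eval_line_eq_zero (v := Pi.single 1 1) hf hd h0
    have hne : (Pi.single 1 1 + t • Pi.single 0 1 : Fin (n + 2) → ℂ) ≠ 0 := by
      intro h
      simpa using congrFun h 1
    exact ⟨.mk ℂ _ hne, (mk_mem_zeroSet hf _).mpr ht⟩

/-- By the Nullstellensatz `f` divides a power of `g`, and a squarefree polynomial generates a
radical ideal. -/
theorem dvd_of_eval_eq_zero {σ : Type*} [Finite σ] {f g : MvPolynomial σ ℂ} (hsq : Squarefree f)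
    (h : ∀ v, eval v f = 0 → eval v g = 0) : f ∣ g := by
  have hvan : g ∈ vanishingIdeal ℂ (zeroLocus ℂ (Ideal.span {f})) := fun v hv =>
    h v (by simpa [MvPolynomial.coe_aeval_eq_eval] using hv f (Ideal.mem_span_singleton_self f))
  rw [vanishingIdeal_zeroLocus_eq_radical] at hvan
  obtain ⟨k, hk⟩ := hvan
  rw [Ideal.mem_span_singleton] at hk
  exact hsq.isRadical k g hk

section Hypersurface

variable {n d : ℕ} {f : MvPolynomial (Fin (n + 2)) ℂ}

theorem dvd_of_mem_formsVanishingOn (hf : f.IsHomogeneous d) (hd : d ≠ 0) (hsq : Squarefree f)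
    {g : MvPolynomial (Fin (n + 2)) ℂ} (hg : g ∈ formsVanishingOn (zeroSet f)) : f ∣ g := by
  obtain ⟨⟨e, hge⟩, hg⟩ := hg
  refine dvd_of_eval_eq_zero hsq fun v hv => ?_
  -- The origin represents no projective point. There g(0) = 0^e · g(p) for a zero p of f, which
  -- covers constant g as well.
  by_cases h0 : v = 0
  · obtain ⟨p, hp⟩ := zeroSet_nonempty hf hd
    have := eval_smul_of_isHomogeneous hge 0 p.rep
    simpa [h0, hg p hp] using this
  · exact (eval_rep_mk_eq_zero_iff hge h0).mp (hg _ ((mk_mem_zeroSet hf h0).mpr hv))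

theorem mem_formsVanishingOn_zeroSet (hf : f.IsHomogeneous d) :
    f ∈ formsVanishingOn (zeroSet f) := ⟨⟨d, hf⟩, fun _ h => h⟩

theorem homogeneousIdeal_zeroSet (hf : f.IsHomogeneous d) (hd : d ≠ 0) (hsq : Squarefree f) :
    homogeneousIdeal (zeroSet f) = Ideal.span {f} := by
  refine le_antisymm (Ideal.span_le.mpr fun g hg => ?_) (Ideal.span_le.mpr ?_)
  · exact Ideal.mem_span_singleton.mpr (dvd_of_mem_formsVanishingOn hf hd hsq hg)
  · rw [Set.singleton_subset_iff]
    exact Ideal.subset_span (mem_formsVanishingOn_zeroSet hf)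

theorem mem_tangentSpace_zeroSet (hf : f.IsHomogeneous d) (hd : d ≠ 0) (hsq : Squarefree f)
    {p : PSpace (n + 1)} (hp : p ∈ zeroSet f) (v : Fin (n + 2) → ℂ) :
    v ∈ tangentSpace (zeroSet f) p ↔ ∑ i, eval p.rep (pderiv i f) * v i = 0 := by
  refine ⟨fun h => h f (mem_formsVanishingOn_zeroSet hf), fun h g hg => ?_⟩
  obtain ⟨k, rfl⟩ := dvd_of_mem_formsVanishingOn hf hd hsq hg
  have hp' : eval p.rep f = 0 := hp
  simp only [pderiv_mul, map_add, map_mul, hp', zero_mul, add_zero]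
  calc _ = eval p.rep k * ∑ i, eval p.rep (pderiv i f) * v i := by
        rw [Finset.mul_sum]
        exact Finset.sum_congr rfl fun i _ => by ring
    _ = 0 := by rw [h, mul_zero]

end Hypersurface

/-! ### Hyperplanes in coordinate space -/

/-- The linear form with coefficient vector `c`. -/
def linearForm {n : ℕ} (c : Fin (n + 1) → ℂ) : Module.Dual ℂ (Fin (n + 1) → ℂ) where
  toFun v := ∑ i, c i * v i
  map_add' u v := by simp [mul_add, Finset.sum_add_distrib]
  map_smul' a v := by
    simp only [Pi.smul_apply, smul_eq_mul, RingHom.id_apply, Finset.mul_sum]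
    exact Finset.sum_congr rfl fun i _ => by ring

theorem linearForm_apply {n : ℕ} (c v : Fin (n + 1) → ℂ) : linearForm c v = ∑ i, c i * v i := rfl

theorem linearForm_single {n : ℕ} (c : Fin (n + 1) → ℂ) (i : Fin (n + 1)) :
    linearForm c (Pi.single i 1) = c i := by
  simp [linearForm_apply, Pi.single_apply]

theorem linearForm_ne_zero {n : ℕ} {c : Fin (n + 1) → ℂ} (hc : c ≠ 0) : linearForm c ≠ 0 := by
  intro h
  apply hc
  ext i
  rw [← linearForm_single c, h]
  rfl

theorem finrank_ker_linearForm {n : ℕ} {c : Fin (n + 1) → ℂ} (hc : c ≠ 0) :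
    Module.finrank ℂ (LinearMap.ker (linearForm c)) = n := by
  have := Module.Dual.finrank_ker_add_one_of_ne_zero (linearForm_ne_zero hc)
  simpa using this

/-- The vectors c_j e_i − c_i e_j lie in the kernel of c, and evaluating c' on them gives
proportionality. The case c = 0 is included. -/
theorem exists_eq_smul_of_ker_le {n : ℕ} {c c' : Fin (n + 1) → ℂ}
    (h : LinearMap.ker (linearForm c) ≤ LinearMap.ker (linearForm c')) : ∃ a : ℂ, c' = a • c := by
  have hrel (i j : Fin (n + 1)) : c j * c' i = c i * c' j := by
    have hmem : c j • Pi.single i 1 - c i • Pi.single j 1 ∈ LinearMap.ker (linearForm c) := by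
      rw [LinearMap.mem_ker, map_sub, map_smul, map_smul, linearForm_single, linearForm_single]
      simp [mul_comm]
    have := h hmem
    rw [LinearMap.mem_ker, map_sub, map_smul, map_smul, linearForm_single, linearForm_single,
      smul_eq_mul, smul_eq_mul] at this
    linear_combination this
  by_cases hc : ∃ k, c k ≠ 0
  · obtain ⟨k, hk⟩ := hc
    refine ⟨c' k / c k, funext fun i => ?_⟩
    rw [Pi.smul_apply, smul_eq_mul]
    field_simp
    linear_combination hrel i k
  · push Not at hc
    refine ⟨0, funext fun i => ?_⟩
    have hmem : (Pi.single i 1 : Fin (n + 1) → ℂ) ∈ LinearMap.ker (linearForm c) := by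
      rw [LinearMap.mem_ker, linearForm_single, hc]
    have := h hmem
    rw [LinearMap.mem_ker, linearForm_single] at this
    simp [this]

/-! ### Gradients and tangent spaces of hypersurfaces -/

/-- The gradient of a polynomial at a vector. -/
def grad {n : ℕ} (f : MvPolynomial (Fin (n + 1)) ℂ) (v : Fin (n + 1) → ℂ) : Fin (n + 1) → ℂ :=
  fun i => eval v (pderiv i f)

theorem grad_smul {n d : ℕ} {f : MvPolynomial (Fin (n + 1)) ℂ} (hf : f.IsHomogeneous d)
    (c : ℂ) (v : Fin (n + 1) → ℂ) : grad f (c • v) = c ^ (d - 1) • grad f v :=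
  funext fun _ => eval_smul_of_isHomogeneous hf.pderiv c v

theorem dotProduct_eq_linearForm {n : ℕ} (c v : Fin (n + 1) → ℂ) : c ⬝ᵥ v = linearForm c v := rfl

section Hypersurface

variable {n d : ℕ} {f : MvPolynomial (Fin (n + 2)) ℂ}

theorem tangentSpace_zeroSet (hf : f.IsHomogeneous d) (hd : d ≠ 0) (hsq : Squarefree f)
    {p : PSpace (n + 1)} (hp : p ∈ zeroSet f) :
    tangentSpace (zeroSet f) p = LinearMap.ker (linearForm (grad f p.rep)) := by
  ext v
  rw [mem_tangentSpace_zeroSet hf hd hsq hp, LinearMap.mem_ker]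
  rfl

theorem isNonsingularPoint_zeroSet_iff (hf : f.IsHomogeneous d) (hd : d ≠ 0)
    (hsq : Squarefree f) {p : PSpace (n + 1)} :
    IsNonsingularPoint n (zeroSet f) p ↔ p ∈ zeroSet f ∧ grad f p.rep ≠ 0 := by
  refine and_congr_right fun hp => ?_
  rw [tangentSpace_zeroSet hf hd hsq hp]
  refine ⟨fun h h0 => ?_, finrank_ker_linearForm⟩
  have h1 : linearForm (grad f p.rep) = 0 := by
    ext
    simp [linearForm_apply, h0]
  rw [h1, LinearMap.ker_zero, finrank_top, Module.finrank_fin_fun] at h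
  omega

end Hypersurface

/-! ### The torus, its dual and the absolute: elementary properties -/

theorem eval_torusForm (a b : ℝ) (v : Fin 4 → ℂ) :
    eval v (torusForm a b) = (v 0 ^ 2 + v 1 ^ 2 + v 2 ^ 2 + a * v 3 ^ 2) ^ 2
      - b * (v 0 ^ 2 + v 1 ^ 2) * v 3 ^ 2 := by
  simp [torusForm]

theorem grad_torusForm (a b : ℝ) (v : Fin 4 → ℂ) :
    grad (torusForm a b) v =
      ![4 * (v 0 ^ 2 + v 1 ^ 2 + v 2 ^ 2 + a * v 3 ^ 2) * v 0 - 2 * b * v 3 ^ 2 * v 0,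
        4 * (v 0 ^ 2 + v 1 ^ 2 + v 2 ^ 2 + a * v 3 ^ 2) * v 1 - 2 * b * v 3 ^ 2 * v 1,
        4 * (v 0 ^ 2 + v 1 ^ 2 + v 2 ^ 2 + a * v 3 ^ 2) * v 2,
        4 * a * (v 0 ^ 2 + v 1 ^ 2 + v 2 ^ 2 + a * v 3 ^ 2) * v 3
          - 2 * b * (v 0 ^ 2 + v 1 ^ 2) * v 3] := by
  ext i
  fin_cases i <;>
  · simp [grad, torusForm, pderiv_X]
    ring

theorem eval_dualTorusForm (a b : ℝ) (v : Fin 4 → ℂ) :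
    eval v (dualTorusForm a b) =
      16 * (a * v 0 ^ 2 + a * v 1 ^ 2 + a * v 2 ^ 2 + v 3 ^ 2) ^ 2
      - 8 * b * (v 0 ^ 2 + v 1 ^ 2) * (a * v 2 ^ 2 + 2 * v 3 ^ 2)
      + ((b : ℂ) ^ 2 - 8 * a * b) * v 2 ^ 4 - 8 * b * v 2 ^ 2 * v 3 ^ 2 := by
  simp [dualTorusForm]

/-- The form `x² + y² + z²`, which defines the dual of the Euclidean absolute. -/
def absoluteForm : MvPolynomial (Fin 4) ℂ := X 0 ^ 2 + X 1 ^ 2 + X 2 ^ 2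

theorem eval_absoluteForm (v : Fin 4 → ℂ) :
    eval v absoluteForm = v 0 ^ 2 + v 1 ^ 2 + v 2 ^ 2 := by
  simp [absoluteForm]

theorem isHomogeneous_absoluteForm : absoluteForm.IsHomogeneous 2 :=
  ((isHomogeneous_X_pow 0 2).add (isHomogeneous_X_pow 1 2)).add (isHomogeneous_X_pow 2 2)

theorem isHomogeneous_torusForm (a b : ℝ) : (torusForm a b).IsHomogeneous 4 := by
  have h1 := (isHomogeneous_absoluteForm.add (isHomogeneous_C_mul_X_pow (a : ℂ) 3 2)).pow 2
  have h2 : ((X 0 ^ 2 + X 1 ^ 2 : MvPolynomial (Fin 4) ℂ)).IsHomogeneous 2 :=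
    (isHomogeneous_X_pow 0 2).add (isHomogeneous_X_pow 1 2)
  exact h1.sub ((h2.C_mul _).mul (isHomogeneous_X_pow 3 2))

theorem isHomogeneous_dualTorusForm (a b : ℝ) : (dualTorusForm a b).IsHomogeneous 4 := by
  have hx (i : Fin 4) : (X i ^ 2 : MvPolynomial (Fin 4) ℂ).IsHomogeneous 2 :=
    isHomogeneous_X_pow i 2
  have h1 := (((((hx 0).C_mul a).add ((hx 1).C_mul a)).add ((hx 2).C_mul a)).add (hx 3)).pow 2
  have h2 := (((hx 0).add (hx 1)).C_mul b).C_mul 8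
  have h3 := ((hx 2).C_mul a).add ((hx 3).C_mul 2)
  have h4 := (isHomogeneous_X_pow 2 4 : (X 2 ^ 4 : MvPolynomial (Fin 4) ℂ).IsHomogeneous 4).C_mul
    ((b : ℂ) ^ 2 - 8 * a * b)
  have h5 := (((hx 2).mul (hx 3)).C_mul b).C_mul 8
  have h6 := (((h1.C_mul 16).sub (h2.mul h3)).add h4).sub h5
  have e : dualTorusForm a b =
      C 16 * (C (a : ℂ) * X 0 ^ 2 + C (a : ℂ) * X 1 ^ 2 + C (a : ℂ) * X 2 ^ 2 + X 3 ^ 2) ^ 2 -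
        C 8 * (C (b : ℂ) * (X 0 ^ 2 + X 1 ^ 2)) * (C (a : ℂ) * X 2 ^ 2 + C 2 * X 3 ^ 2) +
        C ((b : ℂ) ^ 2 - 8 * a * b) * X 2 ^ 4 - C 8 * (C (b : ℂ) * (X 2 ^ 2 * X 3 ^ 2)) := by
    simp only [dualTorusForm, map_ofNat]
    ring
  rw [e]
  exact h6

/-- On the line (t : 0 : 0 : 1) the form is t⁴ + (2a − b)t² + a², with discriminant b(b − 4a). -/
theorem squarefree_torusForm {a b : ℝ} (ha : a ≠ 0) (hb : b ≠ 0) (hab : b ≠ 4 * a) :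
    Squarefree (torusForm a b) := by
  refine squarefree_of_squarefree_lineMap (v := ![0, 0, 0, 1]) (v' := ![1, 0, 0, 0])
    (isHomogeneous_torusForm a b) (by simp [eval_torusForm]) ?_
  have e : lineMap ![0, 0, 0, 1] ![1, 0, 0, 0] (torusForm a b) =
      Polynomial.C 1 * Polynomial.X ^ 4 + Polynomial.C (2 * a - b : ℂ) * Polynomial.X ^ 2
        + Polynomial.C ((a : ℂ) ^ 2) := by
    refine Polynomial.funext fun t => ?_
    rw [eval_lineMap, eval_torusForm]
    simp
    ring
  rw [e]
  refine squarefree_biquadratic (by simpa using ha) ?_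
  have h : (b : ℂ) * (b - 4 * a) ≠ 0 := by
    refine mul_ne_zero (by exact_mod_cast hb) (sub_ne_zero.mpr (by exact_mod_cast hab))
  intro h'
  apply h
  linear_combination h'

/-- On the pencil (1 : 0 : 0 : t) the quartic keeps its degree and has discriminant b(b − 4a) up to
a constant, while the auxiliary forms in `dual_torus` are constant. So this one line gives both
squarefreeness and coprimality. -/
theorem lineMap_dualTorusForm (a b : ℝ) :
    lineMap ![1, 0, 0, 0] ![0, 0, 0, 1] (dualTorusForm a b) =
      Polynomial.C 16 * Polynomial.X ^ 4 + Polynomial.C (16 * (2 * a - b) : ℂ) * Polynomial.X ^ 2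
        + Polynomial.C (16 * (a : ℂ) ^ 2) := by
  refine Polynomial.funext fun t => ?_
  rw [eval_lineMap, eval_dualTorusForm]
  simp
  ring

theorem eval_dualTorusForm_single (a b : ℝ) : eval ![0, 0, 0, 1] (dualTorusForm a b) ≠ 0 := by
  simp [eval_dualTorusForm]

theorem squarefree_dualTorusForm {a b : ℝ} (ha : a ≠ 0) (hb : b ≠ 0) (hab : b ≠ 4 * a) :
    Squarefree (dualTorusForm a b) := by
  refine squarefree_of_squarefree_lineMap (v := ![1, 0, 0, 0])
    (isHomogeneous_dualTorusForm a b) (eval_dualTorusForm_single a b) ?_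
  rw [lineMap_dualTorusForm]
  refine squarefree_biquadratic (by simpa using ha) ?_
  have h : (b : ℂ) * (b - 4 * a) ≠ 0 := by
    refine mul_ne_zero (by exact_mod_cast hb) (sub_ne_zero.mpr (by exact_mod_cast hab))
  intro h'
  apply h
  linear_combination h' / 256

/-- A form that is a nonzero constant on a suitable line has no factor in common with the form of
the dual torus. -/
theorem isRelPrime_dualTorusForm (a b : ℝ) {g : MvPolynomial (Fin 4) ℂ} {c : ℂ} (hc : c ≠ 0)
    (h : lineMap ![1, 0, 0, 0] ![0, 0, 0, 1] g = Polynomial.C c) :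
    IsRelPrime (dualTorusForm a b) g := by
  refine isRelPrime_of_isCoprime_lineMap (v := ![1, 0, 0, 0])
    (isHomogeneous_dualTorusForm a b) (eval_dualTorusForm_single a b) ?_
  rw [h]
  exact ⟨0, Polynomial.C c⁻¹, by rw [zero_mul, zero_add, ← map_mul, inv_mul_cancel₀ hc, map_one]⟩

/-! ### Radii -/

/-- The radii `R`, `r` of a torus: `b = 4 R²` and `a = R² - r²`. The second one may be imaginary. -/
structure IsRadii (a b : ℝ) (R : ℝ) (r : ℂ) : Prop where
  ha : (a : ℂ) = (R : ℂ) ^ 2 - r ^ 2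
  hb : (b : ℂ) = 4 * (R : ℂ) ^ 2
  R_ne : (R : ℂ) ≠ 0
  r_ne : r ≠ 0
  a_ne : (a : ℂ) ≠ 0

theorem exists_isRadii {a b : ℝ} (ha : 0 < a) (hb : 0 < b) (hab : b ≠ 4 * a) :
    ∃ (R : ℝ) (r : ℂ), IsRadii a b R r := by
  obtain ⟨r, hr⟩ := IsAlgClosed.exists_pow_nat_eq ((b : ℂ) / 4 - a) two_pos
  have hR : (Real.sqrt (b / 4) : ℂ) ^ 2 = b / 4 := by
    have := Real.sq_sqrt (show 0 ≤ b / 4 by positivity)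
    exact_mod_cast this
  refine ⟨Real.sqrt (b / 4), r, ?_, ?_, ?_, ?_, ?_⟩
  · rw [hR, hr]; ring
  · rw [hR]; ring
  · rw [Complex.ofReal_ne_zero]; positivity
  · rintro rfl
    apply hab
    have : (b : ℂ) = 4 * a := by linear_combination -4 * hr
    exact_mod_cast this
  · exact_mod_cast ha.ne'

/-- As a polynomial in w, the dual form is 16 times the product of the four factors w ± Ru ± ru'.
Changing the signs of u and u' turns the factor that vanishes into w + Ru + ru'. -/
theorem IsRadii.exists_sqrts {a b : ℝ} {R : ℝ} {r : ℂ} (h : IsRadii a b R r) {v : Fin 4 → ℂ}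
    (hv : eval v (dualTorusForm a b) = 0) :
    ∃ u u' : ℂ, v 0 ^ 2 + v 1 ^ 2 = u ^ 2 ∧ v 2 ^ 2 = u' ^ 2 - u ^ 2 ∧ v 3 = -(R * u + r * u') := by
  obtain ⟨u, hu⟩ := IsAlgClosed.exists_pow_nat_eq (v 0 ^ 2 + v 1 ^ 2) two_pos
  obtain ⟨u', hu'⟩ := IsAlgClosed.exists_pow_nat_eq (v 0 ^ 2 + v 1 ^ 2 + v 2 ^ 2) two_pos
  have hz : v 2 ^ 2 = u' ^ 2 - u ^ 2 := by linear_combination hu - hu'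
  have hs := hu.symm
  rw [eval_dualTorusForm] at hv
  have hv' : 16 * (a * (v 0 ^ 2 + v 1 ^ 2) + a * v 2 ^ 2 + v 3 ^ 2) ^ 2
      - 8 * b * (v 0 ^ 2 + v 1 ^ 2) * (a * v 2 ^ 2 + 2 * v 3 ^ 2)
      + ((b : ℂ) ^ 2 - 8 * a * b) * (v 2 ^ 2) ^ 2 - 8 * b * v 2 ^ 2 * v 3 ^ 2 = 0 := by
    linear_combination hv
  rw [hs, hz, h.ha, h.hb] at hv'
  have key : (v 3 + (R * u + r * u')) * (v 3 - (R * u + r * u')) *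
      ((v 3 + (R * u - r * u')) * (v 3 - (R * u - r * u'))) = 0 := by
    linear_combination hv' / 16
  rcases mul_eq_zero.mp key with key | key <;> rcases mul_eq_zero.mp key with key | key
  · exact ⟨u, u', hs, hz, by linear_combination key⟩
  · exact ⟨-u, -u', by rw [hs]; ring, by rw [hz]; ring, by linear_combination key⟩
  · exact ⟨u, -u', by rw [hs], by rw [hz]; ring, by linear_combination key⟩
  · exact ⟨-u, u', by rw [hs]; ring, by rw [hz]; ring, by linear_combination key⟩

theorem IsRadii.eval_dualTorusForm {a b : ℝ} {R : ℝ} {r : ℂ} (h : IsRadii a b R r)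
    {v : Fin 4 → ℂ} {u u' : ℂ} (hs : v 0 ^ 2 + v 1 ^ 2 = u ^ 2) (hz : v 2 ^ 2 = u' ^ 2 - u ^ 2)
    (hw : v 3 = -(R * u + r * u')) : eval v (dualTorusForm a b) = 0 := by
  have e : eval v (dualTorusForm a b) =
      16 * (a * (v 0 ^ 2 + v 1 ^ 2) + a * v 2 ^ 2 + v 3 ^ 2) ^ 2
      - 8 * b * (v 0 ^ 2 + v 1 ^ 2) * (a * v 2 ^ 2 + 2 * v 3 ^ 2)
      + ((b : ℂ) ^ 2 - 8 * a * b) * (v 2 ^ 2) ^ 2 - 8 * b * v 2 ^ 2 * v 3 ^ 2 := by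
    rw [TorusPicture.eval_dualTorusForm]
    ring
  rw [e, hs, hz, hw, h.ha, h.hb]
  ring

/-- The nonsingular points of the torus and their tangent planes, in terms of the distance
`t` from the axis. -/
theorem IsRadii.exists_axis_distance {a b : ℝ} {R : ℝ} {r : ℂ} (h : IsRadii a b R r)
    {v : Fin 4 → ℂ} (hv : eval v (torusForm a b) = 0) (hg : grad (torusForm a b) v ≠ 0) :
    v 3 ≠ 0 ∧ ∃ t : ℂ, v 0 ^ 2 + v 1 ^ 2 = t ^ 2 ∧
      t ^ 2 + v 2 ^ 2 + a * v 3 ^ 2 = 2 * R * t * v 3 ∧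
      grad (torusForm a b) v = (8 * R * v 3) •
        ![(t - R * v 3) * v 0, (t - R * v 3) * v 1, t * v 2, t * (a * v 3 - R * t)] := by
  -- At infinity the torus is the absolute conic counted twice, and the gradient vanishes there.
  have hw : v 3 ≠ 0 := by
    intro hw
    apply hg
    rw [eval_torusForm, hw] at hv
    have hq : v 0 ^ 2 + v 1 ^ 2 + v 2 ^ 2 = 0 := by
      rw [← sq_eq_zero_iff]
      linear_combination hv
    rw [grad_torusForm, hw]
    ext i
    fin_cases i <;> simp [hq]
  have hR := h.R_ne
  rw [eval_torusForm] at hv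
  -- The torus equation makes this quotient a square root of x² + y². Choosing it as t fixes the
  -- sign in t² + z² + aw² = 2Rtw.
  have ht : v 0 ^ 2 + v 1 ^ 2 =
      ((v 0 ^ 2 + v 1 ^ 2 + v 2 ^ 2 + a * v 3 ^ 2) / (2 * R * v 3)) ^ 2 := by
    field_simp
    rw [h.hb] at hv
    linear_combination -hv
  generalize htd : (v 0 ^ 2 + v 1 ^ 2 + v 2 ^ 2 + a * v 3 ^ 2) / (2 * R * v 3) = t at ht
  have hW : v 0 ^ 2 + v 1 ^ 2 + v 2 ^ 2 + a * v 3 ^ 2 = 2 * R * t * v 3 := by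
    rw [← htd]
    field_simp
  refine ⟨hw, t, ht, by rw [← hW, ht], ?_⟩
  rw [grad_torusForm, hW, h.hb, ht]
  ext i
  fin_cases i <;> simp <;> ring

/-- Up to the factor 8Rw the gradient has the square roots u = (t − Rw)t and u' = trw, and its last
coordinate is then −(Ru + ru'). -/
theorem IsRadii.eval_dualTorusForm_grad {a b : ℝ} {R : ℝ} {r : ℂ} (h : IsRadii a b R r)
    {v : Fin 4 → ℂ} (hv : eval v (torusForm a b) = 0) (hg : grad (torusForm a b) v ≠ 0) :
    eval (grad (torusForm a b) v) (dualTorusForm a b) = 0 := by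
  obtain ⟨-, t, ht, hW, e⟩ := h.exists_axis_distance hv hg
  rw [e, eval_smul_of_isHomogeneous (isHomogeneous_dualTorusForm a b)]
  refine mul_eq_zero_of_right _
    (h.eval_dualTorusForm (u := (t - R * v 3) * t) (u' := t * r * v 3) ?_ ?_ ?_)
  · simp
    linear_combination (t - R * v 3) ^ 2 * ht
  · simp
    linear_combination t ^ 2 * (hW - v 3 ^ 2 * h.ha)
  · simp
    linear_combination t * v 3 * h.ha

/-- The point of the torus in which a general tangent plane touches it. -/
theorem IsRadii.torus_point {a b : ℝ} {R : ℝ} {r : ℂ} (h : IsRadii a b R r)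
    {v : Fin 4 → ℂ} {u u' : ℂ} (hs : v 0 ^ 2 + v 1 ^ 2 = u ^ 2) (hz : v 2 ^ 2 = u' ^ 2 - u ^ 2)
    (hw : v 3 = -(R * u + r * u')) {P : Fin 4 → ℂ}
    (hP : P = ![(R * u' + r * u) * v 0, (R * u' + r * u) * v 1, r * u * v 2, u * u']) :
    eval P (torusForm a b) = 0 ∧
      grad (torusForm a b) P = (8 * R * r * (R * u' + r * u) * u ^ 3 * u') • v := by
  -- Dehomogenized, P is the point R(x, y, 0)/u of the core circle plus r times the unit normal (x,
  -- y, z)/u'.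
  have hW : P 0 ^ 2 + P 1 ^ 2 + P 2 ^ 2 + a * P 3 ^ 2 =
      2 * R * (R * u' + r * u) * u ^ 2 * u' := by
    simp [hP]
    linear_combination (R * u' + r * u) ^ 2 * hs + r ^ 2 * u ^ 2 * hz + u ^ 2 * u' ^ 2 * h.ha
  constructor
  · rw [eval_torusForm, hW, h.hb]
    simp [hP]
    linear_combination -4 * R ^ 2 * (R * u' + r * u) ^ 2 * u ^ 2 * u' ^ 2 * hs
  · rw [grad_torusForm, hW, h.hb, h.ha]
    ext i
    fin_cases i <;> simp [hP]
    · ring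
    · ring
    · ring
    · rw [hw]
      linear_combination -8 * R ^ 2 * (R * u' + r * u) ^ 2 * u * u' * hs

/-! ### The dual of the torus -/

/-- The points of the projective hypersurface `f = 0` and its tangent hyperplanes. -/
theorem exists_smul_grad_of_tangent {n d : ℕ} {f : MvPolynomial (Fin (n + 2)) ℂ}
    (hf : f.IsHomogeneous d) (hd : d ≠ 0) (hsq : Squarefree f) {p h : PSpace (n + 1)}
    (hp : p ∈ zeroSet f) (hh : ∀ v ∈ tangentSpace (zeroSet f) p, h.rep ⬝ᵥ v = 0) :
    ∃ c : ℂ, h.rep = c • grad f p.rep := by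
  rw [tangentSpace_zeroSet hf hd hsq hp] at hh
  exact exists_eq_smul_of_ker_le fun v hv => hh v hv

theorem dual_zeroSet_subset {n d e : ℕ} {f g : MvPolynomial (Fin (n + 2)) ℂ}
    (hf : f.IsHomogeneous d) (hd : d ≠ 0) (hsq : Squarefree f) (hg : g.IsHomogeneous e)
    (h : ∀ v, eval v f = 0 → grad f v ≠ 0 → eval (grad f v) g = 0) :
    dual n (zeroSet f) ⊆ zeroSet g := by
  refine zariskiClosure_subset_zeroSet hg ?_
  rintro H ⟨p, hp, hH⟩
  rw [isNonsingularPoint_zeroSet_iff hf hd hsq] at hp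
  obtain ⟨c, hc⟩ := exists_smul_grad_of_tangent hf hd hsq hp.1 hH
  change eval H.rep g = 0
  rw [hc, eval_smul_of_isHomogeneous hg, h _ hp.1 hp.2, mul_zero]

/-- A point whose coordinate vector is the gradient of `f` at a zero of `f` belongs to the dual. -/
theorem mem_tangents_zeroSet {n d : ℕ} {f : MvPolynomial (Fin (n + 2)) ℂ}
    (hf : f.IsHomogeneous d) (hd : d ≠ 0) (hsq : Squarefree f) {H : PSpace (n + 1)}
    {v : Fin (n + 2) → ℂ} (hv : eval v f = 0) (hv0 : v ≠ 0) {c : ℂ} (hc : c ≠ 0)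
    (hg : grad f v = c • H.rep) :
    ∃ p, IsNonsingularPoint n (zeroSet f) p ∧ ∀ v ∈ tangentSpace (zeroSet f) p, H.rep ⬝ᵥ v = 0 := by
  have hp : Projectivization.mk ℂ v hv0 ∈ zeroSet f := (mk_mem_zeroSet hf hv0).mpr hv
  obtain ⟨k, hk, hrep⟩ := exists_rep_mk hv0
  have hgr : grad f (Projectivization.mk ℂ v hv0).rep = (k ^ (d - 1) * c) • H.rep := by
    rw [hrep, grad_smul hf, hg, mul_smul]
  have hkc : k ^ (d - 1) * c ≠ 0 := mul_ne_zero (pow_ne_zero _ hk) hc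
  refine ⟨_, (isNonsingularPoint_zeroSet_iff hf hd hsq).mpr ⟨hp, ?_⟩, fun x hx => ?_⟩
  · rw [hgr]
    exact smul_ne_zero hkc H.rep_nonzero
  · rw [tangentSpace_zeroSet hf hd hsq hp, hgr, LinearMap.mem_ker] at hx
    rw [dotProduct_eq_linearForm]
    refine (mul_eq_zero_iff_left hkc).mp ?_
    rw [← hx]
    simp [linearForm_apply, Finset.mul_sum, mul_assoc]

/-- Off s = 0, q = 0 and k = 0 the explicit contact point is nonsingular and has the given tangent
plane. So a form that vanishes on the tangent planes vanishes on the whole quartic after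
multiplication by s·q·k. The quartic is squarefree and coprime to these three factors, hence divides
the form itself. -/
theorem dual_torus {a b : ℝ} (ha : 0 < a) (hb : 0 < b) (hab : b ≠ 4 * a) :
    dual 2 (torus a b) = zeroSet (dualTorusForm a b) := by
  obtain ⟨R, r, h⟩ := exists_isRadii ha hb hab
  have hsqT := squarefree_torusForm ha.ne' hb.ne' hab
  have hT := isHomogeneous_torusForm a b
  refine Set.Subset.antisymm ?_ ?_
  · exact dual_zeroSet_subset hT (by norm_num) hsqT
      (isHomogeneous_dualTorusForm a b) fun v hv hg => h.eval_dualTorusForm_grad hv hg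
  · intro H hH f hf
    obtain ⟨⟨d, hfd⟩, hf⟩ := hf
    let s : MvPolynomial (Fin 4) ℂ := X 0 ^ 2 + X 1 ^ 2
    -- On the quartic k = (Ru' + ru)(Ru' − ru), which removes the dependence of the factor Ru' + ru
    -- on the signs of the roots.
    let k : MvPolynomial (Fin 4) ℂ := C ((R : ℂ) ^ 2) * absoluteForm - C (r ^ 2) * s
    have hs : s.IsHomogeneous 2 := (isHomogeneous_X_pow 0 2).add (isHomogeneous_X_pow 1 2)
    have hk : k.IsHomogeneous 2 := (isHomogeneous_absoluteForm.C_mul _).sub (hs.C_mul _)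
    have hvan : f * s * absoluteForm * k ∈ formsVanishingOn (zeroSet (dualTorusForm a b)) := by
      refine ⟨⟨_, ((hfd.mul hs).mul isHomogeneous_absoluteForm).mul hk⟩, fun p hp => ?_⟩
      obtain ⟨u, u', h1, h2, h3⟩ := h.exists_sqrts hp
      obtain ⟨hP, hgP⟩ := h.torus_point h1 h2 h3 rfl
      by_contra hne
      simp only [map_mul, mul_eq_zero, not_or] at hne
      obtain ⟨⟨⟨hf0, hs0⟩, hq0⟩, hk0⟩ := hne
      have hu : u ≠ 0 := by
        rintro rfl
        apply hs0
        simpa [s] using h1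
      have hu' : u' ≠ 0 := by
        rintro rfl
        apply hq0
        rw [eval_absoluteForm]
        linear_combination h1 + h2
      have hk' : R * u' + r * u ≠ 0 := by
        intro h0
        apply hk0
        have hs' : eval p.rep s = u ^ 2 := by
          rw [← h1]
          simp [s]
        have hq' : eval p.rep absoluteForm = u' ^ 2 := by
          rw [eval_absoluteForm]
          linear_combination h1 + h2
        simp only [k, map_sub, map_mul, eval_C, hs', hq']
        linear_combination (R * u' - r * u) * h0
      apply hf0
      refine hf p (mem_tangents_zeroSet hT (by norm_num) hsqT hP ?_ ?_ hgP)
      · intro h0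
        have := congrFun h0 3
        simp [hu, hu'] at this
      · simp [h.R_ne, h.r_ne, hu, hu', hk']
    have hdvd := dvd_of_mem_formsVanishingOn (isHomogeneous_dualTorusForm a b) (by norm_num)
      (squarefree_dualTorusForm ha.ne' hb.ne' hab) hvan
    have hdvd := (isRelPrime_dualTorusForm a b h.a_ne (by
      refine Polynomial.funext fun t => ?_
      rw [eval_lineMap]
      simp [k, s, absoluteForm, h.ha])).dvd_of_dvd_mul_right hdvd
    have hdvd := (isRelPrime_dualTorusForm a b one_ne_zero (by
      refine Polynomial.funext fun t => ?_
      rw [eval_lineMap]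
      simp [absoluteForm])).dvd_of_dvd_mul_right hdvd
    have hdvd := (isRelPrime_dualTorusForm a b one_ne_zero (by
      refine Polynomial.funext fun t => ?_
      rw [eval_lineMap]
      simp [s])).dvd_of_dvd_mul_right hdvd
    obtain ⟨g, rfl⟩ := hdvd
    have hH' : eval H.rep (dualTorusForm a b) = 0 := hH
    rw [map_mul, hH', zero_mul]

/-! ### Derivations and substitution -/

theorem derivation_aeval {n : ℕ} {A : Type*} [CommRing A] [Algebra ℂ A] (D : Derivation ℂ A A)
    (p : Fin n → A) (f : MvPolynomial (Fin n) ℂ) :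
    D (aeval p f) = ∑ i, aeval p (pderiv i f) * D (p i) := by
  induction f using MvPolynomial.induction_on with
  | C c => simp
  | add f g hf hg => simp [hf, hg, add_mul, Finset.sum_add_distrib]
  | mul_X f j hf =>
    simp only [map_mul, aeval_X, Derivation.leibniz, hf, smul_eq_mul, pderiv_X, map_add,
      add_mul, Finset.sum_add_distrib, Finset.mul_sum]
    congr 1
    · simp [Pi.single_apply, apply_ite]
    · exact Finset.sum_congr rfl fun i _ => by ring

theorem eval_derivative_lineMap {n : ℕ} (v v' : Fin (n + 1) → ℂ)
    (f : MvPolynomial (Fin (n + 1)) ℂ) :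
    (Polynomial.derivative (lineMap v v' f)).eval 0 = ∑ i, eval v (pderiv i f) * v' i := by
  have h := derivation_aeval Polynomial.derivative'
    (fun i => Polynomial.C (v i) + Polynomial.X * Polynomial.C (v' i)) f
  rw [Polynomial.derivative'_apply] at h
  rw [lineMap, h, Polynomial.eval_finsetSum]
  refine Finset.sum_congr rfl fun i _ => ?_
  have := eval_lineMap v v' (pderiv i f) 0
  rw [lineMap, zero_smul, add_zero] at this
  rw [Polynomial.eval_mul, this]
  simp

/-! ### The dual of the Euclidean absolute -/

/-- The form `x² + y² + z²` in three variables. -/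
def conicForm : MvPolynomial (Fin 3) ℂ := X 0 ^ 2 + X 1 ^ 2 + X 2 ^ 2

theorem eval_conicForm (v : Fin 3 → ℂ) : eval v conicForm = v 0 ^ 2 + v 1 ^ 2 + v 2 ^ 2 := by
  simp [conicForm]

theorem isHomogeneous_conicForm : conicForm.IsHomogeneous 2 :=
  ((isHomogeneous_X_pow 0 2).add (isHomogeneous_X_pow 1 2)).add (isHomogeneous_X_pow 2 2)

theorem squarefree_quadric_of_line {σ : Type*} {v v' : σ → ℂ} {f : MvPolynomial σ ℂ}
    (hf : f.IsHomogeneous 2)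
    (h : lineMap v v' f = Polynomial.C 0 * Polynomial.X ^ 4 + Polynomial.C 1 * Polynomial.X ^ 2
      + Polynomial.C 1) : Squarefree f := by
  refine squarefree_of_squarefree_lineMap (v := v) (v' := v') hf ?_ ?_
  · rw [← coeff_lineMap v v' hf, h]
    simp [Polynomial.coeff_one]
  · rw [h]
    exact squarefree_biquadratic one_ne_zero (by norm_num)

theorem squarefree_conicForm : Squarefree conicForm := by
  refine squarefree_quadric_of_line (v := ![1, 0, 0]) (v' := ![0, 1, 0]) isHomogeneous_conicForm
    (Polynomial.funext fun t => ?_)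
  rw [eval_lineMap]
  simp [conicForm]
  ring

theorem squarefree_absoluteForm : Squarefree absoluteForm := by
  refine squarefree_quadric_of_line (v := ![1, 0, 0, 0]) (v' := ![0, 1, 0, 0])
    isHomogeneous_absoluteForm (Polynomial.funext fun t => ?_)
  rw [eval_lineMap]
  simp [absoluteForm]
  ring

theorem mem_euclideanAbsolute {p : PSpace 3} :
    p ∈ euclideanAbsolute ↔ p.rep 3 = 0 ∧ p.rep 0 ^ 2 + p.rep 1 ^ 2 + p.rep 2 ^ 2 = 0 := by
  simp [euclideanAbsolute, zeroSet]

/-- The embedding of the plane `w = 0`. -/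
def planeEmbedding : (Fin 3 → ℂ) →ₗ[ℂ] (Fin 4 → ℂ) where
  toFun v := ![v 0, v 1, v 2, 0]
  map_add' u v := by
    ext i
    fin_cases i <;> simp
  map_smul' c v := by
    ext i
    fin_cases i <;> simp

theorem planeEmbedding_apply (v : Fin 3 → ℂ) : planeEmbedding v = ![v 0, v 1, v 2, 0] := rfl

theorem planeEmbedding_injective : Function.Injective planeEmbedding := by
  intro u v h
  rw [planeEmbedding_apply, planeEmbedding_apply] at h
  ext i
  fin_cases i
  · simpa using congrFun h 0
  · simpa using congrFun h 1
  · simpa using congrFun h 2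

/-- A form that vanishes on the conic restricts to the plane w = 0 as a multiple of x² + y² + z², so
its derivative along a tangent direction of the conic is zero. The derivative is taken on the line
`p + t u` inside this plane. -/
theorem tangentSpace_euclideanAbsolute {p : PSpace 3} (hp : p ∈ euclideanAbsolute) :
    tangentSpace euclideanAbsolute p =
      (LinearMap.ker (linearForm ![p.rep 0, p.rep 1, p.rep 2])).map planeEmbedding := by
  have hp' := mem_euclideanAbsolute.mp hp
  ext v
  rw [Submodule.mem_map]
  constructor
  · intro hv
    have h1 := hv (X 3) ⟨⟨1, isHomogeneous_X _ _⟩, fun q hq => by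
      simpa using (mem_euclideanAbsolute.mp hq).1⟩
    have h2 := hv absoluteForm ⟨⟨2, isHomogeneous_absoluteForm⟩, fun q hq => by
      simpa [eval_absoluteForm] using (mem_euclideanAbsolute.mp hq).2⟩
    simp [Fin.sum_univ_four, pderiv_X] at h1
    simp [Fin.sum_univ_four, pderiv_X, absoluteForm] at h2
    refine ⟨![v 0, v 1, v 2], ?_, ?_⟩
    · rw [LinearMap.mem_ker, linearForm_apply]
      simp [Fin.sum_univ_three]
      linear_combination h2 / 2
    · ext i
      fin_cases i <;> simp [planeEmbedding_apply, h1]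
  · rintro ⟨u, hu, rfl⟩ f ⟨⟨d, hfd⟩, hf⟩
    let f' : MvPolynomial (Fin 3) ℂ := aeval ![X 0, X 1, X 2, 0] f
    have hf' : f'.IsHomogeneous d := by
      have := hfd.aeval (n := 1) (![X 0, X 1, X 2, 0] : Fin 4 → MvPolynomial (Fin 3) ℂ) (by
        intro i
        fin_cases i
        · exact isHomogeneous_X _ _
        · exact isHomogeneous_X _ _
        · exact isHomogeneous_X _ _
        · exact isHomogeneous_zero _ _ _)
      rwa [one_mul] at this
    have hev {A : Type} [CommRing A] [Algebra ℂ A] (w : Fin 3 → A) :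
        aeval w f' = aeval ![w 0, w 1, w 2, 0] f := by
      rw [← AlgHom.comp_apply, comp_aeval]
      congr 2
      ext i
      fin_cases i <;> simp
    have hdvd : conicForm ∣ f' := by
      refine dvd_of_mem_formsVanishingOn isHomogeneous_conicForm two_ne_zero squarefree_conicForm
        ⟨⟨d, hf'⟩, fun q hq => ?_⟩
      have hne : planeEmbedding q.rep ≠ 0 := by
        rw [Ne, map_eq_zero_iff _ planeEmbedding_injective]
        exact q.rep_nonzero
      have := hf (.mk ℂ _ hne) ⟨(mk_mem_zeroSet (isHomogeneous_X _ _) hne).mpr (by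
        simp [planeEmbedding_apply]), (mk_mem_zeroSet isHomogeneous_absoluteForm hne).mpr (by
        rw [eval_absoluteForm]
        have hq' : eval q.rep conicForm = 0 := hq
        simpa [planeEmbedding_apply, eval_conicForm] using hq')⟩
      rw [eval_rep_mk_eq_zero_iff hfd] at this
      have h := hev q.rep
      simp only [aeval_eq_eval] at h
      rw [h]
      exact this
    obtain ⟨k, hk⟩ := hdvd
    have hline : lineMap p.rep (planeEmbedding u) f =
        lineMap ![p.rep 0, p.rep 1, p.rep 2] u f' := by
      rw [lineMap, lineMap, hev]
      congr 2
      ext1 i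
      fin_cases i <;> simp [planeEmbedding_apply, hp'.1]
    rw [← eval_derivative_lineMap, hline, hk, map_mul, Polynomial.derivative_mul,
      Polynomial.eval_add, Polynomial.eval_mul, Polynomial.eval_mul, eval_derivative_lineMap,
      eval_lineMap, eval_lineMap, zero_smul, add_zero]
    rw [LinearMap.mem_ker, linearForm_apply] at hu
    simp [Fin.sum_univ_three] at hu
    simp [Fin.sum_univ_three, conicForm, pderiv_X, hp'.2]
    left
    linear_combination 2 * hu

theorem isNonsingularPoint_euclideanAbsolute {p : PSpace 3} :
    IsNonsingularPoint 1 euclideanAbsolute p ↔ p ∈ euclideanAbsolute := by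
  refine and_iff_left_of_imp fun hp => ?_
  rw [tangentSpace_euclideanAbsolute hp]
  rw [(Submodule.equivMapOfInjective _ planeEmbedding_injective _).symm.finrank_eq]
  refine finrank_ker_linearForm fun h => p.rep_nonzero ?_
  ext i
  fin_cases i
  · simpa using congrFun h 0
  · simpa using congrFun h 1
  · simpa using congrFun h 2
  · exact (mem_euclideanAbsolute.mp hp).1

theorem dual_euclideanAbsolute : dual 1 euclideanAbsolute = zeroSet absoluteForm := by
  refine Set.Subset.antisymm ?_ ?_
  · refine zariskiClosure_subset_zeroSet isHomogeneous_absoluteForm ?_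
    rintro H ⟨p, hp, hH⟩
    rw [isNonsingularPoint_euclideanAbsolute] at hp
    rw [tangentSpace_euclideanAbsolute hp] at hH
    obtain ⟨c, hc⟩ := exists_eq_smul_of_ker_le (c := ![p.rep 0, p.rep 1, p.rep 2])
      (c' := ![H.rep 0, H.rep 1, H.rep 2]) fun v hv => by
        have := hH _ (Submodule.mem_map_of_mem hv)
        rw [LinearMap.mem_ker, linearForm_apply, ← this]
        simp [planeEmbedding_apply, dotProduct, Fin.sum_univ_three, Fin.sum_univ_four]
    have h0 := congrFun hc 0
    have h1 := congrFun hc 1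
    have h2 := congrFun hc 2
    simp at h0 h1 h2
    change eval H.rep absoluteForm = 0
    rw [eval_absoluteForm, h0, h1, h2]
    linear_combination c ^ 2 * (mem_euclideanAbsolute.mp hp).2
  · refine Set.Subset.trans (fun H hH => ?_) (subset_zariskiClosure _)
    have hH' : H.rep 0 ^ 2 + H.rep 1 ^ 2 + H.rep 2 ^ 2 = 0 := by
      rw [← eval_absoluteForm]
      exact hH
    obtain ⟨v, c, hv0, hv, hc⟩ : ∃ (v : Fin 3 → ℂ) (c : ℂ), v ≠ 0 ∧
        v 0 ^ 2 + v 1 ^ 2 + v 2 ^ 2 = 0 ∧ ![H.rep 0, H.rep 1, H.rep 2] = c • v := by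
      by_cases h0 : ![H.rep 0, H.rep 1, H.rep 2] = 0
      -- The plane at infinity contains every tangent line of the absolute, so any point of the
      -- conic serves, with factor c = 0.
      · refine ⟨![1, Complex.I, 0], 0, fun h => ?_, ?_, ?_⟩
        · simpa using congrFun h 0
        · simp
        · rw [h0, zero_smul]
      · exact ⟨_, 1, h0, by simpa using hH', by rw [one_smul]⟩
    have hne : planeEmbedding v ≠ 0 := by
      rwa [Ne, map_eq_zero_iff _ planeEmbedding_injective]
    obtain ⟨k, hk, hrep⟩ := exists_rep_mk hne
    have hp : Projectivization.mk ℂ _ hne ∈ euclideanAbsolute := by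
      rw [mem_euclideanAbsolute, hrep]
      simp [planeEmbedding_apply]
      linear_combination k ^ 2 * hv
    refine ⟨_, isNonsingularPoint_euclideanAbsolute.mpr hp, ?_⟩
    rw [tangentSpace_euclideanAbsolute hp, hrep]
    rintro _ ⟨u, hu, rfl⟩
    have h0 := congrFun hc 0
    have h1 := congrFun hc 1
    have h2 := congrFun hc 2
    simp at h0 h1 h2
    rw [SetLike.mem_coe, LinearMap.mem_ker, linearForm_apply] at hu
    simp [Fin.sum_univ_three, planeEmbedding_apply] at hu
    simp [dotProduct, Fin.sum_univ_four, planeEmbedding_apply, h0, h1, h2]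
    refine (mul_eq_zero_iff_left hk).mp ?_
    linear_combination c * hu

/-! ### The intersection of the two duals -/

/-- Modulo x² + y² + z² the dual form is a perfect square. Multiplicity two and tangency both come
from this. -/
theorem dualTorusForm_eq (a b : ℝ) : dualTorusForm a b =
    (C (b : ℂ) * X 2 ^ 2 + 4 * X 3 ^ 2) ^ 2 + absoluteForm * (16 * C (a : ℂ) ^ 2 * absoluteForm
      + 32 * C (a : ℂ) * X 3 ^ 2 - 8 * C (b : ℂ) * (C (a : ℂ) * X 2 ^ 2 + 2 * X 3 ^ 2)) := by
  simp only [dualTorusForm, absoluteForm, map_sub, map_mul, map_pow, map_ofNat]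
  ring

theorem zeroSet_dualTorusForm_inter (a b : ℝ) :
    zeroSet (dualTorusForm a b) ∩ zeroSet absoluteForm =
      zeroSet absoluteForm ∩ zeroSet (C (b : ℂ) * X 2 ^ 2 + 4 * X 3 ^ 2) := by
  ext p
  simp only [zeroSet, Set.mem_inter_iff, Set.mem_ofPred_eq, dualTorusForm_eq]
  rw [and_comm]
  refine and_congr_right fun h => ?_
  rw [map_add, map_mul, h, zero_mul, add_zero, map_pow, sq_eq_zero_iff]

/-- With ε² = −b/4 the curve consists of two conics, in the planes w = ±εz. The excluded planes h
are those tangent to one of the conics and those through a common point (1 : ±i : 0 : 0) of the two;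
the latter are given by h₀² + h₁² = 0. -/
theorem hasCurveDegree_inter {b : ℝ} (hb : b ≠ 0) : HasCurveDegree 4
    (zeroSet absoluteForm ∩ zeroSet (C (b : ℂ) * X 2 ^ 2 + 4 * X 3 ^ 2)) := by
  obtain ⟨ε, hε⟩ := IsAlgClosed.exists_pow_nat_eq (-(b : ℂ) / 4) two_pos
  have hε0 : ε ≠ 0 := by
    rintro rfl
    apply hb
    have : (b : ℂ) = 0 := by linear_combination 4 * hε
    exact_mod_cast this
  have hs : (X 0 ^ 2 + X 1 ^ 2 : MvPolynomial (Fin 4) ℂ).IsHomogeneous 2 :=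
    (isHomogeneous_X_pow 0 2).add (isHomogeneous_X_pow 1 2)
  have hN (e : ℂ) : (X 0 ^ 2 + X 1 ^ 2 + (X 2 + C e * X 3) ^ 2 :
      MvPolynomial (Fin 4) ℂ).IsHomogeneous 2 :=
    hs.add (((isHomogeneous_X ℂ 2).add (isHomogeneous_C_mul_X e 3)).pow 2)
  refine ⟨(X 0 ^ 2 + X 1 ^ 2) * (X 0 ^ 2 + X 1 ^ 2 + (X 2 + C ε * X 3) ^ 2) *
    (X 0 ^ 2 + X 1 ^ 2 + (X 2 + C (-ε) * X 3) ^ 2), ?_, ⟨_, (hs.mul (hN ε)).mul (hN (-ε))⟩, ?_⟩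
  · intro h
    simpa using congrArg (eval ![1, 0, 0, 0]) h
  intro H hH
  generalize H.rep = h at hH
  simp only [map_mul, map_add, map_pow, eval_X, eval_C, mul_ne_zero_iff] at hH
  obtain ⟨⟨hk, hN1⟩, hN2⟩ := hH
  generalize hkd : h 0 ^ 2 + h 1 ^ 2 = k at hk hN1 hN2
  obtain ⟨δ₁, hδ₁⟩ := IsAlgClosed.exists_pow_nat_eq (-(k + (h 2 + ε * h 3) ^ 2)) two_pos
  obtain ⟨δ₂, hδ₂⟩ := IsAlgClosed.exists_pow_nat_eq (-(k + (h 2 + -ε * h 3) ^ 2)) two_pos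
  have hδ₁0 : δ₁ ≠ 0 := by
    rintro rfl
    apply hN1
    linear_combination hδ₁
  have hδ₂0 : δ₂ ≠ 0 := by
    rintro rfl
    apply hN2
    linear_combination hδ₂
  -- Normalize z = 1, w = e and put δ = h₀y − h₁x. Together with h₀x + h₁y = −(h₂ + eh₃) this
  -- determines x and y, and x² + y² = −1 becomes δ² = −(k + (h₂ + eh₃)²).
  let vec (x : ℂ × ℂ) : Fin 4 → ℂ := ![(-(h 2 + x.2 * h 3) * h 0 - h 1 * x.1) / k,
    (-(h 2 + x.2 * h 3) * h 1 + h 0 * x.1) / k, 1, x.2]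
  have hvec (x) : vec x ≠ 0 := fun h0 => by simpa [vec] using congrFun h0 2
  let pt (x : ℂ × ℂ) : PSpace 3 := .mk ℂ (vec x) (hvec x)
  have hinj : Function.Injective pt := by
    intro x y hxy
    obtain ⟨c, hc⟩ := (Projectivization.mk_eq_mk_iff' ℂ _ _ _ _).mp hxy
    have h2 := congrFun hc 2
    simp [vec] at h2
    subst h2
    rw [one_smul] at hc
    have h0 := congrFun hc 0
    have h1 := congrFun hc 1
    have h3 := congrFun hc 3
    simp [vec] at h0 h1 h3
    rw [h3] at h0 h1
    field_simp at h0 h1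
    refine Prod.ext (mul_left_cancel₀ hk ?_) h3.symm
    rw [← hkd]
    linear_combination h 1 * h0 - h 0 * h1
  have hset : {p ∈ zeroSet absoluteForm ∩ zeroSet (C (b : ℂ) * X 2 ^ 2 + 4 * X 3 ^ 2) |
      h ⬝ᵥ p.rep = 0} = pt '' {(δ₁, ε), (-δ₁, ε), (δ₂, -ε), (-δ₂, -ε)} := by
    refine Set.Subset.antisymm ?_ ?_
    · rintro p ⟨⟨hq, hc⟩, hp⟩
      have hq : p.rep 0 ^ 2 + p.rep 1 ^ 2 + p.rep 2 ^ 2 = 0 := by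
        rw [← eval_absoluteForm]
        exact hq
      have hc : b * p.rep 2 ^ 2 + 4 * p.rep 3 ^ 2 = 0 := by
        simpa [zeroSet] using hc
      simp [dotProduct, Fin.sum_univ_four] at hp
      have hz : p.rep 2 ≠ 0 := by
        intro hz
        have hw : p.rep 3 = 0 := by simpa [hz] using hc
        rw [hz] at hq
        rw [hz, hw] at hp
        have hx : p.rep 0 = 0 := by
          rw [← sq_eq_zero_iff]
          refine (mul_eq_zero_iff_left hk).mp ?_
          linear_combination (h 0 * p.rep 0 - h 1 * p.rep 1) * hp + h 1 ^ 2 * hq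
            - p.rep 0 ^ 2 * hkd
        have hy : p.rep 1 = 0 := by simpa [hx] using hq
        refine p.rep_nonzero (funext fun i => ?_)
        fin_cases i <;> simpa
      have hmem (e : ℂ) (he : p.rep 3 = e * p.rep 2) :
          ∃ δ, δ ^ 2 = -(k + (h 2 + e * h 3) ^ 2) ∧ p = pt (δ, e) := by
        refine ⟨(h 0 * p.rep 1 - h 1 * p.rep 0) / p.rep 2, ?_, ?_⟩
        · field_simp
          rw [he] at hp
          linear_combination k * hq + (p.rep 0 ^ 2 + p.rep 1 ^ 2) * hkd
            - (h 0 * p.rep 0 + h 1 * p.rep 1 - (h 2 + e * h 3) * p.rep 2) * hp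
        · refine p.mk_rep.symm.trans ?_
          refine (Projectivization.mk_eq_mk_iff' ℂ _ _ _ _).mpr ⟨p.rep 2, ?_⟩
          rw [he] at hp
          ext i
          fin_cases i <;> simp [vec]
          · field_simp
            linear_combination p.rep 0 * hkd - h 0 * hp
          · field_simp
            linear_combination p.rep 1 * hkd - h 1 * hp
          · rw [he]; ring
      have hw : (p.rep 3 - ε * p.rep 2) * (p.rep 3 - -ε * p.rep 2) = 0 := by
        linear_combination hc / 4 - p.rep 2 ^ 2 * hε
      rcases mul_eq_zero.mp hw with hw | hw
      · obtain ⟨δ, hδ, hpt⟩ := hmem _ (sub_eq_zero.mp hw)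
        rw [← hδ₁, sq_eq_sq_iff_eq_or_eq_neg] at hδ
        refine ⟨_, ?_, hpt.symm⟩
        rcases hδ with rfl | rfl <;> simp
      · obtain ⟨δ, hδ, hpt⟩ := hmem _ (sub_eq_zero.mp hw)
        rw [← hδ₂, sq_eq_sq_iff_eq_or_eq_neg] at hδ
        refine ⟨_, ?_, hpt.symm⟩
        rcases hδ with rfl | rfl <;> simp
    · have hmem (e δ : ℂ) (he : e ^ 2 = -(b : ℂ) / 4) (hδ : δ ^ 2 = -(k + (h 2 + e * h 3) ^ 2)) :
          pt (δ, e) ∈ {p ∈ zeroSet absoluteForm ∩ zeroSet (C (b : ℂ) * X 2 ^ 2 + 4 * X 3 ^ 2) |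
            h ⬝ᵥ p.rep = 0} := by
        obtain ⟨c, hc, hrep⟩ := exists_rep_mk (hvec (δ, e))
        have hrep' : (pt (δ, e)).rep = c • vec (δ, e) := hrep
        simp only [zeroSet, Set.mem_inter_iff, Set.mem_ofPred_eq, hrep']
        refine ⟨⟨?_, ?_⟩, ?_⟩
        · rw [eval_absoluteForm]
          simp [vec]
          field_simp
          linear_combination c ^ 2 * ((h 2 + e * h 3) ^ 2 + δ ^ 2) * hkd + c ^ 2 * k * hδ
        · simp [vec]
          linear_combination 4 * c ^ 2 * he
        · simp [vec, dotProduct, Fin.sum_univ_four]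
          field_simp
          linear_combination -c * (h 2 + h 3 * e) * hkd
      rintro _ ⟨x, hx, rfl⟩
      simp only [Set.mem_insert_iff, Set.mem_singleton_iff] at hx
      have hε' : (-ε) ^ 2 = -(b : ℂ) / 4 := by rw [neg_sq, hε]
      rcases hx with rfl | rfl | rfl | rfl
      · exact hmem _ _ hε hδ₁
      · exact hmem _ _ hε (by rw [neg_sq, hδ₁])
      · exact hmem _ _ hε' hδ₂
      · exact hmem _ _ hε' (by rw [neg_sq, hδ₂])
  rw [hset, hinj.encard_image, Set.encard_insert_of_notMem, Set.encard_insert_of_notMem,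
    Set.encard_insert_of_notMem, Set.encard_singleton]
  · norm_num
  all_goals simp [self_eq_neg, hδ₁0, hδ₂0, hε0]

/-! ### Intersection multiplicity -/

/-- The length of the quotient by an ideal `(x, y²)` if `(x, y)` is maximal. -/
theorem length_quotient_span_pair_sq {A : Type*} [CommRing A] {x y : A}
    (hmax : (Ideal.span {x, y}).IsMaximal) (hy : y ∉ Ideal.span {x, y ^ 2}) :
    Module.length A (A ⧸ Ideal.span {x, y ^ 2}) = 2 := by
  have hle : Ideal.span {x, y ^ 2} ≤ Ideal.span {x, y} := by
    rw [Ideal.span_le]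
    rintro _ (rfl | rfl)
    · exact Ideal.subset_span (by simp)
    · exact Ideal.pow_mem_of_mem _ (Ideal.subset_span (by simp)) 2 two_pos
  have hsimple : IsSimpleModule A (A ⧸ Ideal.span {x, y}) :=
    isSimpleModule_iff_isCoatom.mpr hmax.out
  -- Multiplication by y maps A/(x, y) onto the kernel of A/(x, y²) → A/(x, y). It is injective
  -- because its source is simple and y ∉ (x, y²). So the length is 1 + 1.
  let f : (A ⧸ Ideal.span {x, y}) →ₗ[A] (A ⧸ Ideal.span {x, y ^ 2}) :=
    Submodule.mapQ _ _ (LinearMap.lsmul A A y) (by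
      intro z hz
      rw [Submodule.mem_comap, LinearMap.lsmul_apply, smul_eq_mul]
      obtain ⟨c, d, rfl⟩ := Ideal.mem_span_pair.mp hz
      exact Ideal.mem_span_pair.mpr ⟨y * c, d, by ring⟩)
  have hf : Function.Injective f := by
    refine (LinearMap.injective_or_eq_zero f).resolve_right fun h0 => hy ?_
    have := LinearMap.congr_fun h0 (Submodule.Quotient.mk 1)
    rw [Submodule.mapQ_apply, LinearMap.zero_apply, Submodule.Quotient.mk_eq_zero] at this
    simpa using this
  let g : (A ⧸ Ideal.span {x, y ^ 2}) →ₗ[A] (A ⧸ Ideal.span {x, y}) := Submodule.factor hle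
  have hg : Function.Surjective g := Submodule.factor_surjective hle
  have hfg : Function.Exact f g := by
    intro z
    obtain ⟨z, rfl⟩ := Submodule.Quotient.mk_surjective _ z
    constructor
    · intro hz
      have hz' : z ∈ Ideal.span {x, y} := by
        rwa [← Submodule.Quotient.mk_eq_zero]
      obtain ⟨c, d, rfl⟩ := Ideal.mem_span_pair.mp hz'
      refine ⟨Submodule.Quotient.mk d, ?_⟩
      rw [Submodule.mapQ_apply, Submodule.Quotient.eq, LinearMap.lsmul_apply, smul_eq_mul]
      exact Ideal.mem_span_pair.mpr ⟨-c, 0, by ring⟩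
    · rintro ⟨w, hw⟩
      obtain ⟨w, rfl⟩ := Submodule.Quotient.mk_surjective _ w
      rw [← hw, Submodule.mapQ_apply]
      refine (Submodule.Quotient.mk_eq_zero _).mpr ?_
      rw [LinearMap.lsmul_apply, smul_eq_mul]
      exact Ideal.mul_mem_right _ _ (Ideal.subset_span (by simp))
  rw [Module.length_eq_add_of_exact f g hf hg hfg, Module.length_eq_one, one_add_one_eq_two]

theorem exists_conic_parametrization {v : Fin 3 → ℂ} (hv : eval v conicForm = 0) :
    ∃ s t : ℂ, v = ![s ^ 2 - t ^ 2, Complex.I * (s ^ 2 + t ^ 2), 2 * s * t] := by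
  rw [eval_conicForm] at hv
  obtain ⟨s, hs⟩ := IsAlgClosed.exists_pow_nat_eq ((v 0 - Complex.I * v 1) / 2) two_pos
  obtain ⟨t, ht⟩ := IsAlgClosed.exists_pow_nat_eq ((-v 0 - Complex.I * v 1) / 2) two_pos
  have h2 : v 2 ^ 2 = (2 * s * t) ^ 2 := by
    rw [mul_pow, mul_pow, hs, ht]
    linear_combination hv - v 1 ^ 2 * Complex.I_sq
  have hy : Complex.I * (s ^ 2 + t ^ 2) = v 1 := by
    rw [hs, ht]
    linear_combination -v 1 * Complex.I_sq
  rcases sq_eq_sq_iff_eq_or_eq_neg.mp h2 with h | h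
  · refine ⟨s, t, funext fun i => ?_⟩
    fin_cases i <;> simp [hy, h]
    rw [hs, ht]; ring
  · refine ⟨s, -t, funext fun i => ?_⟩
    fin_cases i <;> simp [hy, h]
    rw [hs, ht]; ring

/-- The rational parametrization of the conic gives a homomorphism into a domain. Its kernel
consists of the multiples of the conic form, since every zero of that squarefree form is
parametrized. -/
theorem prime_conicForm : Prime conicForm := by
  let φ : MvPolynomial (Fin 3) ℂ →ₐ[ℂ] MvPolynomial (Fin 2) ℂ :=
    aeval ![X 0 ^ 2 - X 1 ^ 2, C Complex.I * (X 0 ^ 2 + X 1 ^ 2), 2 * X 0 * X 1]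
  have hφ (f) (h : φ f = 0) : conicForm ∣ f := by
    refine dvd_of_eval_eq_zero squarefree_conicForm fun v hv => ?_
    obtain ⟨s, t, rfl⟩ := exists_conic_parametrization hv
    have h' := congrArg (aeval ![s, t]) h
    rw [← AlgHom.comp_apply, comp_aeval, map_zero] at h'
    rw [← h', ← aeval_eq_eval]
    congr 2
    ext i
    fin_cases i <;> simp
  have h0 : φ conicForm = 0 := by
    simp only [φ, conicForm, map_add, map_pow, aeval_X]
    simp
    have : (C Complex.I : MvPolynomial (Fin 2) ℂ) ^ 2 = -1 := by
      rw [← map_pow, Complex.I_sq, map_neg, map_one]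
    linear_combination (X 0 ^ 2 + X 1 ^ 2) ^ 2 * this
  refine ⟨fun h => ?_, fun h => ?_, fun f g h => ?_⟩
  · simpa [eval_conicForm] using congrArg (eval ![1, 0, 0]) h
  · have := (h.map φ)
    rw [h0] at this
    exact not_isUnit_zero this
  · have : φ (f * g) = 0 := by
      obtain ⟨k, hk⟩ := h
      rw [hk, map_mul, h0, zero_mul]
    rw [map_mul, mul_eq_zero] at this
    exact this.imp (hφ f) (hφ g)

/-- The homogeneous ideal of a component of the intersection of the two duals. -/
theorem isPrime_span_component (ε : ℂ) :
    (Ideal.span {absoluteForm, X 3 - C ε * X 2} : Ideal (MvPolynomial (Fin 4) ℂ)).IsPrime := by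
  let φ : MvPolynomial (Fin 4) ℂ →ₐ[ℂ] MvPolynomial (Fin 3) ℂ := aeval ![X 0, X 1, X 2, C ε * X 2]
  let ψ : MvPolynomial (Fin 3) ℂ →ₐ[ℂ] MvPolynomial (Fin 4) ℂ := aeval ![X 0, X 1, X 2]
  have hφ : φ absoluteForm = conicForm := by
    simp [φ, absoluteForm, conicForm]
  have hψ : ψ conicForm = absoluteForm := by
    simp [ψ, absoluteForm, conicForm]
  have hprime : (Ideal.span {conicForm}).IsPrime :=
    (Ideal.span_singleton_prime prime_conicForm.ne_zero).mpr prime_conicForm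
  -- The ideal is the preimage of the prime (x² + y² + z²) under w ↦ εz, because ψ ∘ φ is the
  -- identity modulo w − εz.
  have hcomap : Ideal.span {absoluteForm, X 3 - C ε * X 2} =
      (Ideal.span {conicForm}).comap φ := by
    refine le_antisymm ?_ fun f hf => ?_
    · rw [Ideal.span_le]
      rintro _ (rfl | rfl)
      · exact Ideal.mem_comap.mpr (by rw [hφ]; exact Ideal.mem_span_singleton_self _)
      · have : φ (X 3 - C ε * X 2) = 0 := by
          simp [φ]
        exact Ideal.mem_comap.mpr (by rw [this]; exact zero_mem _)
    · obtain ⟨k, hk⟩ := Ideal.mem_span_singleton.mp (Ideal.mem_comap.mp hf)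
      set I : Ideal (MvPolynomial (Fin 4) ℂ) := Ideal.span {absoluteForm, X 3 - C ε * X 2}
      have hhom : (Ideal.Quotient.mkₐ ℂ I).comp (ψ.comp φ) = Ideal.Quotient.mkₐ ℂ I := by
        ext i
        fin_cases i
        · simp [φ, ψ]
        · simp [φ, ψ]
        · simp [φ, ψ]
        · simp [φ, ψ]
          rw [← map_mul, Ideal.Quotient.mk_eq_mk_iff_sub_mem, ← neg_sub]
          exact neg_mem (Ideal.subset_span (by simp))
      have h1 := AlgHom.congr_fun hhom f
      rw [AlgHom.comp_apply, AlgHom.comp_apply] at h1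
      rw [← Ideal.Quotient.eq_zero_iff_mem]
      refine h1.symm.trans (Ideal.Quotient.eq_zero_iff_mem.mpr ?_)
      change ψ (φ f) ∈ I
      have : φ f = conicForm * k := hk
      rw [this, map_mul, hψ]
      exact Ideal.mul_mem_right _ _ (Ideal.subset_span (by simp))
  rw [hcomap]
  infer_instance

theorem not_mem_component {ε : ℂ} (hε : ε ≠ 0) :
    X 3 + C ε * X 2 ∉ (Ideal.span {absoluteForm, X 3 - C ε * X 2} :
      Ideal (MvPolynomial (Fin 4) ℂ)) := by
  intro h
  obtain ⟨c, d, hcd⟩ := Ideal.mem_span_pair.mp h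
  have := congrArg (eval ![0, Complex.I, 1, ε]) hcd
  simp [absoluteForm, ← two_mul, hε] at this

/-- In the local ring w + εz is a unit, so the ideal becomes (q, (w − εz)²), while (q, w − εz) is
the maximal ideal. -/
theorem length_component {ε : ℂ} (hε : ε ≠ 0) (P : Ideal (MvPolynomial (Fin 4) ℂ)) [P.IsPrime]
    (hP : P = Ideal.span {absoluteForm, X 3 - C ε * X 2}) :
    Module.length (Localization.AtPrime P) (Localization.AtPrime P ⧸
      (Ideal.span {absoluteForm, ((X 3 - C ε * X 2) * (X 3 + C ε * X 2)) ^ 2}).map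
        (algebraMap (MvPolynomial (Fin 4) ℂ) (Localization.AtPrime P))) = 2 := by
  have hunit : IsUnit (algebraMap (MvPolynomial (Fin 4) ℂ) (Localization.AtPrime P)
      (X 3 + C ε * X 2)) := by
    rw [IsLocalization.AtPrime.isUnit_to_map_iff (Localization.AtPrime P) P]
    change _ ∉ P
    rw [hP]
    exact not_mem_component hε
  have hmap : (Ideal.span {absoluteForm, ((X 3 - C ε * X 2) * (X 3 + C ε * X 2)) ^ 2}).map
      (algebraMap (MvPolynomial (Fin 4) ℂ) (Localization.AtPrime P)) =
      Ideal.span {algebraMap (MvPolynomial (Fin 4) ℂ) (Localization.AtPrime P) absoluteForm,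
        algebraMap (MvPolynomial (Fin 4) ℂ) (Localization.AtPrime P) (X 3 - C ε * X 2) ^ 2} := by
    rw [Ideal.map_span, Set.image_pair, mul_pow, map_mul, map_pow, map_pow,
      Ideal.span_insert, Ideal.span_insert _ {_ ^ 2},
      Ideal.span_singleton_mul_right_unit (hunit.pow 2)]
  rw [hmap]
  refine length_quotient_span_pair_sq ?_ fun hmem => ?_
  · rw [← Set.image_pair, ← Ideal.map_span, ← hP, IsLocalization.AtPrime.map_eq_maximalIdeal P]
    infer_instance
  · rw [← map_pow, ← Set.image_pair, ← Ideal.map_span,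
      IsLocalization.algebraMap_mem_map_algebraMap_iff P.primeCompl] at hmem
    obtain ⟨σ, hσ, hmem⟩ := hmem
    obtain ⟨c, d, hcd⟩ := Ideal.mem_span_pair.mp hmem
    apply hσ
    -- As q does not involve w, differentiating σ(w − εz) = cq + d(w − εz)² with respect to w shows
    -- σ ∈ P.
    have h := congrArg (pderiv 3) hcd
    simp [pderiv_X, absoluteForm, Derivation.leibniz] at h
    rw [hP]
    refine Ideal.mem_span_pair.mpr ⟨pderiv 3 c, pderiv 3 d * (X 3 - C ε * X 2) + 2 * d
      - pderiv 3 σ, ?_⟩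
    simp only [absoluteForm]
    linear_combination h

/-- The sum of the ideals is (q, ((w − εz)(w + εz))²). A minimal prime over it contains one of the
linear factors w ∓ εz, hence equals the prime (q, w ∓ εz). -/
theorem multiplicityAlong_duals {a b : ℝ} (ha : 0 < a) (hb : 0 < b) (hab : b ≠ 4 * a)
    (P : Ideal (MvPolynomial (Fin 4) ℂ)) [P.IsPrime]
    (hP : P ∈ (homogeneousIdeal (dual 2 (torus a b)) ⊔
      homogeneousIdeal (dual 1 euclideanAbsolute)).minimalPrimes) :
    multiplicityAlong (dual 2 (torus a b)) (dual 1 euclideanAbsolute) P = 2 := by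
  obtain ⟨ε, hε⟩ := IsAlgClosed.exists_pow_nat_eq (-(b : ℂ) / 4) two_pos
  have hε0 : ε ≠ 0 := by
    rintro rfl
    apply hb.ne'
    have : (b : ℂ) = 0 := by linear_combination 4 * hε
    exact_mod_cast this
  have hideal (e : ℂ) (he : e ^ 2 = -(b : ℂ) / 4) : homogeneousIdeal (dual 2 (torus a b)) ⊔
      homogeneousIdeal (dual 1 euclideanAbsolute) =
      Ideal.span {absoluteForm, ((X 3 - C e * X 2) * (X 3 + C e * X 2)) ^ 2} := by
    rw [dual_torus ha hb hab, dual_euclideanAbsolute,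
      homogeneousIdeal_zeroSet (isHomogeneous_dualTorusForm a b) (by norm_num)
        (squarefree_dualTorusForm ha.ne' hb.ne' hab),
      homogeneousIdeal_zeroSet isHomogeneous_absoluteForm two_ne_zero squarefree_absoluteForm,
      ← Ideal.span_union, Set.union_comm]
    have hb' : (C (b : ℂ) : MvPolynomial (Fin 4) ℂ) = -4 * C e ^ 2 := by
      rw [← map_pow, he, ← map_ofNat C 4, ← map_neg, ← map_mul]
      congr 1
      ring
    have hD : dualTorusForm a b = 16 * ((X 3 - C e * X 2) * (X 3 + C e * X 2)) ^ 2 +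
        absoluteForm * (16 * C (a : ℂ) ^ 2 * absoluteForm
      + 32 * C (a : ℂ) * X 3 ^ 2 - 8 * C (b : ℂ) * (C (a : ℂ) * X 2 ^ 2 + 2 * X 3 ^ 2)) := by
      rw [dualTorusForm_eq, hb']
      ring
    have h16 : (C (1 / 16 : ℂ) : MvPolynomial (Fin 4) ℂ) * 16 = 1 := by
      rw [← map_ofNat C 16, ← map_mul]
      norm_num
    refine le_antisymm (Ideal.span_le.mpr ?_) (Ideal.span_le.mpr ?_)
    · rintro _ (rfl | rfl)
      · exact Ideal.subset_span (by simp)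
      · rw [hD]
        exact Ideal.mem_span_pair.mpr ⟨16 * C (a : ℂ) ^ 2 * absoluteForm
          + 32 * C (a : ℂ) * X 3 ^ 2 - 8 * C (b : ℂ) * (C (a : ℂ) * X 2 ^ 2 + 2 * X 3 ^ 2), 16,
          by ring⟩
    · rintro _ (rfl | rfl)
      · exact Ideal.subset_span (by simp)
      · refine Ideal.mem_span_pair.mpr ⟨-C (1 / 16) * (16 * C (a : ℂ) ^ 2 * absoluteForm
          + 32 * C (a : ℂ) * X 3 ^ 2 - 8 * C (b : ℂ) * (C (a : ℂ) * X 2 ^ 2 + 2 * X 3 ^ 2)),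
          C (1 / 16), ?_⟩
        rw [hD]
        linear_combination ((X 3 - C e * X 2) * (X 3 + C e * X 2)) ^ 2 * h16
  have hlen (e : ℂ) (he0 : e ≠ 0) (he : e ^ 2 = -(b : ℂ) / 4) (hmem : X 3 - C e * X 2 ∈ P) :
      multiplicityAlong (dual 2 (torus a b)) (dual 1 euclideanAbsolute) P = 2 := by
    rw [hideal e he] at hP
    have hPe : P = Ideal.span {absoluteForm, X 3 - C e * X 2} := by
      have hle : Ideal.span {absoluteForm, X 3 - C e * X 2} ≤ P := by
        rw [Ideal.span_le]
        rintro _ (rfl | rfl)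
        · exact hP.1.2 (Ideal.subset_span (by simp))
        · exact hmem
      refine le_antisymm (hP.2 ⟨isPrime_span_component e, Ideal.span_le.mpr ?_⟩ hle) hle
      rintro _ (rfl | rfl)
      · exact Ideal.subset_span (by simp)
      · rw [mul_pow, sq, mul_assoc]
        exact Ideal.mul_mem_right _ _ (Ideal.subset_span (by simp))
    rw [multiplicityAlong, hideal e he]
    exact length_component he0 P hPe
  have hprod : ((X 3 - C ε * X 2) * (X 3 + C ε * X 2)) ^ 2 ∈ P := by
    have hle := hP.1.2
    rw [hideal ε hε] at hle
    exact hle (Ideal.subset_span (by simp))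
  rcases (Ideal.IsPrime.mem_or_mem ‹_› (Ideal.IsPrime.mem_of_pow_mem ‹_› _ hprod)) with h | h
  · exact hlen ε hε0 hε h
  · exact hlen (-ε) (neg_ne_zero.mpr hε0) (by rw [neg_sq, hε])
      (by rwa [map_neg, neg_mul, sub_neg_eq_add])

/-! ### Proportional vectors over a domain -/

theorem aeval_smul_of_isHomogeneous {σ A : Type*} [CommRing A] [Algebra ℂ A]
    {f : MvPolynomial σ ℂ} {d : ℕ} (hf : f.IsHomogeneous d) (c : A) (v : σ → A) :
    aeval (c • v) f = c ^ d * aeval v f := by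
  simp only [aeval_def, eval₂_eq, Pi.smul_apply, smul_eq_mul, mul_pow, Finset.prod_mul_distrib,
    Finset.mul_sum, Finset.prod_pow_eq_pow_sum]
  refine Finset.sum_congr rfl fun m hm => ?_
  rw [hf.degree_eq_sum_deg_support hm]
  ring

theorem aeval_eq_zero_of_proportional {σ A : Type*} [CommRing A] [IsDomain A] [Algebra ℂ A]
    {f : MvPolynomial σ ℂ} {d : ℕ} (hf : f.IsHomogeneous d) {u v : σ → A}
    (huv : ∀ i j, u i * v j = u j * v i) (hu : u ≠ 0) (h : aeval u f = 0) : aeval v f = 0 := by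
  obtain ⟨m, hm⟩ := Function.ne_iff.mp hu
  have h1 : u m • v = v m • u := funext fun i => by
    rw [Pi.smul_apply, Pi.smul_apply, smul_eq_mul, smul_eq_mul, huv, mul_comm]
  have h2 := aeval_smul_of_isHomogeneous hf (u m) v
  rw [h1, aeval_smul_of_isHomogeneous hf, h, mul_zero] at h2
  exact (mul_eq_zero.mp h2.symm).resolve_left (pow_ne_zero _ hm)

open scoped Matrix in
-- Expanding (p × q) × c shows that a vector orthogonal to p and q is proportional to p × q. A
-- nonzero coordinate of p × q is cancelled, so no fraction field is needed.
theorem proportional_of_orthogonal {A : Type*} [CommRing A] [IsDomain A] {p q a b : Fin 3 → A}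
    (hpq : p ⨯₃ q ≠ 0) (hpa : p ⬝ᵥ a = 0) (hqa : q ⬝ᵥ a = 0) (hpb : p ⬝ᵥ b = 0)
    (hqb : q ⬝ᵥ b = 0) (i j : Fin 3) : a i * b j = a j * b i := by
  have hprop (c : Fin 3 → A) (hp : p ⬝ᵥ c = 0) (hq : q ⬝ᵥ c = 0) (i j : Fin 3) :
      (p ⨯₃ q) i * c j = (p ⨯₃ q) j * c i := by
    have h := cross_cross_eq_smul_sub_smul p q c
    rw [hp, hq, zero_smul, zero_smul, sub_zero] at h
    generalize p ⨯₃ q = x at h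
    rw [cross_apply] at h
    have h0 := congrFun h 0
    have h1 := congrFun h 1
    have h2 := congrFun h 2
    simp at h0 h1 h2
    fin_cases i <;> fin_cases j <;> simp <;> grind
  obtain ⟨m, hm⟩ := Function.ne_iff.mp hpq
  refine mul_left_cancel₀ (pow_ne_zero 2 hm) ?_
  linear_combination (p ⨯₃ q) m * b j * hprop a hpa hqa m i
    + (p ⨯₃ q) i * a m * hprop b hpb hqb m j
    - (p ⨯₃ q) m * b i * hprop a hpa hqa m j
    - (p ⨯₃ q) j * a m * hprop b hpb hqb m i

/-! ### The dual of a parametrized plane curve -/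

/-- If the whole gradient vanishes along Q, a nonzero partial derivative is a relation of smaller
degree. By Euler's identity one exists in positive degree, and a nonzero constant is not a relation.
-/
theorem exists_gradient_ne_zero {A : Type*} [CommRing A] [IsDomain A] [Algebra ℂ A]
    (Q : Fin 3 → A) (d : ℕ) (f : MvPolynomial (Fin 3) ℂ) (hf : f.IsHomogeneous d) (hf0 : f ≠ 0)
    (h : aeval Q f = 0) : ∃ (d : ℕ) (f : MvPolynomial (Fin 3) ℂ), f.IsHomogeneous d ∧
      aeval Q f = 0 ∧ ∃ i, aeval Q (pderiv i f) ≠ 0 := by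
  induction d using Nat.strong_induction_on generalizing f with
  | _ d ih =>
    by_cases hi : ∃ i, aeval Q (pderiv i f) ≠ 0
    · exact ⟨d, f, hf, h, hi⟩
    push Not at hi
    have hd : d ≠ 0 := by
      rintro rfl
      have hc := totalDegree_eq_zero_iff_eq_C.mp (Nat.le_zero.mp hf.totalDegree_le)
      rw [hc, aeval_C, map_eq_zero_iff _ (algebraMap ℂ A).injective] at h
      rw [h, map_zero] at hc
      exact hf0 hc
    by_cases hp : ∃ i, pderiv i f ≠ 0
    · obtain ⟨i, hi0⟩ := hp
      exact ih (d - 1) (by omega) _ hf.pderiv hi0 (hi i)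
    · push Not at hp
      have := hf.sum_X_mul_pderiv
      simp only [hp, mul_zero, Finset.sum_const_zero] at this
      exact absurd this.symm (smul_ne_zero hd hf0)

open scoped Matrix in
/-- The dual of a plane curve that is parametrized by homogeneous coordinates `Q` in a domain with a
derivation, if the tangent lines are given by `u` and satisfy the equation `E = 0`. -/
theorem dual_eq_zeroSet_of_parametrization {A : Type*} [CommRing A] [IsDomain A] [Algebra ℂ A]
    (D : Derivation ℂ A A) (Q u : Fin 3 → A) (hQ : Q ⨯₃ (fun i => D (Q i)) ≠ 0)
    (huQ : Q ⬝ᵥ u = 0) (huDQ : (fun i => D (Q i)) ⬝ᵥ u = 0) (hu : u ≠ 0)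
    (S : Set (A →ₐ[ℂ] ℂ)) (hS : ∀ z, (∀ e ∈ S, e z = 0) → z = 0)
    (X : Set (PSpace 2))
    (hX : ∀ e ∈ S, ∃ hne : (fun i => e (Q i)) ≠ 0, Projectivization.mk ℂ _ hne ∈ X)
    (hvan : ∀ (f : MvPolynomial (Fin 3) ℂ) (d : ℕ), f.IsHomogeneous d → aeval Q f = 0 →
      ∀ p ∈ X, eval p.rep f = 0)
    (hex : ∃ (d : ℕ) (f : MvPolynomial (Fin 3) ℂ), f.IsHomogeneous d ∧ f ≠ 0 ∧ aeval Q f = 0)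
    (E : MvPolynomial (Fin 3) ℂ) (k : ℕ) (hE : E.IsHomogeneous k) (huE : aeval u E = 0)
    (hdvd : ∀ (f : MvPolynomial (Fin 3) ℂ) (d : ℕ), f.IsHomogeneous d → aeval u f = 0 → E ∣ f) :
    dual 1 X = zeroSet E := by
  have hev (e : A →ₐ[ℂ] ℂ) (v : Fin 3 → A) (f : MvPolynomial (Fin 3) ℂ) :
      e (aeval v f) = eval (fun i => e (v i)) f := by
    rw [← AlgHom.comp_apply, comp_aeval, aeval_eq_eval]
  have hforms {f : MvPolynomial (Fin 3) ℂ} {d : ℕ} (hf : f.IsHomogeneous d) :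
      f ∈ formsVanishingOn X ↔ aeval Q f = 0 := by
    refine ⟨fun h => hS _ fun e he => ?_, fun h => ⟨⟨d, hf⟩, hvan f d hf h⟩⟩
    obtain ⟨hne, hmem⟩ := hX e he
    rw [hev]
    exact (eval_rep_mk_eq_zero_iff hf hne).mp (h.2 _ hmem)
  -- Along Q the gradient of f is orthogonal to Q by Euler's identity and to DQ by the chain rule,
  -- just as u is.
  have hprop {f : MvPolynomial (Fin 3) ℂ} {d : ℕ} (hf : f.IsHomogeneous d) (h : aeval Q f = 0)
      (i j : Fin 3) : u i * aeval Q (pderiv j f) = u j * aeval Q (pderiv i f) := by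
    refine proportional_of_orthogonal (b := fun i => aeval Q (pderiv i f)) hQ huQ huDQ ?_ ?_ i j
    · have := congrArg (aeval Q) hf.sum_X_mul_pderiv
      simpa [h, dotProduct] using this
    · have := derivation_aeval D Q f
      rw [h, map_zero] at this
      rw [this, dotProduct]
      exact Finset.sum_congr rfl fun i _ => mul_comm _ _
  refine Set.Subset.antisymm (zariskiClosure_subset_zeroSet hE ?_) ?_
  · rintro H ⟨p, ⟨hp, hrank⟩, hH⟩
    obtain ⟨f, hf, hgrad⟩ : ∃ f ∈ formsVanishingOn X, grad f p.rep ≠ 0 := by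
      by_contra! hall
      have htop : tangentSpace X p = ⊤ := by
        refine eq_top_iff.mpr fun v _ f hf => Finset.sum_eq_zero fun i _ => ?_
        have := congrFun (hall f hf) i
        rw [grad, Pi.zero_apply] at this
        rw [this, zero_mul]
      rw [htop, finrank_top, Module.finrank_fin_fun] at hrank
      omega
    obtain ⟨d, hfd⟩ := hf.1
    have hle : tangentSpace X p ≤ LinearMap.ker (linearForm (grad f p.rep)) := fun v hv => hv f hf
    have heq := Submodule.eq_of_le_of_finrank_eq hle
      (by rw [hrank, finrank_ker_linearForm hgrad])
    rw [heq] at hH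
    obtain ⟨c, hc⟩ := exists_eq_smul_of_ker_le (c := grad f p.rep) (c' := H.rep)
      fun v hv => hH v hv
    change eval H.rep E = 0
    rw [hc, eval_smul_of_isHomogeneous hE]
    refine mul_eq_zero_of_right _ ?_
    -- E(grad f) is itself a form. It vanishes along Q, hence on all of X, including points that the
    -- parametrization misses.
    have hΦ : (aeval (fun i => pderiv i f) E).IsHomogeneous ((d - 1) * k) :=
      hE.aeval _ fun i => hfd.pderiv
    have h0 : aeval Q (aeval (fun i => pderiv i f) E) = 0 := by
      rw [← AlgHom.comp_apply, comp_aeval]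
      exact aeval_eq_zero_of_proportional hE (hprop hfd ((hforms hfd).mp hf)) hu huE
    have := hvan _ _ hΦ h0 p hp
    rw [← aeval_eq_eval, ← AlgHom.comp_apply, comp_aeval, aeval_eq_eval] at this
    exact this
  · intro H hH e' he'
    obtain ⟨⟨k', hk'⟩, he'⟩ := he'
    obtain ⟨d, f, hf, hf0⟩ := hex
    obtain ⟨d, f, hf, hQf, m, hm⟩ := exists_gradient_ne_zero Q d f hf hf0.1 hf0.2
    -- Where ∂ₘf ≠ 0 the gradient of f is the tangent line, so e' vanishes on it. The product with
    -- ∂ₘf vanishes at every point of S, and A is a domain.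
    have hn : aeval (fun i => aeval Q (pderiv i f)) e' = 0 := by
      refine (mul_eq_zero.mp (hS (aeval Q (pderiv m f) *
        aeval (fun i => aeval Q (pderiv i f)) e') fun e he => ?_)).resolve_left hm
      rw [map_mul, mul_eq_zero, or_iff_not_imp_left]
      intro hem
      obtain ⟨hne, hmem⟩ := hX e he
      obtain ⟨c, hc, hrep⟩ := exists_rep_mk hne
      have hgr : grad f (fun i => e (Q i)) = fun i => e (aeval Q (pderiv i f)) :=
        funext fun i => (hev e Q (pderiv i f)).symm
      have hgr0 : grad f (fun i => e (Q i)) ≠ 0 := by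
        rw [hgr]
        exact Function.ne_iff.mpr ⟨m, hem⟩
      have hT : tangentSpace X (Projectivization.mk ℂ _ hne) =
          LinearMap.ker (linearForm (grad f (fun i => e (Q i)))) := by
        ext v
        rw [LinearMap.mem_ker, linearForm_apply]
        constructor
        · intro hv
          have := hv f ((hforms hf).mpr hQf)
          have h2 := grad_smul hf c (fun i => e (Q i))
          rw [← hrep] at h2
          change ∑ i, grad f _ i * v i = 0 at this
          rw [h2] at this
          simp only [Pi.smul_apply, smul_eq_mul, mul_assoc, ← Finset.mul_sum] at this
          exact (mul_eq_zero.mp this).resolve_left (pow_ne_zero _ hc)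
        · intro hv f' hf'
          obtain ⟨d', hd'⟩ := hf'.1
          have h2 := grad_smul hd' c (fun i => e (Q i))
          rw [← hrep] at h2
          change ∑ i, grad f' _ i * v i = 0
          rw [h2]
          simp only [Pi.smul_apply, smul_eq_mul, mul_assoc, ← Finset.mul_sum]
          refine mul_eq_zero_of_right _ ?_
          -- All gradients of forms vanishing on X are proportional along Q, so one nonzero gradient
          -- cuts out the whole tangent space.
          have hpr (i j : Fin 3) : aeval Q (pderiv i f) * aeval Q (pderiv j f') =
              aeval Q (pderiv j f) * aeval Q (pderiv i f') := by
            obtain ⟨l, hl⟩ := Function.ne_iff.mp hu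
            refine mul_left_cancel₀ (pow_ne_zero 2 hl) ?_
            linear_combination u l * aeval Q (pderiv j f') * hprop hf hQf l i
              + u i * aeval Q (pderiv l f) * hprop hd' ((hforms hd').mp hf') l j
              - u l * aeval Q (pderiv i f') * hprop hf hQf l j
              - u j * aeval Q (pderiv l f) * hprop hd' ((hforms hd').mp hf') l i
          have hpr' (i : Fin 3) : e (aeval Q (pderiv m f)) * grad f' (fun i => e (Q i)) i =
              grad f (fun i => e (Q i)) i * e (aeval Q (pderiv m f')) := by
            have := congrArg e (hpr m i)
            rw [map_mul, map_mul] at this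
            rw [hgr, grad, ← hev, this]
          refine (mul_eq_zero.mp ?_).resolve_left hem
          rw [Finset.mul_sum]
          simp only [← mul_assoc, hpr']
          rw [Finset.sum_congr rfl fun i _ => mul_right_comm _ _ _, ← Finset.sum_mul, hv, zero_mul]
      have hH := he' (Projectivization.mk ℂ _ hgr0) ⟨_, ⟨hmem, by
        rw [hT, finrank_ker_linearForm hgr0]⟩, fun v hv => by
          rw [hT, LinearMap.mem_ker] at hv
          obtain ⟨c', hc', hrep'⟩ := exists_rep_mk hgr0
          rw [hrep', smul_dotProduct, dotProduct_eq_linearForm, hv, smul_zero]⟩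
      rw [eval_rep_mk_eq_zero_iff hk', hgr] at hH
      rw [hev, hH]
    have hn0 : (fun i => aeval Q (pderiv i f)) ≠ 0 := Function.ne_iff.mpr ⟨m, hm⟩
    have hue : aeval u e' = 0 :=
      aeval_eq_zero_of_proportional hk' (fun i j => by
        rw [mul_comm, hprop hf hQf, mul_comm]) hn0 hn
    obtain ⟨g, rfl⟩ := hdvd e' k' hk' hue
    have hH' : eval H.rep E = 0 := hH
    rw [map_mul, hH', zero_mul]

/-! ### Coordinate rings of hyperelliptic curves -/

/-- The coordinate ring of the affine curve `Y² = g(t)`. -/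
abbrev CurveRing (g : Polynomial ℂ) : Type := QuadraticAlgebra (Polynomial ℂ) g 0

namespace CurveRing

variable {g : Polynomial ℂ}

theorem norm_eq (z : CurveRing g) : z.norm = z.re ^ 2 - g * z.im ^ 2 := by
  rw [QuadraticAlgebra.norm_def]
  ring

/-- A simple root of g would have even multiplicity on the left and odd multiplicity on the right.
Hence the norm on the curve ring vanishes only at zero, which makes the ring a domain. -/
theorem eq_zero_of_sq_eq {t : ℂ} (hg : g.rootMultiplicity t = 1) {p q : Polynomial ℂ}
    (h : p ^ 2 = g * q ^ 2) : q = 0 := by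
  by_contra hq
  have hg0 : g ≠ 0 := by
    rintro rfl
    simp at hg
  have hp : p ≠ 0 := by
    rintro rfl
    refine mul_ne_zero hg0 (pow_ne_zero 2 hq) ?_
    rw [← h, zero_pow two_ne_zero]
  have hm := congrArg (Polynomial.rootMultiplicity t) h
  rw [Polynomial.rootMultiplicity_mul (mul_ne_zero hg0 (pow_ne_zero 2 hq)),
    sq, sq, Polynomial.rootMultiplicity_mul (mul_ne_zero hq hq),
    Polynomial.rootMultiplicity_mul (mul_ne_zero hp hp), hg] at hm
  omega

theorem isDomain {t : ℂ} (hg : g.rootMultiplicity t = 1) : IsDomain (CurveRing g) := by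
  have hnorm (z : CurveRing g) (hz : z.norm = 0) : z = 0 := by
    rw [norm_eq, sub_eq_zero] at hz
    have him := eq_zero_of_sq_eq hg hz
    rw [him] at hz
    ext1
    · simpa using hz
    · exact him
  have : NoZeroDivisors (CurveRing g) := ⟨fun {z w} h => by
    have := congrArg QuadraticAlgebra.norm h
    rw [map_mul, QuadraticAlgebra.norm_zero, mul_eq_zero] at this
    exact this.imp (hnorm z) (hnorm w)⟩
  exact NoZeroDivisors.to_isDomain _

/-- Evaluation of functions at a point of the curve. -/
def evalAt (t y : ℂ) (h : y ^ 2 = g.eval t) : CurveRing g →ₐ[ℂ] ℂ where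
  toFun z := z.re.eval t + z.im.eval t * y
  map_one' := by
    change (1 : Polynomial ℂ).eval t + (0 : Polynomial ℂ).eval t * y = 1
    simp
  map_zero' := by simp
  map_mul' z w := by
    simp
    linear_combination (-z.im.eval t * w.im.eval t) * h
  map_add' z w := by
    simp
    ring
  commutes' c := by
    change (Polynomial.C c).eval t + (0 : Polynomial ℂ).eval t * y = c
    simp

theorem evalAt_apply (t y : ℂ) (h : y ^ 2 = g.eval t) (z : CurveRing g) :
    evalAt t y h z = z.re.eval t + z.im.eval t * y := rfl

/-- The values at the conjugate points (t, y) and (t, −y) separate the two polynomial components. -/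
theorem eq_zero_of_evalAt (hg : g ≠ 0) {z : CurveRing g}
    (hz : ∀ (t y : ℂ) (h : y ^ 2 = g.eval t), evalAt t y h z = 0) : z = 0 := by
  have key (t : ℂ) : z.re.eval t = 0 ∧ z.im.eval t ^ 2 * g.eval t = 0 := by
    obtain ⟨y, hy⟩ := IsAlgClosed.exists_pow_nat_eq (g.eval t) two_pos
    have h1 := hz t y hy
    have h2 := hz t (-y) (by rw [neg_sq, hy])
    rw [evalAt_apply] at h1 h2
    have h3 : z.re.eval t = 0 := by linear_combination (h1 + h2) / 2
    refine ⟨h3, ?_⟩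
    rw [← hy]
    linear_combination (z.im.eval t * y) * (h1 - h3)
  ext1
  · exact Polynomial.funext fun t => by simpa using (key t).1
  · have : z.im ^ 2 * g = 0 := Polynomial.funext fun t => by simpa using (key t).2
    simpa [hg] using this

/-- The derivation that corresponds to the vector field `2 Y ∂/∂t + g' ∂/∂Y`. -/
def derivation (g : Polynomial ℂ) : Derivation ℂ (CurveRing g) (CurveRing g) :=
  Derivation.mk'
    { toFun := fun z => ⟨2 * Polynomial.derivative z.im * g + z.im * Polynomial.derivative g,
        2 * Polynomial.derivative z.re⟩
      map_add' := fun z w => by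
        ext1 <;> simp <;> ring
      map_smul' := fun c z => by
        ext1 <;> simp [Polynomial.smul_eq_C_mul] <;> ring }
    (fun z w => by
      ext1 <;> simp <;> ring)

theorem derivation_apply (z : CurveRing g) : derivation g z =
    ⟨2 * Polynomial.derivative z.im * g + z.im * Polynomial.derivative g,
      2 * Polynomial.derivative z.re⟩ := rfl

/-- Any three functions on the curve satisfy a homogeneous polynomial relation. -/
theorem exists_relation (Q : Fin 3 → CurveRing g) : ∃ (d : ℕ) (f : MvPolynomial (Fin 3) ℂ),
    f.IsHomogeneous d ∧ f ≠ 0 ∧ aeval Q f = 0 := by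
  obtain ⟨N, hN⟩ : ∃ N : ℕ, ∀ i, (Q i).re.natDegree ≤ N ∧ (Q i).im.natDegree ≤ N := by
    refine ⟨∑ i, ((Q i).re.natDegree + (Q i).im.natDegree), fun i => ?_⟩
    have := Finset.single_le_sum (f := fun i => (Q i).re.natDegree + (Q i).im.natDegree)
      (fun i _ => Nat.zero_le _) (Finset.mem_univ i)
    omega
  -- Multiplication by one of the Qᵢ raises the degree bound of both components by at most B.
  set B := N + g.natDegree with hB
  have hmul (z w : CurveRing g) (k : ℕ) (hz : z.re.natDegree ≤ k * B ∧ z.im.natDegree ≤ k * B)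
      (hw : w.re.natDegree ≤ N ∧ w.im.natDegree ≤ N) :
      (z * w).re.natDegree ≤ (k + 1) * B ∧ (z * w).im.natDegree ≤ (k + 1) * B := by
    have e : (k + 1) * B = k * B + N + g.natDegree := by rw [hB]; ring
    have h1 (p q : Polynomial ℂ) (hp : p.natDegree ≤ k * B) (hq : q.natDegree ≤ N) :
        (p * q).natDegree ≤ k * B + N := Polynomial.natDegree_mul_le_of_le hp hq
    have h2 : (g * (z.im * w.im)).natDegree ≤ k * B + N + g.natDegree := by
      rw [add_comm (k * B + N)]
      exact Polynomial.natDegree_mul_le_of_le le_rfl (h1 _ _ hz.2 hw.2)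
    rw [e, QuadraticAlgebra.re_mul, QuadraticAlgebra.im_mul, zero_mul, zero_mul, add_zero,
      mul_assoc]
    refine ⟨Polynomial.natDegree_add_le_of_degree_le ((h1 _ _ hz.1 hw.1).trans ?_) h2,
      Polynomial.natDegree_add_le_of_degree_le ((h1 _ _ hz.1 hw.2).trans ?_)
        ((h1 _ _ hz.2 hw.1).trans ?_)⟩ <;> omega
  have hmon (m : Fin 3 →₀ ℕ) : (aeval Q (monomial m (1 : ℂ))).re.natDegree ≤ m.degree * B ∧
      (aeval Q (monomial m (1 : ℂ))).im.natDegree ≤ m.degree * B := by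
    induction hk : m.degree generalizing m with
    | zero =>
      rw [(Finsupp.degree_eq_zero_iff m).mp hk, monomial_zero', map_one, map_one]
      change (1 : Polynomial ℂ).natDegree ≤ 0 * B ∧ (0 : Polynomial ℂ).natDegree ≤ 0 * B
      simp
    | succ k ih =>
      obtain ⟨i, hi⟩ : ∃ i, m i ≠ 0 := by
        by_contra! h
        rw [show m = 0 from Finsupp.ext h] at hk
        simp at hk
      have hm : m - Finsupp.single i 1 + Finsupp.single i 1 = m :=
        tsub_add_cancel_of_le (Finsupp.single_le_iff.mpr (Nat.one_le_iff_ne_zero.mpr hi))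
      have hk' : (m - Finsupp.single i 1).degree = k := by
        have := congrArg Finsupp.degree hm
        rw [map_add, Finsupp.degree_single] at this
        omega
      have hX : monomial m (1 : ℂ) = monomial (m - Finsupp.single i 1) 1 * X i := by
        rw [X, monomial_mul, hm, one_mul]
      rw [hX, map_mul, aeval_X]
      exact hmul _ _ k (ih _ hk') (hN i)
  -- The n² chosen monomials of degree 2n map into a space of dimension 2(2nB + 1), and n² = 4nB +
  -- 3n is larger.
  let n := 4 * B + 3
  let e (x : Fin n × Fin n) : Fin 3 →₀ ℕ :=
    Finsupp.equivFunOnFinite.symm ![(x.1 : ℕ), (x.2 : ℕ), 2 * n - x.1 - x.2]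
  have hdeg (x) : (e x).degree = 2 * n := by
    have h1 := x.1.isLt
    have h2 := x.2.isLt
    simp [e, Finsupp.degree_eq_sum, Fin.sum_univ_three]
    omega
  have hinj : Function.Injective e := by
    intro x y h
    have h0 := DFunLike.congr_fun h 0
    have h1 := DFunLike.congr_fun h 1
    simp [e] at h0 h1
    exact Prod.ext (Fin.ext h0) (Fin.ext h1)
  let F : (Fin n × Fin n → ℂ) →ₗ[ℂ] MvPolynomial (Fin 3) ℂ :=
    Fintype.linearCombination ℂ fun x => monomial (e x) (1 : ℂ)
  have hF (c) : F c = ∑ x, monomial (e x) (c x) := by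
    simp [F, Fintype.linearCombination_apply, smul_monomial]
  let reC (j : ℕ) : CurveRing g →ₗ[ℂ] ℂ :=
    { toFun := fun z => z.re.coeff j
      map_add' := fun z w => by simp
      map_smul' := fun c z => by simp }
  let imC (j : ℕ) : CurveRing g →ₗ[ℂ] ℂ :=
    { toFun := fun z => z.im.coeff j
      map_add' := fun z w => by simp
      map_smul' := fun c z => by simp }
  let K := 2 * n * B + 1
  let L : (Fin n × Fin n → ℂ) →ₗ[ℂ] (Fin K → ℂ) × (Fin K → ℂ) :=
    (LinearMap.prod (LinearMap.pi fun j => reC j) (LinearMap.pi fun j => imC j)) ∘ₗ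
      (aeval Q).toLinearMap ∘ₗ F
  have hrank : Module.finrank ℂ ((Fin K → ℂ) × (Fin K → ℂ)) <
      Module.finrank ℂ (Fin n × Fin n → ℂ) := by
    rw [Module.finrank_prod, Module.finrank_fin_fun, Module.finrank_fintype_fun_eq_card,
      Fintype.card_prod, Fintype.card_fin]
    simp only [K, n]
    nlinarith
  obtain ⟨c, hc, hc0⟩ := (Submodule.ne_bot_iff _).mp (LinearMap.ker_ne_bot_of_finrank_lt hrank)
  have hL : L c = 0 := hc
  refine ⟨2 * n, F c, ?_, fun h => ?_, ?_⟩
  · rw [hF]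
    exact IsHomogeneous.sum _ _ _ fun x _ => isHomogeneous_monomial _ (hdeg x)
  · obtain ⟨x, hx⟩ := Function.ne_iff.mp hc0
    have hcoeff := congrArg (coeff (e x)) h
    rw [hF, coeff_sum, coeff_zero] at hcoeff
    simp only [coeff_monomial, hinj.eq_iff] at hcoeff
    simp at hcoeff
    exact hx hcoeff
  · obtain ⟨G, hG⟩ : ∃ G : Fin n × Fin n → CurveRing g,
        ∀ x, G x = aeval Q (monomial (e x) (1 : ℂ)) := ⟨_, fun _ => rfl⟩
    have hFG : aeval Q (F c) = ∑ x, c x • G x := by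
      simp only [F, Fintype.linearCombination_apply, map_sum, map_smul, hG]
    have hGdeg (x) : (G x).re.natDegree < K ∧ (G x).im.natDegree < K := by
      have := hmon (e x)
      rw [hdeg, ← hG] at this
      exact ⟨Nat.lt_succ_of_le this.1, Nat.lt_succ_of_le this.2⟩
    have hlarge (l : CurveRing g →ₗ[ℂ] ℂ) (hl : ∀ x, l (G x) = 0) : l (aeval Q (F c)) = 0 := by
      rw [hFG, map_sum]
      refine Finset.sum_eq_zero fun x _ => ?_
      rw [map_smul, hl, smul_zero]
    ext1
    · refine Polynomial.ext fun j => ?_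
      change reC j (aeval Q (F c)) = 0
      by_cases hj : j < K
      · exact congrFun (congrArg Prod.fst hL) ⟨j, hj⟩
      · exact hlarge _ fun x => Polynomial.coeff_eq_zero_of_natDegree_lt
          ((hGdeg x).1.trans_le (not_lt.mp hj))
    · refine Polynomial.ext fun j => ?_
      change imC j (aeval Q (F c)) = 0
      by_cases hj : j < K
      · exact congrFun (congrArg Prod.snd hL) ⟨j, hj⟩
      · exact hlarge _ fun x => Polynomial.coeff_eq_zero_of_natDegree_lt
          ((hGdeg x).2.trans_le (not_lt.mp hj))

end CurveRing

/-! ### Tangent planes of the torus through a general center -/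

/-- The conditions on the coordinates of the center of projection. -/
structure IsGenericCenter (a b : ℝ) (o : Fin 4 → ℝ) : Prop where
  off_equator : o 2 ≠ 0
  off_axis : o 0 ^ 2 + o 1 ^ 2 ≠ 0
  finite : o 3 ≠ 0
  -- Since b − 4a = 4r², this keeps the center off the planes z = ±rw, which touch the torus along
  -- circles.
  off_top : 4 * o 2 ^ 2 ≠ (b - 4 * a) * o 3 ^ 2
  off_torus : (o 0 ^ 2 + o 1 ^ 2 + o 2 ^ 2 + a * o 3 ^ 2) ^ 2
    - b * (o 0 ^ 2 + o 1 ^ 2) * o 3 ^ 2 ≠ 0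
  -- This is the product of the two factors x² + y² − (R ± r)²w²: the center avoids the cylinders
  -- over the two equators.
  off_circles : (o 0 ^ 2 + o 1 ^ 2) ^ 2 - (b - 2 * a) * (o 0 ^ 2 + o 1 ^ 2) * o 3 ^ 2
    + a ^ 2 * o 3 ^ 4 ≠ 0

/-- The squared distance of the center from the axis of the torus. -/
def axisSq (o : Fin 4 → ℝ) : ℂ := (o 0 : ℂ) ^ 2 + (o 1 : ℂ) ^ 2

theorem IsGenericCenter.axisSq_ne_zero {a b : ℝ} {o : Fin 4 → ℝ} (ho : IsGenericCenter a b o) :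
    axisSq o ≠ 0 := by
  rw [axisSq]
  exact_mod_cast ho.off_axis

section Parametrization

variable (R : ℝ) (r : ℂ) (o : Fin 4 → ℝ) {A : Type*} [CommRing A] [Algebra ℂ A]

/-- A quadratic polynomial that occurs in the parametrization of the tangent planes through `o`. -/
def ellFun (t : A) : A :=
  algebraMap ℂ A (R * o 3) * (t ^ 2 + 1) + algebraMap ℂ A (2 * r * o 3) * t
    + algebraMap ℂ A (Complex.I * o 2) * (t ^ 2 - 1)

/-- The tangent planes of the torus that pass through `o`, parametrized by the points of the curve
`y² = axisSq o * (t² + 1)² - (ellFun t)²`. -/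
def planeFun (t y : A) : Fin 4 → A :=
  -- With κ = `axisSq o`, the conic u² + z² = u'² is parametrized by u = κ(t² + 1), u' = 2κt, z =
  -- −iκ(t² − 1), and w = −(Ru + ru'). Incidence with o says that the first two coordinates have
  -- inner product κ · `ellFun` with (o₀, o₁); their inner product with (−o₁, o₀) is κy.
  ![algebraMap ℂ A (o 0) * ellFun R r o t - algebraMap ℂ A (o 1) * y,
    algebraMap ℂ A (o 1) * ellFun R r o t + algebraMap ℂ A (o 0) * y,
    algebraMap ℂ A (-Complex.I * axisSq o) * (t ^ 2 - 1),
    -(algebraMap ℂ A (R * axisSq o) * (t ^ 2 + 1) + algebraMap ℂ A (r * (2 * axisSq o)) * t)]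

/-- The factor that vanishes at the tangent planes in the nodes of the torus. -/
def nodeFun (t : A) : A :=
  algebraMap ℂ A (R * (2 * axisSq o)) * t + algebraMap ℂ A (r * axisSq o) * (t ^ 2 + 1)

/-- The points of contact of the tangent planes `planeFun`. -/
def contactFun (t y : A) : Fin 4 → A :=
  ![nodeFun R r o t * planeFun R r o t y 0, nodeFun R r o t * planeFun R r o t y 1,
    algebraMap ℂ A (r * axisSq o) * (t ^ 2 + 1) * planeFun R r o t y 2,
    algebraMap ℂ A (axisSq o * (2 * axisSq o)) * (t ^ 2 + 1) * t]

variable {R r o} {B : Type*} [CommRing B] [Algebra ℂ B] (e : A →ₐ[ℂ] B)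

theorem map_ellFun (t : A) : e (ellFun R r o t) = ellFun R r o (e t) := by
  simp only [ellFun, map_add, map_mul, map_sub, map_pow, map_one, AlgHom.commutes]

theorem map_nodeFun (t : A) : e (nodeFun R r o t) = nodeFun R r o (e t) := by
  simp only [nodeFun, map_add, map_mul, map_pow, map_one, AlgHom.commutes]

theorem map_planeFun (t y : A) (i : Fin 4) :
    e (planeFun R r o t y i) = planeFun R r o (e t) (e y) i := by
  fin_cases i <;>
  · simp [planeFun, -map_mul, -map_neg]
    simp only [map_add, map_sub, map_mul e, map_neg e, map_pow, map_one, AlgHom.commutes,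
      map_ellFun]

theorem map_contactFun (t y : A) (i : Fin 4) :
    e (contactFun R r o t y i) = contactFun R r o (e t) (e y) i := by
  fin_cases i <;>
  · simp [contactFun, -map_mul, -map_neg]
    simp only [map_add, map_mul e, map_pow, map_one, AlgHom.commutes, map_nodeFun, map_planeFun]

end Parametrization

section Pointwise

variable {a b : ℝ} {R : ℝ} {r : ℂ} {o : Fin 4 → ℝ} {t y : ℂ}

theorem planeFun_dot_center (t y : ℂ) : ∑ i, planeFun R r o t y i * (o i : ℂ) = 0 := by
  simp [Fin.sum_univ_four, planeFun, ellFun, axisSq]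
  ring

theorem planeFun_sqrts (hy : y ^ 2 = axisSq o * (t ^ 2 + 1) ^ 2 - ellFun R r o t ^ 2) :
    planeFun R r o t y 0 ^ 2 + planeFun R r o t y 1 ^ 2 = (axisSq o * (t ^ 2 + 1)) ^ 2 ∧
    planeFun R r o t y 2 ^ 2 = (2 * axisSq o * t) ^ 2 - (axisSq o * (t ^ 2 + 1)) ^ 2 ∧
    planeFun R r o t y 3 = -(R * (axisSq o * (t ^ 2 + 1)) + r * (2 * axisSq o * t)) := by
  refine ⟨?_, ?_, ?_⟩
  · simp [planeFun]
    generalize ellFun R r o t = l at hy ⊢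
    rw [axisSq] at *
    linear_combination (o 0 ^ 2 + o 1 ^ 2) * hy
  · simp [planeFun]
    linear_combination (axisSq o * (t ^ 2 - 1)) ^ 2 * Complex.I_sq
  · simp [planeFun]
    ring

theorem contactFun_eq (t y : ℂ) : contactFun R r o t y =
    ![(R * (2 * axisSq o * t) + r * (axisSq o * (t ^ 2 + 1))) * planeFun R r o t y 0,
      (R * (2 * axisSq o * t) + r * (axisSq o * (t ^ 2 + 1))) * planeFun R r o t y 1,
      r * (axisSq o * (t ^ 2 + 1)) * planeFun R r o t y 2,
      axisSq o * (t ^ 2 + 1) * (2 * axisSq o * t)] := by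
  ext i
  fin_cases i <;> simp [contactFun, nodeFun, -mul_eq_mul_right_iff] <;> ring

theorem nodeFun_eq (t : ℂ) : nodeFun R r o t =
    R * (2 * axisSq o * t) + r * (axisSq o * (t ^ 2 + 1)) := by
  simp [nodeFun]
  ring

/-- A zero would give t² = 1 and R + rt = 0, hence a = R² − r² = 0. -/
theorem IsRadii.planeFun_ne_zero (h : IsRadii a b R r) (ho : axisSq o ≠ 0) (t y : ℂ) :
    planeFun R r o t y ≠ 0 := by
  intro h0
  have h2 : axisSq o * (t ^ 2 - 1) = 0 := by simpa [planeFun] using congrFun h0 2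
  have h3 : axisSq o * (R * (t ^ 2 + 1) + 2 * r * t) = 0 := by
    have h3 : -(r * (2 * axisSq o) * t) - R * axisSq o * (t ^ 2 + 1) = 0 := by
      simpa [planeFun, sub_eq_add_neg] using congrFun h0 3
    linear_combination -h3
  replace h2 := (mul_eq_zero.mp h2).resolve_left ho
  replace h3 := (mul_eq_zero.mp h3).resolve_left ho
  apply h.a_ne
  rw [h.ha]
  linear_combination (R - r * t) / 2 * h3 + (r ^ 2 - R * (R - r * t) / 2) * h2

theorem planeFun_dot_contactFun (hy : y ^ 2 = axisSq o * (t ^ 2 + 1) ^ 2 - ellFun R r o t ^ 2) :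
    ∑ i, contactFun R r o t y i * planeFun R r o t y i = 0 := by
  obtain ⟨h1, h2, h3⟩ := planeFun_sqrts hy
  rw [contactFun_eq]
  simp [Fin.sum_univ_four]
  rw [h3]
  linear_combination (R * (2 * axisSq o * t) + r * (axisSq o * (t ^ 2 + 1))) * h1
    + r * (axisSq o * (t ^ 2 + 1)) * h2

theorem IsRadii.contactFun_torus (h : IsRadii a b R r)
    (hy : y ^ 2 = axisSq o * (t ^ 2 + 1) ^ 2 - ellFun R r o t ^ 2) :
    eval (contactFun R r o t y) (torusForm a b) = 0 ∧
      grad (torusForm a b) (contactFun R r o t y) = (8 * R * r * nodeFun R r o t *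
        (axisSq o * (t ^ 2 + 1)) ^ 3 * (2 * axisSq o * t)) • planeFun R r o t y := by
  obtain ⟨h1, h2, h3⟩ := planeFun_sqrts hy
  rw [nodeFun_eq]
  exact h.torus_point h1 h2 h3 (contactFun_eq t y)

/-- From (u + iz)(u − iz) = u'² the parameter is t = (u + iz)/u'. The planes with u' = 0 are left
out here and are handled later by coprimality with q. -/
theorem exists_planeFun_eq {v : Fin 4 → ℂ} {u u' : ℂ} (ho : axisSq o ≠ 0)
    (hv : ∑ i, v i * (o i : ℂ) = 0) (hs : v 0 ^ 2 + v 1 ^ 2 = u ^ 2)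
    (hz : v 2 ^ 2 = u' ^ 2 - u ^ 2) (hw : v 3 = -(R * u + r * u')) (hu' : u' ≠ 0) :
    ∃ t y c : ℂ, y ^ 2 = axisSq o * (t ^ 2 + 1) ^ 2 - ellFun R r o t ^ 2 ∧ c ≠ 0 ∧
      planeFun R r o t y = c • v ∧ axisSq o * (t ^ 2 + 1) = c * u ∧ 2 * axisSq o * t = c * u' := by
  have hI := Complex.I_sq
  have hm : u + Complex.I * v 2 ≠ 0 := by
    intro hm
    refine pow_ne_zero 2 hu' ?_
    linear_combination (u - Complex.I * v 2) * hm - hz + v 2 ^ 2 * hI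
  generalize hmd : u + Complex.I * v 2 = m at hm
  have h1 : (m / u') ^ 2 + 1 = 2 * m / u' ^ 2 * u := by
    field_simp
    rw [← hmd]
    linear_combination v 2 ^ 2 * hI - hz
  have h2 : (m / u') ^ 2 - 1 = 2 * m / u' ^ 2 * (Complex.I * v 2) := by
    field_simp
    rw [← hmd]
    linear_combination -v 2 ^ 2 * hI + hz
  have h3 : m / u' = m / u' ^ 2 * u' := by
    field_simp
  have hl : ellFun R r o (m / u') = 2 * m / u' ^ 2 * (o 0 * v 0 + o 1 * v 1) := by
    simp [Fin.sum_univ_four] at hv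
    simp only [ellFun, h1, h2, Algebra.algebraMap_self, RingHom.id_apply]
    rw [h3, hw] at *
    linear_combination (2 * m / u' ^ 2) * (o 2 * v 2 * hI - hv)
  refine ⟨m / u', 2 * m / u' ^ 2 * (o 0 * v 1 - o 1 * v 0), 2 * m / u' ^ 2 * axisSq o, ?_,
    by simp [hm, hu', ho], ?_, ?_, ?_⟩
  · rw [hl, h1, axisSq]
    linear_combination (2 * m / u' ^ 2) ^ 2 * (o 0 ^ 2 + o 1 ^ 2 : ℂ) * hs
  · ext i
    fin_cases i
    · simp [planeFun, hl, axisSq]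
      ring
    · simp [planeFun, hl, axisSq]
      ring
    · simp [planeFun, h2]
      linear_combination -axisSq o * (2 * m / u' ^ 2) * v 2 * hI
    · simp [planeFun, h1]
      rw [h3, hw]
      ring
  · rw [h1]
    ring
  · rw [h3]
    ring

/-- Every critical point of the projection from a generic center is a point of contact of one of the
tangent planes `planeFun`. -/
theorem exists_contactFun_eq (h : IsRadii a b R r) (ho : IsGenericCenter a b o) {p : Fin 4 → ℂ}
    (hp : eval p (torusForm a b) = 0) (hg : grad (torusForm a b) p ≠ 0)
    (hgo : ∑ i, grad (torusForm a b) p i * (o i : ℂ) = 0) :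
    ∃ t y c : ℂ, y ^ 2 = axisSq o * (t ^ 2 + 1) ^ 2 - ellFun R r o t ^ 2 ∧ c ≠ 0 ∧
      contactFun R r o t y = c • p := by
  obtain ⟨hw, d, hd, hW, e⟩ := h.exists_axis_distance hp hg
  have hκ := ho.axisSq_ne_zero
  have h8 : 8 * R * p 3 ≠ 0 := by simp [h.R_ne, hw]
  rw [e] at hgo
  simp [Fin.sum_univ_four] at hgo
  have hvo : (d - R * p 3) * p 0 * o 0 + (d - R * p 3) * p 1 * o 1 + d * p 2 * o 2
      + d * (a * p 3 - R * d) * o 3 = 0 := by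
    refine (mul_eq_zero.mp ?_).resolve_left h8
    linear_combination hgo
  -- For d = 0 incidence with o, which is off the axis, forces x = y = 0, where the gradient
  -- vanishes.
  have hd0 : d ≠ 0 := by
    rintro rfl
    have h1 : p 0 * o 0 + p 1 * o 1 = 0 := by
      refine (mul_eq_zero.mp ?_).resolve_left (mul_ne_zero h.R_ne hw)
      linear_combination -hvo
    have h2 : p 0 = 0 := by
      rw [← sq_eq_zero_iff]
      refine (mul_eq_zero.mp ?_).resolve_left hκ
      rw [axisSq]
      linear_combination (p 0 * o 0 - p 1 * o 1) * h1 + (o 1 : ℂ) ^ 2 * hd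
    have h3 : p 1 = 0 := by
      rw [← sq_eq_zero_iff]
      simpa [h2] using hd
    apply hg
    rw [e]
    simp [h2, h3]
  -- The points with d = Rw lie on the circles of contact of the planes z = ±rw, which avoid o by
  -- `off_top`.
  have hd1 : d - R * p 3 ≠ 0 := by
    intro hd1
    have h1 : p 2 * o 2 - r ^ 2 * p 3 * o 3 = 0 := by
      refine (mul_eq_zero.mp ?_).resolve_left hd0
      linear_combination hvo - (p 0 * o 0 + p 1 * o 1 - R * d * o 3) * hd1
        - d * p 3 * o 3 * h.ha
    have h2 : p 2 ^ 2 = r ^ 2 * p 3 ^ 2 := by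
      linear_combination hW - p 3 ^ 2 * h.ha - (d - R * p 3) * hd1
    have h3 : r ^ 2 * p 3 ^ 2 * (o 2 ^ 2 - r ^ 2 * o 3 ^ 2) = 0 := by
      linear_combination (p 2 * o 2 + r ^ 2 * p 3 * o 3) * h1 - (o 2 : ℂ) ^ 2 * h2
    have h4 := (mul_eq_zero.mp h3).resolve_left (by simp [h.r_ne, hw])
    apply ho.off_top
    have h5 : 4 * (o 2 : ℂ) ^ 2 = (b - 4 * a) * (o 3 : ℂ) ^ 2 := by
      rw [h.ha, h.hb]
      linear_combination 4 * h4
    exact_mod_cast h5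
  let v : Fin 4 → ℂ :=
    ![(d - R * p 3) * p 0, (d - R * p 3) * p 1, d * p 2, d * (a * p 3 - R * d)]
  obtain ⟨t, y, c, hy, hc, hpl, hu, hu'⟩ := exists_planeFun_eq (R := R) (r := r) (o := o) (v := v)
    (u := (d - R * p 3) * d) (u' := d * r * p 3) hκ
    (by simp [v, Fin.sum_univ_four]; linear_combination hvo)
    (by simp [v]; linear_combination (d - R * p 3) ^ 2 * hd)
    (by simp [v]; linear_combination d ^ 2 * (hW - p 3 ^ 2 * h.ha))
    (by simp [v]; linear_combination d * p 3 * h.ha)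
    (by simp [hd0, h.r_ne, hw])
  refine ⟨t, y, c ^ 2 * (r * d ^ 2 * (d - R * p 3)), hy, by simp [hc, h.r_ne, hd0, hd1], ?_⟩
  rw [contactFun_eq, hpl, hu, hu']
  ext i
  fin_cases i <;> simp [v] <;> ring

/-- The branch points of the curve that parametrizes the tangent planes through `o`. -/
theorem exists_branch_point (h : IsRadii a b R r) (ho : IsGenericCenter a b o) :
    ∃ t : ℂ, axisSq o * (t ^ 2 + 1) ^ 2 - ellFun R r o t ^ 2 = 0 ∧ t ^ 2 + 1 ≠ 0 ∧
      nodeFun R r o t ≠ 0 ∧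
      4 * axisSq o * t * (t ^ 2 + 1) - 2 * ellFun R r o t *
        (2 * R * o 3 * t + 2 * r * o 3 + 2 * Complex.I * o 2 * t) ≠ 0 := by
  -- With k² = κ the branch polynomial is (k(t² + 1) − ℓ)(k(t² + 1) + ℓ), where ℓ is `ellFun`. The
  -- roots of the first factor are used; α is its leading coefficient and δ² a quarter of its
  -- discriminant.
  obtain ⟨k, hk⟩ : ∃ k : ℝ, (k : ℂ) ^ 2 = axisSq o := by
    refine ⟨Real.sqrt (o 0 ^ 2 + o 1 ^ 2), ?_⟩
    rw [axisSq]
    exact_mod_cast Real.sq_sqrt (by positivity)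
  have hκ := ho.axisSq_ne_zero
  have hI := Complex.I_sq
  have him : Complex.I * o 2 ≠ 0 := by simp [ho.off_equator]
  -- The center is real and k, R are real, so the imaginary part is −o₂ ≠ 0.
  have hA : k - R * o 3 - Complex.I * o 2 ≠ 0 := by
    intro h0
    apply ho.off_equator
    have := congrArg Complex.im h0
    simpa using this
  obtain ⟨δ, hδ⟩ := IsAlgClosed.exists_pow_nat_eq
    (r ^ 2 * o 3 ^ 2 - (k - R * o 3 - Complex.I * o 2) * (k - R * o 3 + Complex.I * o 2)) two_pos
  generalize hAd : k - R * o 3 - Complex.I * o 2 = α at hA hδ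
  have hδ0 : δ ≠ 0 := by
    rintro rfl
    have h1 : (axisSq o + o 2 ^ 2 + a * o 3 ^ 2) ^ 2 - b * axisSq o * o 3 ^ 2 = 0 := by
      rw [h.ha, h.hb, ← hk]
      rw [← hAd] at hδ
      linear_combination ((k + R * o 3) ^ 2 + o 2 ^ 2 - r ^ 2 * o 3 ^ 2) * hδ
        + ((k + R * o 3) ^ 2 + o 2 ^ 2 - r ^ 2 * o 3 ^ 2) * o 2 ^ 2 * hI
    apply ho.off_torus
    rw [axisSq] at h1
    exact_mod_cast h1
  have hroot (ε : ℂ) (hε : ε ^ 2 = δ ^ 2) :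
      k * (((r * o 3 + ε) / α) ^ 2 + 1) = ellFun R r o ((r * o 3 + ε) / α) := by
    simp only [ellFun, Algebra.algebraMap_self, RingHom.id_apply]
    have ht : (r * o 3 + ε) / α * α = r * o 3 + ε := div_mul_cancel₀ _ hA
    generalize (r * o 3 + ε) / α = t at ht
    refine mul_left_cancel₀ hA ?_
    linear_combination α * (t ^ 2 * hAd) + (α * t + ε - r * o 3) * ht + hε + hδ
  have hgood (t : ℂ) (ht : k * (t ^ 2 + 1) = ellFun R r o t) : t ^ 2 + 1 ≠ 0 := by
    intro h0
    have h1 : r * o 3 * t = Complex.I * o 2 := by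
      simp only [ellFun, Algebra.algebraMap_self, RingHom.id_apply] at ht
      linear_combination (-ht + (k - R * o 3 - Complex.I * o 2) * h0) / 2
    apply ho.off_top
    have h2 : 4 * (o 2 : ℂ) ^ 2 = (b - 4 * a) * (o 3 : ℂ) ^ 2 := by
      rw [h.ha, h.hb]
      linear_combination 4 * (r * o 3 * t + Complex.I * o 2) * h1 - 4 * r ^ 2 * o 3 ^ 2 * h0
        + 4 * o 2 ^ 2 * hI
    exact_mod_cast h2
  -- If `nodeFun` vanished at both roots, they would be the zeros of rt² + 2Rt + r and have product
  -- 1. Their product is (k − Ro₃ + io₂)/α, so o₂ would be 0.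
  obtain ⟨ε, hε, hnode⟩ : ∃ ε, ε ^ 2 = δ ^ 2 ∧ nodeFun R r o ((r * o 3 + ε) / α) ≠ 0 := by
    by_contra! hall
    have h1 := hall δ rfl
    have h2 := hall (-δ) (neg_sq δ)
    have ht1 : (r * o 3 + δ) / α * α = r * o 3 + δ := div_mul_cancel₀ _ hA
    have ht2 : (r * o 3 + -δ) / α * α = r * o 3 + -δ := div_mul_cancel₀ _ hA
    generalize (r * o 3 + δ) / α = t₁ at h1 ht1
    generalize (r * o 3 + -δ) / α = t₂ at h2 ht2
    rw [nodeFun_eq] at h1 h2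
    have h3 : 2 * R + r * (t₁ + t₂) = 0 := by
      refine (mul_eq_zero.mp ?_).resolve_left (mul_ne_zero hδ0 hκ)
      linear_combination α / 2 * (h1 - h2)
        - axisSq o * (2 * R + r * (t₁ + t₂)) / 2 * (ht1 - ht2)
    have h4 : 1 - t₁ * t₂ = 0 := by
      refine (mul_eq_zero.mp ?_).resolve_left (mul_ne_zero h.r_ne hκ)
      linear_combination h1 - axisSq o * t₁ * h3
    apply him
    have h5 : α - (k - R * o 3 + Complex.I * o 2) = 0 := by
      refine (mul_eq_zero.mp ?_).resolve_left hA
      linear_combination α ^ 2 * h4 + α * t₂ * ht1 + (r * o 3 + δ) * ht2 - hδ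
    linear_combination (-h5 - hAd) / 2
  refine ⟨_, ?_, hgood _ (hroot ε hε), hnode, ?_⟩
  · rw [← hroot ε hε, ← hk]
    ring
  · have hg := hgood _ (hroot ε hε)
    rw [← hroot ε hε, ← hk]
    have hε0 : ε ≠ 0 := by
      rintro rfl
      apply hδ0
      simpa using hε.symm
    have hk0 : (k : ℂ) ≠ 0 := by
      intro hk0
      rw [hk0] at hk
      apply hκ
      rw [← hk]
      ring
    -- At a root of the first factor the second one is 2k(t² + 1), and the derivative of the first
    -- is 2(αt − ro₃) = 2ε.
    have e1 : 4 * (k : ℂ) ^ 2 * ((r * o 3 + ε) / α) * (((r * o 3 + ε) / α) ^ 2 + 1) -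
        2 * (k * (((r * o 3 + ε) / α) ^ 2 + 1)) * (2 * R * o 3 * ((r * o 3 + ε) / α)
          + 2 * r * o 3 + 2 * Complex.I * o 2 * ((r * o 3 + ε) / α)) =
        4 * k * (((r * o 3 + ε) / α) ^ 2 + 1) * ε := by
      have : (r * o 3 + ε) / α * α = r * o 3 + ε := by field_simp
      rw [← hAd] at this ⊢
      linear_combination 4 * k * (((r * o 3 + ε) / (k - R * o 3 - Complex.I * o 2)) ^ 2 + 1) * this
    rw [e1]
    simp [hk0, hg, hε0]

end Pointwise

/-! ### Central projections -/

/-- The pullback of a form along the linear map with matrix `Aᵀ`. -/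
def pullback {m n : ℕ} (A : Matrix (Fin m) (Fin n) ℂ) (f : MvPolynomial (Fin n) ℂ) :
    MvPolynomial (Fin m) ℂ :=
  aeval (fun j => ∑ k, C (A k j) * X k) f

theorem aeval_pullback {m n : ℕ} (A : Matrix (Fin m) (Fin n) ℂ) {B : Type*} [CommRing B]
    [Algebra ℂ B] (u : Fin m → B) (f : MvPolynomial (Fin n) ℂ) :
    aeval u (pullback A f) = aeval (fun j => ∑ k, algebraMap ℂ B (A k j) * u k) f := by
  rw [pullback, ← AlgHom.comp_apply, comp_aeval]
  simp

theorem eval_pullback {m n : ℕ} (A : Matrix (Fin m) (Fin n) ℂ) (u : Fin m → ℂ)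
    (f : MvPolynomial (Fin n) ℂ) : eval u (pullback A f) = eval (A.transpose.mulVec u) f := by
  have := aeval_pullback A u f
  rw [aeval_eq_eval, aeval_eq_eval] at this
  exact this

theorem isHomogeneous_pullback {m n d : ℕ} (A : Matrix (Fin m) (Fin n) ℂ)
    {f : MvPolynomial (Fin n) ℂ} (hf : f.IsHomogeneous d) : (pullback A f).IsHomogeneous d := by
  have := hf.aeval (fun j => ∑ k, C (A k j) * (X k : MvPolynomial (Fin m) ℂ)) (n := 1)
    fun j => IsHomogeneous.sum _ _ _ fun k _ => isHomogeneous_C_mul_X _ _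
  rwa [one_mul] at this

/-- `A` is the matrix of a projection with center `o`, and `N` is a right inverse of `A`. -/
structure IsSplitProjection (A : Matrix (Fin 3) (Fin 4) ℂ) (N : Matrix (Fin 4) (Fin 3) ℂ)
    (o : Fin 4 → ℝ) : Prop where
  center (i : Fin 3) : ∑ j, A i j * (o j : ℂ) = 0
  right_inv : A * N = 1
  left_inv : ∃ c : Fin 4 → ℂ, ∀ i j, (N * A) i j = (if i = j then 1 else 0) - o i * c j

/-- Rank and nullity make M surjective. For a right inverse N the columns of 1 − NM lie in the
kernel of M, so they are multiples of o. -/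
theorem IsProjectionFrom.exists_isSplitProjection {M : Matrix (Fin 3) (Fin 4) ℝ}
    {o : Projectivization ℝ (Fin 4 → ℝ)} (h : IsProjectionFrom M o) :
    ∃ N, IsSplitProjection (complexify M) N o.rep := by
  have hker : LinearMap.ker M.mulVecLin = o.submodule := h
  have hsurj : LinearMap.range M.mulVecLin = ⊤ := by
    refine Submodule.eq_top_of_finrank_eq ?_
    have := LinearMap.finrank_range_add_finrank_ker M.mulVecLin
    rw [hker, Projectivization.finrank_submodule, Module.finrank_fin_fun] at this
    rw [Module.finrank_fin_fun]
    omega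
  obtain ⟨N, hN⟩ := LinearMap.exists_rightInverse_of_surjective M.mulVecLin hsurj
  have hMN : M * LinearMap.toMatrix' N = 1 := by
    have := congrArg LinearMap.toMatrix' hN
    rwa [LinearMap.toMatrix'_comp, LinearMap.toMatrix'_id, ← Matrix.toLin'_apply',
      LinearMap.toMatrix'_toLin'] at this
  generalize LinearMap.toMatrix' N = N at hMN
  have ho : M.mulVec o.rep = 0 := by
    have : o.rep ∈ LinearMap.ker M.mulVecLin := by
      rw [hker, Projectivization.submodule_eq]
      exact Submodule.mem_span_singleton_self _
    simpa using this
  have hc (j : Fin 4) : ∃ c : ℝ, ∀ i, (N * M) i j = (if i = j then 1 else 0) - o.rep i * c := by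
    have : (fun i => (1 - N * M : Matrix (Fin 4) (Fin 4) ℝ) i j) ∈ LinearMap.ker M.mulVecLin := by
      rw [LinearMap.mem_ker, Matrix.mulVecLin_apply]
      ext k
      have : (M * (1 - N * M) : Matrix (Fin 3) (Fin 4) ℝ) k j = 0 := by
        rw [Matrix.mul_sub, Matrix.mul_one, ← Matrix.mul_assoc, hMN, Matrix.one_mul, sub_self,
          Matrix.zero_apply]
      exact this
    rw [hker, Projectivization.submodule_eq, Submodule.mem_span_singleton] at this
    obtain ⟨c, hc⟩ := this
    refine ⟨c, fun i => ?_⟩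
    have := congrFun hc i
    rw [Pi.smul_apply, smul_eq_mul, Matrix.sub_apply, Matrix.one_apply] at this
    linear_combination this
  choose c hc using hc
  refine ⟨N.map (fun t : ℝ => (t : ℂ)), fun i => ?_, ?_, fun j => c j, fun i j => ?_⟩
  · have := congrFun ho i
    simp only [Matrix.mulVec, dotProduct, Pi.zero_apply] at this
    simp only [complexify, Matrix.map_apply]
    exact_mod_cast this
  · have := Matrix.map_mul (L := M) (M := N) (f := Complex.ofRealHom)
    rw [hMN, Matrix.map_one _ (map_zero _) (map_one _)] at this
    exact this.symm
  · have := hc j i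
    simp only [Matrix.mul_apply, complexify, Matrix.map_apply] at this ⊢
    have h2 := congrArg (fun t : ℝ => (t : ℂ)) this
    push_cast [apply_ite] at h2
    exact h2

namespace IsSplitProjection

variable {A : Matrix (Fin 3) (Fin 4) ℂ} {N : Matrix (Fin 4) (Fin 3) ℂ} {o : Fin 4 → ℝ}

theorem eq_of_mulVec_eq_zero (h : IsSplitProjection A N o) {v : Fin 4 → ℂ}
    (hv : ∀ i, ∑ j, A i j * v j = 0) : ∃ s : ℂ, ∀ i, v i = s * o i := by
  obtain ⟨c, hc⟩ := h.left_inv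
  refine ⟨∑ j, c j * v j, fun i => ?_⟩
  have h1 : ∑ j, (N * A) i j * v j = 0 := by
    simp only [Matrix.mul_apply, Finset.sum_mul, mul_assoc]
    rw [Finset.sum_comm]
    simp only [← Finset.mul_sum, hv, mul_zero, Finset.sum_const_zero]
  simp only [hc, sub_mul, Finset.sum_sub_distrib, ite_mul, one_mul, zero_mul,
    Finset.sum_ite_eq, Finset.mem_univ, if_true, mul_assoc, ← Finset.mul_sum] at h1
  linear_combination h1

/-- N A differs from the identity by a rank one term with image spanned by o, which is annihilated
by planes through o. Coefficients in B allow the use on parametrized planes. -/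
theorem lift_descend (h : IsSplitProjection A N o) {B : Type*} [CommRing B] [Algebra ℂ B]
    {v : Fin 4 → B} (hv : ∑ i, v i * algebraMap ℂ B (o i) = 0) (j : Fin 4) :
    ∑ k, algebraMap ℂ B (A k j) * ∑ i, algebraMap ℂ B (N i k) * v i = v j := by
  obtain ⟨c, hc⟩ := h.left_inv
  calc _ = ∑ i, algebraMap ℂ B ((N * A) i j) * v i := by
        simp only [Matrix.mul_apply, map_sum, map_mul, Finset.mul_sum, Finset.sum_mul]
        rw [Finset.sum_comm]
        exact Finset.sum_congr rfl fun i _ => Finset.sum_congr rfl fun k _ => by ring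
    _ = v j - algebraMap ℂ B (c j) * ∑ i, v i * algebraMap ℂ B (o i) := by
        simp only [hc, map_sub, map_mul, sub_mul, Finset.sum_sub_distrib, Finset.mul_sum]
        congr 1
        · simp
        · exact Finset.sum_congr rfl fun i _ => by ring
    _ = v j := by rw [hv, mul_zero, sub_zero]

theorem transpose_mulVec (h : IsSplitProjection A N o) {v : Fin 4 → ℂ}
    (hv : ∑ i, v i * (o i : ℂ) = 0) : A.transpose.mulVec (N.transpose.mulVec v) = v :=
  funext fun j => h.lift_descend hv j

theorem transpose_mulVec_transpose_mulVec (h : IsSplitProjection A N o) (w : Fin 3 → ℂ) :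
    N.transpose.mulVec (A.transpose.mulVec w) = w := by
  rw [Matrix.mulVec_mulVec, ← Matrix.transpose_mul, h.right_inv, Matrix.transpose_one,
    Matrix.one_mulVec]

theorem transpose_mulVec_dot_center (h : IsSplitProjection A N o) (w : Fin 3 → ℂ) :
    ∑ i, A.transpose.mulVec w i * (o i : ℂ) = 0 := by
  simp only [Matrix.mulVec, dotProduct, Matrix.transpose_apply, Finset.sum_mul]
  rw [Finset.sum_comm]
  refine Finset.sum_eq_zero fun k _ => ?_
  have := congrArg (fun t => w k * t) (h.center k)
  simp only [mul_zero, Finset.mul_sum] at this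
  rw [← this]
  exact Finset.sum_congr rfl fun i _ => by ring

/-- A tangent plane is projected to a line if and only if it contains the center. -/
theorem map_ker_linearForm_ne_top_iff (h : IsSplitProjection A N o) {c : Fin 4 → ℂ} (hc : c ≠ 0) :
    (LinearMap.ker (linearForm c)).map A.mulVecLin ≠ ⊤ ↔ ∑ i, c i * (o i : ℂ) = 0 := by
  constructor
  · intro hne
    by_contra hco
    apply hne
    refine eq_top_iff.mpr fun w _ => ?_
    refine ⟨N.mulVec w - (linearForm c (N.mulVec w) / ∑ i, c i * (o i : ℂ)) •
      (fun i => (o i : ℂ)), ?_, ?_⟩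
    · change linearForm c _ = 0
      rw [map_sub, map_smul, linearForm_apply c fun i => (o i : ℂ), smul_eq_mul,
        div_mul_cancel₀ _ hco, sub_self]
    · rw [map_sub, map_smul, Matrix.mulVecLin_apply, Matrix.mulVecLin_apply, Matrix.mulVec_mulVec,
        h.right_inv, Matrix.one_mulVec, show A.mulVec (fun i => (o i : ℂ)) = 0 from
        funext h.center, smul_zero, sub_zero]
  · intro hco htop
    apply hc
    rw [← h.transpose_mulVec hco]
    suffices hz : N.transpose.mulVec c = 0 by rw [hz, Matrix.mulVec_zero]
    ext k
    obtain ⟨v, hv, hvk⟩ : Pi.single k 1 ∈ (LinearMap.ker (linearForm c)).map A.mulVecLin := by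
      rw [htop]
      trivial
    have h1 : N.transpose.mulVec c ⬝ᵥ A.mulVec v = c ⬝ᵥ v := by
      rw [Matrix.dotProduct_mulVec, ← Matrix.mulVec_transpose, h.transpose_mulVec hco]
    rw [dotProduct_eq_linearForm c, hv, show A.mulVec v = Pi.single k 1 from hvk, dotProduct_single_one] at h1
    exact h1

end IsSplitProjection

/-! ### The curve of tangent planes through the center -/

/-- `B` is a ring of functions on the curve of tangent planes through `o`, with coordinate functions
`t`, `y` and a derivation. -/
structure IsTangentPlaneCurve (R : ℝ) (r : ℂ) (o : Fin 4 → ℝ) {B : Type*} [CommRing B]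
    [Algebra ℂ B] (D : Derivation ℂ B B) (t y : B) : Prop where
  curve_eq : y ^ 2 = algebraMap ℂ B (axisSq o) * (t ^ 2 + 1) ^ 2 - ellFun R r o t ^ 2
  exists_eval (t₀ y₀ : ℂ) (h : y₀ ^ 2 = axisSq o * (t₀ ^ 2 + 1) ^ 2 - ellFun R r o t₀ ^ 2) :
    ∃ e : B →ₐ[ℂ] ℂ, e t = t₀ ∧ e y = y₀
  eq_zero (z : B) (h : ∀ e : B →ₐ[ℂ] ℂ, e z = 0) : z = 0
  deriv_t : D t = 2 * y
  deriv_y : D y = algebraMap ℂ B (4 * axisSq o) * t * (t ^ 2 + 1) - 2 * ellFun R r o t *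
    (algebraMap ℂ B (2 * R * o 3) * t + algebraMap ℂ B (2 * r * o 3)
      + algebraMap ℂ B (2 * Complex.I * o 2) * t)
  exists_relation (Q : Fin 3 → B) : ∃ (d : ℕ) (f : MvPolynomial (Fin 3) ℂ),
    f.IsHomogeneous d ∧ f ≠ 0 ∧ aeval Q f = 0

namespace CurveRing

/-- The polynomial whose square root is adjoined to parametrize the tangent planes through `o`. -/
def tangentPlanePoly (R : ℝ) (r : ℂ) (o : Fin 4 → ℝ) : Polynomial ℂ :=
  Polynomial.C (axisSq o) * (Polynomial.X ^ 2 + 1) ^ 2 - ellFun R r o Polynomial.X ^ 2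

theorem eval_tangentPlanePoly (R : ℝ) (r : ℂ) (o : Fin 4 → ℝ) (t : ℂ) :
    (tangentPlanePoly R r o).eval t = axisSq o * (t ^ 2 + 1) ^ 2 - ellFun R r o t ^ 2 := by
  simp [tangentPlanePoly, ellFun]

theorem derivative_tangentPlanePoly (R : ℝ) (r : ℂ) (o : Fin 4 → ℝ) :
    Polynomial.derivative (tangentPlanePoly R r o) =
      Polynomial.C (4 * axisSq o) * Polynomial.X * (Polynomial.X ^ 2 + 1)
      - 2 * ellFun R r o Polynomial.X * (Polynomial.C (2 * R * o 3 : ℂ) * Polynomial.X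
        + Polynomial.C (2 * r * o 3) + Polynomial.C (2 * Complex.I * o 2) * Polynomial.X) := by
  simp [tangentPlanePoly, ellFun, Polynomial.derivative_pow]
  simp only [Polynomial.C_ofNat]
  ring

theorem map_tangentPlanePoly (R : ℝ) (r : ℂ) (o : Fin 4 → ℝ) {B : Type*} [CommRing B]
    [Algebra ℂ B] (e : Polynomial ℂ →ₐ[ℂ] B) : e (tangentPlanePoly R r o) =
      algebraMap ℂ B (axisSq o) * (e Polynomial.X ^ 2 + 1) ^ 2
        - ellFun R r o (e Polynomial.X) ^ 2 := by
  simp only [tangentPlanePoly, ← Polynomial.algebraMap_eq, map_sub, map_mul, map_add, map_one,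
    AlgHom.commutes, map_pow, map_ellFun]

theorem map_derivative_tangentPlanePoly (R : ℝ) (r : ℂ) (o : Fin 4 → ℝ) {B : Type*} [CommRing B]
    [Algebra ℂ B] (e : Polynomial ℂ →ₐ[ℂ] B) : e (Polynomial.derivative (tangentPlanePoly R r o)) =
      algebraMap ℂ B (4 * axisSq o) * e Polynomial.X * (e Polynomial.X ^ 2 + 1)
      - 2 * ellFun R r o (e Polynomial.X) *
        (algebraMap ℂ B (2 * R * o 3) * e Polynomial.X + algebraMap ℂ B (2 * r * o 3)
          + algebraMap ℂ B (2 * Complex.I * o 2) * e Polynomial.X) := by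
  simp only [derivative_tangentPlanePoly, ← Polynomial.algebraMap_eq, map_sub, map_mul e, map_add e,
    map_one, AlgHom.commutes, map_pow, map_ellFun, map_ofNat]

theorem rootMultiplicity_tangentPlanePoly {R : ℝ} {r : ℂ} {o : Fin 4 → ℝ} {t : ℂ}
    (h0 : axisSq o * (t ^ 2 + 1) ^ 2 - ellFun R r o t ^ 2 = 0)
    (h1 : 4 * axisSq o * t * (t ^ 2 + 1) - 2 * ellFun R r o t *
        (2 * R * o 3 * t + 2 * r * o 3 + 2 * Complex.I * o 2 * t) ≠ 0) :
    (tangentPlanePoly R r o).rootMultiplicity t = 1 := by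
  have hd : (Polynomial.derivative (tangentPlanePoly R r o)).eval t ≠ 0 := by
    rw [derivative_tangentPlanePoly]
    convert h1 using 1
    simp [ellFun]
  have hg : tangentPlanePoly R r o ≠ 0 := by
    intro h
    simp [h] at hd
  have hpos : 0 < (tangentPlanePoly R r o).rootMultiplicity t := by
    rw [Polynomial.rootMultiplicity_pos hg, Polynomial.IsRoot, eval_tangentPlanePoly, h0]
  have hle := mt (Polynomial.one_lt_rootMultiplicity_iff_isRoot hg).mp fun h => hd h.2
  omega

/-- The first coordinate function. -/
def coordT (g : Polynomial ℂ) : CurveRing g := ⟨Polynomial.X, 0⟩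

/-- The second coordinate function. -/
def coordY (g : Polynomial ℂ) : CurveRing g := ⟨0, 1⟩

/-- Polynomials as functions on the curve. -/
def ofPoly (g : Polynomial ℂ) : Polynomial ℂ →ₐ[ℂ] CurveRing g where
  toFun p := ⟨p, 0⟩
  map_one' := rfl
  map_zero' := rfl
  map_mul' p q := by ext1 <;> simp
  map_add' p q := by ext1 <;> simp
  commutes' _ := rfl

theorem ofPoly_apply (g p : Polynomial ℂ) : ofPoly g p = ⟨p, 0⟩ := rfl

theorem isTangentPlaneCurve {R : ℝ} {r : ℂ} {o : Fin 4 → ℝ} (hg : tangentPlanePoly R r o ≠ 0) :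
    IsTangentPlaneCurve R r o (derivation (tangentPlanePoly R r o)) (coordT _) (coordY _) where
  curve_eq := by
    have h : coordY (tangentPlanePoly R r o) ^ 2 = ofPoly _ (tangentPlanePoly R r o) := by
      rw [sq]
      ext1 <;> simp [coordY, ofPoly_apply]
    rw [h, map_tangentPlanePoly]
    rfl
  exists_eval t₀ y₀ h := by
    rw [← eval_tangentPlanePoly] at h
    refine ⟨evalAt t₀ y₀ h, ?_, ?_⟩ <;> simp [evalAt_apply, coordT, coordY]
  eq_zero z h := eq_zero_of_evalAt hg fun t y h' => h _
  deriv_t := by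
    rw [derivation_apply, two_mul (coordY _)]
    ext1 <;> simp [coordT, coordY]
    norm_num
  deriv_y := by
    have h : derivation _ (coordY (tangentPlanePoly R r o)) =
        ofPoly _ (Polynomial.derivative (tangentPlanePoly R r o)) := by
      rw [derivation_apply]
      ext1 <;> simp [coordY, ofPoly_apply]
    rw [h, map_derivative_tangentPlanePoly]
    rfl
  exists_relation := exists_relation

end CurveRing

/-! ### The section of the dual torus with the plane of planes through the center -/

namespace IsSplitProjection

variable {a b : ℝ} {A : Matrix (Fin 3) (Fin 4) ℂ} {N : Matrix (Fin 4) (Fin 3) ℂ} {o : Fin 4 → ℝ}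

/-- A line of planes through the center. -/
theorem eval_lineMap_pullback (h : IsSplitProjection A N o) (f : MvPolynomial (Fin 4) ℂ)
    {v v' : Fin 4 → ℂ} (hv : ∑ i, v i * (o i : ℂ) = 0) (hv' : ∑ i, v' i * (o i : ℂ) = 0) (t : ℂ) :
    (lineMap (N.transpose.mulVec v) (N.transpose.mulVec v') (pullback A f)).eval t =
      eval (v + t • v') f := by
  rw [eval_lineMap, eval_pullback, Matrix.mulVec_add, Matrix.mulVec_smul, h.transpose_mulVec hv,
    h.transpose_mulVec hv']

/-- The test pencil consists of the planes through o parallel to the axis. On it q = κ(t² + 1), w is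
constant and D = 16(a²q² + (2a − b)w²q + w⁴). The constant coefficient in t is nonzero by
`off_circles`, the discriminant by b ≠ 4a, and the remainder 16w⁴ modulo q by w ≠ 0. -/
theorem squarefree_and_isRelPrime (h : IsSplitProjection A N o) (ha : 0 < a) (hb : 0 < b)
    (hab : b ≠ 4 * a) (ho : IsGenericCenter a b o) :
    Squarefree (pullback A (dualTorusForm a b)) ∧
      IsRelPrime (pullback A (dualTorusForm a b)) (pullback A absoluteForm) := by
  have hκ := ho.axisSq_ne_zero
  have h3 : (o 3 : ℂ) ≠ 0 := by exact_mod_cast ho.finite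
  have haC : (a : ℂ) ≠ 0 := by exact_mod_cast ha.ne'
  have hbC : (b : ℂ) ≠ 0 := by exact_mod_cast hb.ne'
  have habC : (b : ℂ) - 4 * a ≠ 0 := sub_ne_zero.mpr (by exact_mod_cast hab)
  have hoff : axisSq o ^ 2 - (b - 2 * a) * axisSq o * o 3 ^ 2 + a ^ 2 * o 3 ^ 4 ≠ 0 := by
    rw [axisSq]
    exact_mod_cast ho.off_circles
  let v : Fin 4 → ℂ := ![o 0, o 1, 0, -axisSq o / o 3]
  let v' : Fin 4 → ℂ := ![o 1, -o 0, 0, 0]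
  have hv : ∑ i, v i * (o i : ℂ) = 0 := by
    simp [v, Fin.sum_univ_four, h3, axisSq]
    ring
  have hv' : ∑ i, v' i * (o i : ℂ) = 0 := by
    simp [v', Fin.sum_univ_four]
    ring
  have hs (t : ℂ) : (o 0 + t * o 1) ^ 2 + (o 1 + -(t * o 0)) ^ 2 = axisSq o * (t ^ 2 + 1) := by
    rw [axisSq]
    ring
  have hline : lineMap (N.transpose.mulVec v) (N.transpose.mulVec v')
      (pullback A (dualTorusForm a b)) =
      Polynomial.C (16 * a ^ 2 * axisSq o ^ 2) * Polynomial.X ^ 4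
      + Polynomial.C (32 * a ^ 2 * axisSq o ^ 2
        + 16 * (2 * a - b) * axisSq o ^ 3 / o 3 ^ 2) * Polynomial.X ^ 2
      + Polynomial.C (16 * a ^ 2 * axisSq o ^ 2
        + 16 * (2 * a - b) * axisSq o ^ 3 / o 3 ^ 2 + 16 * axisSq o ^ 4 / o 3 ^ 4) := by
    refine Polynomial.funext fun t => ?_
    rw [h.eval_lineMap_pullback _ hv hv', eval_dualTorusForm]
    simp [v, v', ← mul_add, hs]
    generalize axisSq o = k at *
    field_simp
    ring
  have hline' : lineMap (N.transpose.mulVec v) (N.transpose.mulVec v') (pullback A absoluteForm) =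
      Polynomial.C (axisSq o) * (Polynomial.X ^ 2 + 1) := by
    refine Polynomial.funext fun t => ?_
    rw [h.eval_lineMap_pullback _ hv hv', eval_absoluteForm]
    simp [v, v', hs]
  have hev : eval (N.transpose.mulVec v') (pullback A (dualTorusForm a b)) ≠ 0 := by
    rw [eval_pullback, h.transpose_mulVec hv', eval_dualTorusForm]
    have e : (o 1 : ℂ) ^ 2 + o 0 ^ 2 = axisSq o := by
      rw [axisSq, add_comm]
    simp [v', ← mul_add, e, haC, hκ]
  have hhom := isHomogeneous_pullback A (isHomogeneous_dualTorusForm a b)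
  constructor
  · refine squarefree_of_squarefree_lineMap hhom hev (v := N.transpose.mulVec v) ?_
    rw [hline]
    refine squarefree_biquadratic ?_ ?_
    · intro h0
      apply hoff
      field_simp at h0
      refine (mul_eq_zero.mp ?_).resolve_left (pow_ne_zero 2 hκ)
      linear_combination h0 / 16
    · intro h0
      field_simp at h0
      have : axisSq o ^ 6 * (b * (b - 4 * a)) = 0 := by
        linear_combination h0 / 256
      simp [hκ, hbC, habC] at this
  · refine isRelPrime_of_isCoprime_lineMap hhom hev (v := N.transpose.mulVec v) ?_
    rw [hline, hline']
    have hk : (16 * axisSq o ^ 4 / o 3 ^ 4 : ℂ) ≠ 0 := by simp [hκ, h3]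
    refine ⟨Polynomial.C (16 * axisSq o ^ 4 / o 3 ^ 4 : ℂ)⁻¹,
      -Polynomial.C ((16 * axisSq o ^ 4 / o 3 ^ 4 : ℂ)⁻¹ * (axisSq o)⁻¹) *
        (Polynomial.C (16 * a ^ 2 * axisSq o ^ 2) * (Polynomial.X ^ 2 + 1)
          + Polynomial.C (16 * (2 * a - b) * axisSq o ^ 3 / o 3 ^ 2)), ?_⟩
    refine Polynomial.funext fun t => ?_
    simp only [Polynomial.eval_add, Polynomial.eval_mul, Polynomial.eval_C, Polynomial.eval_pow,
      Polynomial.eval_X, Polynomial.eval_one, Polynomial.eval_neg]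
    field_simp
    ring

end IsSplitProjection

namespace IsTangentPlaneCurve

variable {a b : ℝ} {R : ℝ} {r : ℂ} {o : Fin 4 → ℝ} {B : Type*} [CommRing B] [Algebra ℂ B]
  {D : Derivation ℂ B B} {t y : B}

theorem map_curve_eq (h : IsTangentPlaneCurve R r o D t y) (e : B →ₐ[ℂ] ℂ) :
    e y ^ 2 = axisSq o * (e t ^ 2 + 1) ^ 2 - ellFun R r o (e t) ^ 2 := by
  have := congrArg e h.curve_eq
  simpa only [map_sub, map_mul, map_add, map_one, map_pow, AlgHom.commutes, map_ellFun,
    Algebra.algebraMap_self, RingHom.id_apply] using this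

theorem algHom_aeval (e : B →ₐ[ℂ] ℂ) {σ : Type*} (v : σ → B) (f : MvPolynomial σ ℂ) :
    e (aeval v f) = eval (fun i => e (v i)) f := by
  rw [← AlgHom.comp_apply, comp_aeval, aeval_eq_eval]

theorem planeFun_dot_center (h : IsTangentPlaneCurve R r o D t y) :
    ∑ i, planeFun R r o t y i * algebraMap ℂ B (o i) = 0 :=
  h.eq_zero _ fun e => by
    simp only [map_sum, map_mul, map_planeFun, AlgHom.commutes]
    exact TorusPicture.planeFun_dot_center _ _

theorem contactFun_dot_planeFun (h : IsTangentPlaneCurve R r o D t y) :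
    ∑ i, contactFun R r o t y i * planeFun R r o t y i = 0 :=
  h.eq_zero _ fun e => by
    simp only [map_sum, map_mul, map_planeFun, map_contactFun]
    exact planeFun_dot_contactFun (h.map_curve_eq e)

theorem aeval_contactFun (h : IsTangentPlaneCurve R r o D t y) (hR : IsRadii a b R r) :
    aeval (contactFun R r o t y) (torusForm a b) = 0 :=
  h.eq_zero _ fun e => by
    simp only [algHom_aeval, map_contactFun]
    exact (hR.contactFun_torus (h.map_curve_eq e)).1

theorem aeval_planeFun (h : IsTangentPlaneCurve R r o D t y) (hR : IsRadii a b R r) :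
    aeval (planeFun R r o t y) (dualTorusForm a b) = 0 :=
  h.eq_zero _ fun e => by
    obtain ⟨h1, h2, h3⟩ := planeFun_sqrts (h.map_curve_eq e)
    simp only [algHom_aeval, map_planeFun]
    exact hR.eval_dualTorusForm h1 h2 h3

/-- The factor between the tangent plane and the gradient of the torus at the point of contact. -/
def contactFactor (R : ℝ) (r : ℂ) (o : Fin 4 → ℝ) (t : B) : B :=
  algebraMap ℂ B (8 * R * r) * nodeFun R r o t *
    (algebraMap ℂ B (axisSq o) * (t ^ 2 + 1)) ^ 3 * (algebraMap ℂ B (2 * axisSq o) * t)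

theorem map_contactFactor (e : B →ₐ[ℂ] ℂ) : e (contactFactor R r o t) =
    8 * R * r * nodeFun R r o (e t) * (axisSq o * (e t ^ 2 + 1)) ^ 3 * (2 * axisSq o * e t) := by
  simp only [contactFactor, map_mul e, map_pow, map_add, map_one, AlgHom.commutes, map_nodeFun,
    Algebra.algebraMap_self, RingHom.id_apply]

theorem aeval_pderiv_contactFun (h : IsTangentPlaneCurve R r o D t y) (hR : IsRadii a b R r)
    (i : Fin 4) : aeval (contactFun R r o t y) (pderiv i (torusForm a b)) =
      contactFactor R r o t * planeFun R r o t y i := by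
  rw [← sub_eq_zero]
  refine h.eq_zero _ fun e => ?_
  have := congrFun (hR.contactFun_torus (h.map_curve_eq e)).2 i
  rw [map_sub, map_mul, algHom_aeval, map_contactFactor, map_planeFun, sub_eq_zero]
  simp only [map_contactFun]
  exact this

theorem contactFactor_ne_zero (h : IsTangentPlaneCurve R r o D t y) (hR : IsRadii a b R r)
    (ho : IsGenericCenter a b o) [IsDomain B] : contactFactor R r o t ≠ 0 := by
  have hκ := ho.axisSq_ne_zero
  obtain ⟨t₀, h₀, h1, h2, -⟩ := exists_branch_point hR ho
  obtain ⟨e, he, -⟩ := h.exists_eval t₀ 0 (by rw [h₀, zero_pow two_ne_zero])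
  -- The branch point shows that `nodeFun` and t² + 1 are nonzero functions; a point over t = 1
  -- shows the same for t.
  obtain ⟨y₁, hy₁⟩ := IsAlgClosed.exists_pow_nat_eq
    (axisSq o * ((1 : ℂ) ^ 2 + 1) ^ 2 - ellFun R r o 1 ^ 2) two_pos
  obtain ⟨e', he', -⟩ := h.exists_eval 1 y₁ hy₁
  have hinj := (algebraMap ℂ B).injective
  have hnode : nodeFun R r o t ≠ 0 := by
    intro h0
    apply h2
    rw [← he, ← map_nodeFun, h0, map_zero]
  have ht : t ^ 2 + 1 ≠ 0 := by
    intro h0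
    apply h1
    rw [← he, ← map_pow, ← map_one e, ← map_add, h0, map_zero]
  have ht0 : t ≠ 0 := by
    rintro rfl
    simp at he'
  have hc {c : ℂ} (hc : c ≠ 0) : algebraMap ℂ B c ≠ 0 := (map_ne_zero_iff _ hinj).mpr hc
  exact mul_ne_zero (mul_ne_zero (mul_ne_zero (hc (by simp [hR.R_ne, hR.r_ne])) hnode)
    (pow_ne_zero _ (mul_ne_zero (hc hκ) ht))) (mul_ne_zero (hc (by simp [hκ])) ht0)

/-- The torus equation is differentiated along the curve. Its gradient there is `contactFactor`
times the plane, and the factor cancels in a domain. -/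
theorem planeFun_dot_deriv_contactFun [IsDomain B] (h : IsTangentPlaneCurve R r o D t y)
    (hR : IsRadii a b R r) (h0 : contactFactor R r o t ≠ 0) :
    ∑ i, D (contactFun R r o t y i) * planeFun R r o t y i = 0 := by
  have h1 := derivation_aeval D (contactFun R r o t y) (torusForm a b)
  rw [h.aeval_contactFun hR, map_zero] at h1
  simp only [h.aeval_pderiv_contactFun hR, mul_assoc, ← Finset.mul_sum] at h1
  rw [← (mul_eq_zero.mp h1.symm).resolve_left h0]
  exact Finset.sum_congr rfl fun i _ => mul_comm _ _

/-- The derivative of the point of contact at a branch point. -/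
theorem map_deriv_contactFun (h : IsTangentPlaneCurve R r o D t y) (e : B →ₐ[ℂ] ℂ)
    (he : e y = 0) (i : Fin 4) : e (D (contactFun R r o t y i)) =
      nodeFun R r o (e t) * (4 * axisSq o * e t * (e t ^ 2 + 1) - 2 * ellFun R r o (e t) *
        (2 * R * o 3 * e t + 2 * r * o 3 + 2 * Complex.I * o 2 * e t)) *
        (![-o 1, o 0, 0, 0] : Fin 4 → ℂ) i := by
  have h1 : e (D t) = 0 := by rw [h.deriv_t, map_mul, he, mul_zero]
  have h2 : e (D y) = 4 * axisSq o * e t * (e t ^ 2 + 1) - 2 * ellFun R r o (e t) *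
        (2 * R * o 3 * e t + 2 * r * o 3 + 2 * Complex.I * o 2 * e t) := by
    rw [h.deriv_y]
    simp only [map_sub, map_mul e, map_add, map_one, map_pow, AlgHom.commutes, map_ellFun,
      map_ofNat, Algebra.algebraMap_self, RingHom.id_apply]
  rw [← h2]
  have hell : e (D (ellFun R r o t)) = 0 := by
    simp only [ellFun, map_add, map_sub, Derivation.leibniz, Derivation.leibniz_pow,
      Derivation.map_algebraMap, smul_eq_mul, map_mul e, h1, Derivation.map_one_eq_zero,
      map_nsmul, mul_zero, smul_zero, add_zero, sub_zero]
  have hnode : e (D (nodeFun R r o t)) = 0 := by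
    simp only [nodeFun, map_add, Derivation.leibniz, Derivation.leibniz_pow,
      Derivation.map_algebraMap, smul_eq_mul, map_mul e, h1, Derivation.map_one_eq_zero,
      map_nsmul, mul_zero, smul_zero, add_zero]
  fin_cases i
  all_goals
    simp [contactFun, planeFun, -map_mul, -map_neg]
    simp only [map_add, map_sub, map_mul e, map_neg, map_neg e, h1, hell, hnode, map_nodeFun,
      AlgHom.commutes, Algebra.algebraMap_self, RingHom.id_apply, mul_zero, add_zero]
    try ring

end IsTangentPlaneCurve

/-! ### The dual picture of the torus -/

variable {a b : ℝ} {R : ℝ} {r : ℂ} {o : Fin 4 → ℝ} {A : Matrix (Fin 3) (Fin 4) ℂ}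
  {N : Matrix (Fin 4) (Fin 3) ℂ}

theorem IsGenericCenter.eval_torusForm_ne_zero (ho : IsGenericCenter a b o) :
    eval (fun i => (o i : ℂ)) (torusForm a b) ≠ 0 := by
  rw [eval_torusForm]
  exact_mod_cast ho.off_torus

/-- The projection is defined at all points of the torus. -/
theorem IsSplitProjection.mulVec_ne_zero (hA : IsSplitProjection A N o)
    (ho : IsGenericCenter a b o) {p : Fin 4 → ℂ} (hp : p ≠ 0)
    (hT : eval p (torusForm a b) = 0) : A.mulVec p ≠ 0 := by
  intro h0
  obtain ⟨s, hs⟩ := hA.eq_of_mulVec_eq_zero (v := p) (congrFun h0)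
  have he : p = s • fun i => (o i : ℂ) := funext hs
  rw [he, eval_smul_of_isHomogeneous (isHomogeneous_torusForm a b), mul_eq_zero,
    or_iff_left ho.eval_torusForm_ne_zero] at hT
  rw [pow_eq_zero_iff four_ne_zero] at hT
  rw [hT, zero_smul] at he
  exact hp he

theorem mem_criticalPoints_torus (ha : 0 < a) (hb : 0 < b) (hab : b ≠ 4 * a)
    (hA : IsSplitProjection A N o) (p : PSpace 3) : p ∈ criticalPoints A (torus a b) ↔
      eval p.rep (torusForm a b) = 0 ∧ grad (torusForm a b) p.rep ≠ 0 ∧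
        ∑ i, grad (torusForm a b) p.rep i * (o i : ℂ) = 0 := by
  have hsq := squarefree_torusForm ha.ne' hb.ne' hab
  have hT := isHomogeneous_torusForm a b
  change IsNonsingularPoint 2 (zeroSet (torusForm a b)) p ∧
    (tangentSpace (zeroSet (torusForm a b)) p).map A.mulVecLin ≠ ⊤ ↔ _
  rw [isNonsingularPoint_zeroSet_iff hT four_ne_zero hsq, and_assoc]
  refine and_congr_right fun hp => and_congr_right fun hg => ?_
  rw [tangentSpace_zeroSet hT four_ne_zero hsq hp, hA.map_ker_linearForm_ne_top_iff hg]

/-- The cross product of the projected point of contact and its derivative does not vanish at a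
branch point. -/
theorem cross_ne_zero_of_branch_point (hR : IsRadii a b R r) (ho : IsGenericCenter a b o)
    (hA : IsSplitProjection A N o) {t₀ c : ℂ}
    (h0 : axisSq o * (t₀ ^ 2 + 1) ^ 2 - ellFun R r o t₀ ^ 2 = 0) (h1 : t₀ ^ 2 + 1 ≠ 0)
    (h2 : nodeFun R r o t₀ ≠ 0) (hc : c ≠ 0) :
    crossProduct (A.mulVec (contactFun R r o t₀ 0)) (A.mulVec (c • (![-o 1, o 0, 0, 0] : Fin 4 → ℂ))) ≠ 0 := by
  have hκ := ho.axisSq_ne_zero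
  have hP0 : contactFun R r o t₀ 0 ≠ 0 := by
    intro h
    have e0 := congrFun h 0
    have e1 := congrFun h 1
    have hl : ellFun R r o t₀ ≠ 0 := by
      intro hl
      rw [hl] at h0
      simp [hκ, h1] at h0
    simp [contactFun, planeFun, h2, hl] at e0 e1
    apply hκ
    simp [axisSq, e0, e1]
  have hT : eval (contactFun R r o t₀ 0) (torusForm a b) = 0 :=
    (hR.contactFun_torus (by rw [h0, zero_pow two_ne_zero])).1
  have hne := hA.mulVec_ne_zero ho hP0 hT
  rw [crossProduct_ne_zero_iff_linearIndependent, LinearIndependent.pair_iff' hne]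
  -- A dependency makes sP − c(−o₁, o₀, 0, 0) a multiple of o. For y = 0 the first two coordinates
  -- of P are proportional to (o₀, o₁), so cκ = 0.
  intro s hs
  have hker (i : Fin 3) : ∑ j, A i j * (s • contactFun R r o t₀ 0 - c • (![-o 1, o 0, 0, 0] : Fin 4 → ℂ)) j
      = 0 := by
    have : A.mulVec (s • contactFun R r o t₀ 0 - c • (![-o 1, o 0, 0, 0] : Fin 4 → ℂ)) i = 0 := by
      rw [Matrix.mulVec_sub, Matrix.mulVec_smul, hs, sub_self, Pi.zero_apply]
    exact this
  obtain ⟨s', hs'⟩ := hA.eq_of_mulVec_eq_zero hker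
  have e0 := hs' 0
  have e1 := hs' 1
  simp [contactFun, planeFun] at e0 e1
  refine mul_ne_zero hc hκ ?_
  rw [axisSq]
  linear_combination o 1 * e0 - o 0 * e1

/-- The parametrization reaches, up to scalars, all planes of the slice with q ≠ 0. So f·q vanishes
on the slice, and coprimality removes q. -/
theorem dvd_of_aeval_planeFun_eq_zero {B : Type*} [CommRing B] [Algebra ℂ B]
    {D : Derivation ℂ B B} {t y : B} (h : IsTangentPlaneCurve R r o D t y) (ha : 0 < a)
    (hb : 0 < b) (hab : b ≠ 4 * a) (hR : IsRadii a b R r) (ho : IsGenericCenter a b o)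
    (hA : IsSplitProjection A N o) {f : MvPolynomial (Fin 3) ℂ} {d : ℕ} (hf : f.IsHomogeneous d)
    (hfu : aeval (fun k => ∑ i, algebraMap ℂ B (N i k) * planeFun R r o t y i) f = 0) :
    pullback A (dualTorusForm a b) ∣ f := by
  obtain ⟨hsq, hrel⟩ := hA.squarefree_and_isRelPrime ha hb hab ho
  refine hrel.dvd_of_dvd_mul_right (dvd_of_eval_eq_zero hsq fun w hw => ?_)
  rw [eval_pullback] at hw
  obtain ⟨u, u', hu, hz, hw3⟩ := hR.exists_sqrts hw
  rw [map_mul, eval_pullback, eval_absoluteForm]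
  by_cases hu' : u' = 0
  · refine mul_eq_zero_of_right _ ?_
    rw [hu, hz, hu']
    ring
  · refine mul_eq_zero_of_left ?_ _
    obtain ⟨t₀, y₀, c, hy, hc, hpl, -⟩ := exists_planeFun_eq ho.axisSq_ne_zero
      (hA.transpose_mulVec_dot_center w) hu hz hw3 hu'
    obtain ⟨e, rfl, rfl⟩ := h.exists_eval t₀ y₀ hy
    have := congrArg e hfu
    rw [IsTangentPlaneCurve.algHom_aeval, map_zero] at this
    simp only [map_sum, map_mul, map_planeFun, AlgHom.commutes, hpl] at this
    have e1 : N.transpose.mulVec (c • A.transpose.mulVec w) = c • w := by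
      rw [Matrix.mulVec_smul, hA.transpose_mulVec_transpose_mulVec]
    change eval (N.transpose.mulVec (c • A.transpose.mulVec w)) f = 0 at this
    rw [e1, eval_smul_of_isHomogeneous hf] at this
    exact (mul_eq_zero.mp this).resolve_left (pow_ne_zero _ hc)

theorem dualPicture_torus_of_curve {B : Type*} [CommRing B] [IsDomain B] [Algebra ℂ B]
    {D : Derivation ℂ B B} {t y : B} (h : IsTangentPlaneCurve R r o D t y) (ha : 0 < a)
    (hb : 0 < b) (hab : b ≠ 4 * a) (hR : IsRadii a b R r) (ho : IsGenericCenter a b o)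
    (hA : IsSplitProjection A N o) :
    dualPicture A (torus a b) = zeroSet (pullback A (dualTorusForm a b)) := by
  have hκ := ho.axisSq_ne_zero
  have hfac := h.contactFactor_ne_zero hR ho
  let u : Fin 3 → B := fun k => ∑ i, algebraMap ℂ B (N i k) * planeFun R r o t y i
  have hu (w : Fin 4 → B) : (fun i => ∑ j, algebraMap ℂ B (A i j) * w j) ⬝ᵥ u =
      ∑ j, w j * planeFun R r o t y j := by
    rw [Finset.sum_congr rfl fun j _ => by
      rw [← hA.lift_descend h.planeFun_dot_center j]]
    change _ = ∑ j, w j * ∑ k, algebraMap ℂ B (A k j) * u k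
    generalize u = u
    simp only [dotProduct, Finset.sum_mul, Finset.mul_sum]
    rw [Finset.sum_comm]
    exact Finset.sum_congr rfl fun j _ => Finset.sum_congr rfl fun k _ => by ring
  have hev (e : B →ₐ[ℂ] ℂ) : (fun i => e (∑ j, algebraMap ℂ B (A i j) * contactFun R r o t y j)) =
      A.mulVec (contactFun R r o (e t) (e y)) := by
    ext i
    simp only [map_sum, map_mul, map_contactFun, AlgHom.commutes]
    rfl
  obtain ⟨t₀, h0, h1, h2, h3⟩ := exists_branch_point hR ho
  obtain ⟨e₀, rfl, he₀⟩ := h.exists_eval t₀ 0 (by rw [h0, zero_pow two_ne_zero])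
  have hdu (e : B →ₐ[ℂ] ℂ) : (fun i => e (u i)) =
      N.transpose.mulVec (planeFun R r o (e t) (e y)) := by
    ext i
    simp only [u, map_sum, map_mul, map_planeFun, AlgHom.commutes]
    rfl
  refine dual_eq_zeroSet_of_parametrization D
    (fun i => ∑ j, algebraMap ℂ B (A i j) * contactFun R r o t y j) u ?_ ?_ ?_ ?_
    -- Where this factor is nonzero the contact point is a nonsingular point of the torus. The
    -- factor is a nonzero element of a domain, so these points still detect zero.
    {e | e (IsTangentPlaneCurve.contactFactor R r o t) ≠ 0} ?_ _ ?_ ?_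
    (h.exists_relation _) _ 4 (isHomogeneous_pullback A (isHomogeneous_dualTorusForm a b)) ?_
    fun f d hf hfu => dvd_of_aeval_planeFun_eq_zero h ha hb hab hR ho hA hf hfu
  -- Q × DQ ≠ 0 is verified at a branch point, where Dt = 2y = 0 and only Dy contributes.
  · intro hcross
    have hD : (fun i => e₀ (D (∑ j, algebraMap ℂ B (A i j) * contactFun R r o t y j))) =
        A.mulVec ((nodeFun R r o (e₀ t) * (4 * axisSq o * e₀ t * (e₀ t ^ 2 + 1)
          - 2 * ellFun R r o (e₀ t) * (2 * R * o 3 * e₀ t + 2 * r * o 3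
            + 2 * Complex.I * o 2 * e₀ t))) •
            (![-o 1, o 0, 0, 0] : Fin 4 → ℂ)) := by
      ext i
      simp only [map_sum, Derivation.leibniz, Derivation.map_algebraMap, mul_zero, add_zero,
        smul_eq_mul, map_mul e₀, AlgHom.commutes, h.map_deriv_contactFun e₀ he₀]
      simp only [Matrix.mulVec, dotProduct, Pi.smul_apply, smul_eq_mul]
      rfl
    refine cross_ne_zero_of_branch_point hR ho hA h0 h1 h2 (mul_ne_zero h2 h3) ?_
    rw [← hD, ← he₀, ← hev]
    ext i
    have := congrArg e₀ (congrFun hcross i)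
    rw [cross_apply] at this ⊢
    fin_cases i <;> simpa using this
  · exact (hu _).trans h.contactFun_dot_planeFun
  · have : (fun i => D (∑ j, algebraMap ℂ B (A i j) * contactFun R r o t y j)) =
        fun i => ∑ j, algebraMap ℂ B (A i j) * D (contactFun R r o t y j) := by
      ext i
      simp only [map_sum, Derivation.leibniz, Derivation.map_algebraMap, mul_zero, add_zero,
        smul_eq_mul]
    rw [this]
    exact (hu _).trans (h.planeFun_dot_deriv_contactFun hR hfac)
  · intro hu0
    refine hR.planeFun_ne_zero hκ (e₀ t) (e₀ y) ?_
    rw [← hA.transpose_mulVec (TorusPicture.planeFun_dot_center (e₀ t) (e₀ y)), ← hdu, show (fun i => e₀ (u i)) = 0 from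
      funext fun i => by rw [hu0, Pi.zero_apply, map_zero, Pi.zero_apply], Matrix.mulVec_zero]
  · intro z hz
    refine (mul_eq_zero.mp (h.eq_zero (IsTangentPlaneCurve.contactFactor R r o t * z)
      fun e => ?_)).resolve_left hfac
    rw [map_mul, mul_eq_zero, or_iff_not_imp_left]
    exact hz e
  · intro e he
    rw [hev]
    obtain ⟨hT, hg⟩ := hR.contactFun_torus (h.map_curve_eq e)
    have hfe : e (IsTangentPlaneCurve.contactFactor R r o t) ≠ 0 := he
    rw [IsTangentPlaneCurve.map_contactFactor] at hfe
    have hP : contactFun R r o (e t) (e y) ≠ 0 := by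
      intro hP
      have := congrFun hP 3
      simp only [mul_ne_zero_iff] at hfe
      simp [contactFun, hfe] at this
      simp [this] at hfe
    have hne := hA.mulVec_ne_zero ho hP hT
    refine ⟨hne, subset_zariskiClosure _ ⟨Projectivization.mk ℂ _ hP, ?_, ?_⟩⟩
    · obtain ⟨c, hc, hrep⟩ := exists_rep_mk hP
      rw [mem_criticalPoints_torus ha hb hab hA, hrep, grad_smul (isHomogeneous_torusForm a b),
        eval_smul_of_isHomogeneous (isHomogeneous_torusForm a b), hT, hg]
      refine ⟨mul_zero _, smul_ne_zero (pow_ne_zero _ hc) (smul_ne_zero hfe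
        (hR.planeFun_ne_zero hκ _ _)), ?_⟩
      simp only [Pi.smul_apply, smul_eq_mul, mul_assoc, ← Finset.mul_sum]
      rw [TorusPicture.planeFun_dot_center]
      simp only [mul_zero]
    · obtain ⟨c, hc, hrep⟩ := exists_rep_mk hP
      rw [hrep, Matrix.mulVec_smul]
      refine ⟨smul_ne_zero hc hne, ?_⟩
      rw [Projectivization.mk_eq_mk_iff']
      exact ⟨c⁻¹, by rw [smul_smul, inv_mul_cancel₀ hc, one_smul]⟩
  · intro f d hf hfQ p hp
    refine hp f ⟨⟨d, hf⟩, ?_⟩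
    rintro _ ⟨p, hp, hne, rfl⟩
    rw [eval_rep_mk_eq_zero_iff hf]
    obtain ⟨hT, hg, hgo⟩ := (mem_criticalPoints_torus ha hb hab hA p).mp hp
    obtain ⟨t₁, y₁, c, hy, hc, hcp⟩ := exists_contactFun_eq hR ho hT hg hgo
    obtain ⟨e, rfl, rfl⟩ := h.exists_eval t₁ y₁ hy
    have := congrArg e hfQ
    rw [IsTangentPlaneCurve.algHom_aeval, hev, hcp, Matrix.mulVec_smul,
      eval_smul_of_isHomogeneous hf, map_zero] at this
    exact (mul_eq_zero.mp this).resolve_left (pow_ne_zero _ hc)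
  · rw [aeval_pullback]
    have : (fun j => ∑ k, algebraMap ℂ B (A k j) * u k) = planeFun R r o t y :=
      funext fun j => hA.lift_descend h.planeFun_dot_center j
    rw [this]
    exact h.aeval_planeFun hR

theorem dualPicture_torus (ha : 0 < a) (hb : 0 < b) (hab : b ≠ 4 * a)
    (ho : IsGenericCenter a b o) (hA : IsSplitProjection A N o) :
    dualPicture A (torus a b) = zeroSet (pullback A (dualTorusForm a b)) := by
  obtain ⟨R, r, hR⟩ := exists_isRadii ha hb hab
  obtain ⟨t, h0, -, -, h3⟩ := exists_branch_point hR ho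
  have hmul := CurveRing.rootMultiplicity_tangentPlanePoly h0 h3
  have hg : CurveRing.tangentPlanePoly R r o ≠ 0 := by
    intro hg
    simp [hg] at hmul
  have := CurveRing.isDomain hmul
  exact dualPicture_torus_of_curve (CurveRing.isTangentPlaneCurve hg) ha hb hab hR ho hA

/-! ### Lines in the image plane as planes through the center -/

theorem grad_pullback {m n : ℕ} (A : Matrix (Fin (m + 1)) (Fin (n + 1)) ℂ)
    (f : MvPolynomial (Fin (n + 1)) ℂ) (u : Fin (m + 1) → ℂ) :
    grad (pullback A f) u = A.mulVec (grad f (A.transpose.mulVec u)) := by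
  ext k
  rw [grad, pullback, derivation_aeval, map_sum, Matrix.mulVec, dotProduct]
  refine Finset.sum_congr rfl fun j _ => ?_
  have h1 := eval_pullback A u (pderiv j f)
  rw [pullback] at h1
  rw [map_mul, h1, mul_comm, grad]
  congr 1
  simp [pderiv_X, Pi.single_apply]

theorem grad_absoluteForm (v : Fin 4 → ℂ) :
    grad absoluteForm v = (2 : ℂ) • ![v 0, v 1, v 2, 0] := by
  ext i
  fin_cases i <;> simp [grad, absoluteForm, pderiv_X]

variable {a b : ℝ} {A : Matrix (Fin 3) (Fin 4) ℂ} {N : Matrix (Fin 4) (Fin 3) ℂ}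

theorem IsSplitProjection.projImage_zeroSet_pullback {o : Projectivization ℝ (Fin 4 → ℝ)}
    (hA : IsSplitProjection A N o.rep) {f : MvPolynomial (Fin 4) ℂ} {d : ℕ}
    (hf : f.IsHomogeneous d) :
    projImage A.transpose (zeroSet (pullback A f)) = zeroSet f ∩ planesThrough o := by
  ext H
  constructor
  · rintro ⟨p, hp, hne, rfl⟩
    refine ⟨(mk_mem_zeroSet hf hne).mpr ?_, ?_⟩
    · rw [← eval_pullback]
      exact hp
    · obtain ⟨c, -, hrep⟩ := exists_rep_mk hne
      change ∑ i, (Projectivization.mk ℂ _ hne).rep i * (o.rep i : ℂ) = 0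
      rw [hrep]
      simp only [Pi.smul_apply, smul_eq_mul, mul_assoc, ← Finset.mul_sum]
      rw [hA.transpose_mulVec_dot_center, mul_zero]
  · rintro ⟨hH, hHo⟩
    have hlift := hA.transpose_mulVec hHo
    have hne : N.transpose.mulVec H.rep ≠ 0 := by
      intro h0
      rw [h0, Matrix.mulVec_zero] at hlift
      exact H.rep_nonzero hlift.symm
    obtain ⟨c, hc, hrep⟩ := exists_rep_mk hne
    refine ⟨.mk ℂ _ hne, (mk_mem_zeroSet (isHomogeneous_pullback A hf) hne).mpr ?_, ?_⟩
    · rw [eval_pullback, hlift]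
      exact hH
    · rw [hrep, Matrix.mulVec_smul, hlift]
      refine ⟨smul_ne_zero hc H.rep_nonzero, ?_⟩
      conv_lhs => rw [← H.mk_rep]
      rw [Projectivization.mk_eq_mk_iff']
      exact ⟨c⁻¹, by rw [smul_smul, inv_mul_cancel₀ hc, one_smul]⟩

/-! ### The elliptic absolute -/

variable {o : Fin 4 → ℝ}

/-- The right inverse can be chosen with values in the plane `w = 0`. -/
theorem IsSplitProjection.exists_plane_section (hA : IsSplitProjection A N o) (h3 : o 3 ≠ 0) :
    ∃ L, IsSplitProjection A L o ∧ ∀ k, L 3 k = 0 := by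
  have h3' : (o 3 : ℂ) ≠ 0 := by exact_mod_cast h3
  obtain ⟨c, hc⟩ := hA.left_inv
  refine ⟨Matrix.of fun i k => N i k - o i * (N 3 k / o 3), ⟨hA.center, ?_, ?_⟩, fun k => ?_⟩
  · rw [← hA.right_inv]
    ext i k
    simp only [Matrix.mul_apply, Matrix.of_apply, mul_sub, Finset.sum_sub_distrib, ← mul_assoc, ← Finset.sum_mul,
      hA.center, zero_mul, sub_zero]
  · refine ⟨fun j => c j + (N * A) 3 j / o 3, fun i j => ?_⟩
    have := hc i j
    simp only [Matrix.mul_apply, Matrix.of_apply, sub_mul, Finset.sum_sub_distrib] at this ⊢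
    rw [this, mul_add, ← sub_sub, Finset.sum_div, Finset.mul_sum]
    congr 1
    exact Finset.sum_congr rfl fun k _ => by ring
  · rw [Matrix.of_apply]
    field_simp
    ring

theorem IsSplitProjection.mulVec_mulVec_of_plane {L : Matrix (Fin 4) (Fin 3) ℂ}
    (hA : IsSplitProjection A L o) (h3 : o 3 ≠ 0) (hL : ∀ k, L 3 k = 0) {p : Fin 4 → ℂ}
    (hp : p 3 = 0) : L.mulVec (A.mulVec p) = p := by
  have h3' : (o 3 : ℂ) ≠ 0 := by exact_mod_cast h3
  obtain ⟨c, hc⟩ := hA.left_inv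
  have e (i : Fin 4) : L.mulVec (A.mulVec p) i = p i - o i * ∑ j, c j * p j := by
    rw [Matrix.mulVec_mulVec]
    simp [Matrix.mulVec, dotProduct, hc, sub_mul, Finset.sum_sub_distrib, Finset.mul_sum, mul_assoc]
  have e3 := e 3
  rw [hp, zero_sub, Matrix.mulVec, dotProduct] at e3
  simp only [hL, zero_mul, Finset.sum_const_zero] at e3
  have hz : ∑ j, c j * p j = 0 := by simpa [h3'] using e3.symm
  ext i
  rw [e, hz, mul_zero, sub_zero]

section EllipticAbsolute

variable {L : Matrix (Fin 4) (Fin 3) ℂ}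

theorem mulVec_apply_three_eq_zero (hL : ∀ k, L 3 k = 0) (w : Fin 3 → ℂ) : L.mulVec w 3 = 0 := by
  simp [Matrix.mulVec, dotProduct, hL]

theorem eval_pullback_transpose_absoluteForm (w : Fin 3 → ℂ) :
    eval w (pullback L.transpose absoluteForm) =
      L.mulVec w 0 ^ 2 + L.mulVec w 1 ^ 2 + L.mulVec w 2 ^ 2 := by
  rw [eval_pullback, Matrix.transpose_transpose, eval_absoluteForm]

/-- As o is not at infinity, A maps the plane w = 0 isomorphically to the image plane, with inverse
L. -/
theorem ellipticAbsolute_eq (hA : IsSplitProjection A L o) (h3 : o 3 ≠ 0) (hL : ∀ k, L 3 k = 0) :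
    ellipticAbsolute A = zeroSet (pullback L.transpose absoluteForm) := by
  have hhom := isHomogeneous_pullback L.transpose isHomogeneous_absoluteForm
  ext q
  constructor
  · rintro ⟨p, hp, hne, rfl⟩
    rw [mem_euclideanAbsolute] at hp
    rw [mk_mem_zeroSet hhom, eval_pullback_transpose_absoluteForm,
      hA.mulVec_mulVec_of_plane h3 hL hp.1, hp.2]
  · intro hq
    have hq' : eval q.rep (pullback L.transpose absoluteForm) = 0 := hq
    rw [eval_pullback_transpose_absoluteForm] at hq'
    have hAL : A.mulVec (L.mulVec q.rep) = q.rep := by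
      rw [Matrix.mulVec_mulVec, hA.right_inv, Matrix.one_mulVec]
    have hne : L.mulVec q.rep ≠ 0 := by
      intro h0
      rw [h0, Matrix.mulVec_zero] at hAL
      exact q.rep_nonzero hAL.symm
    obtain ⟨c, hc, hrep⟩ := exists_rep_mk hne
    refine ⟨.mk ℂ _ hne, ?_, ?_⟩
    · rw [mem_euclideanAbsolute, hrep]
      simp only [Pi.smul_apply, smul_eq_mul, mulVec_apply_three_eq_zero hL, mul_zero, true_and]
      linear_combination c ^ 2 * hq'
    · rw [hrep, Matrix.mulVec_smul, hAL]
      refine ⟨smul_ne_zero hc q.rep_nonzero, ?_⟩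
      conv_lhs => rw [← q.mk_rep]
      rw [Projectivization.mk_eq_mk_iff']
      exact ⟨c⁻¹, by rw [smul_smul, inv_mul_cancel₀ hc, one_smul]⟩

theorem squarefree_pullback_transpose_absoluteForm (hA : IsSplitProjection A L o) (h3 : o 3 ≠ 0)
    (hL : ∀ k, L 3 k = 0) : Squarefree (pullback L.transpose absoluteForm) := by
  refine squarefree_quadric_of_line (v := A.mulVec ![1, 0, 0, 0]) (v' := A.mulVec ![0, 1, 0, 0])
    (isHomogeneous_pullback _ isHomogeneous_absoluteForm) (Polynomial.funext fun t => ?_)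
  rw [eval_lineMap, eval_pullback_transpose_absoluteForm, Matrix.mulVec_add, Matrix.mulVec_smul,
    hA.mulVec_mulVec_of_plane h3 hL (by simp), hA.mulVec_mulVec_of_plane h3 hL (by simp)]
  simp
  ring

theorem squarefree_pullback_absoluteForm (hA : IsSplitProjection A N o) (h3 : o 3 ≠ 0) :
    Squarefree (pullback A absoluteForm) := by
  have h3' : (o 3 : ℂ) ≠ 0 := by exact_mod_cast h3
  refine squarefree_quadric_of_line (v := N.transpose.mulVec ![1, 0, 0, -o 0 / o 3])
    (v' := N.transpose.mulVec ![0, 1, 0, -o 1 / o 3])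
    (isHomogeneous_pullback _ isHomogeneous_absoluteForm) (Polynomial.funext fun t => ?_)
  rw [hA.eval_lineMap_pullback, eval_absoluteForm]
  · simp
    ring
  · simp [Fin.sum_univ_four, h3']
  · simp [Fin.sum_univ_four, h3']

/-- Vectors are determined by their first three coordinates up to the kernel of `Lᵀ`. -/
theorem transpose_mulVec_congr (hL : ∀ k, L 3 k = 0) {p p' : Fin 4 → ℂ} (h0 : p 0 = p' 0)
    (h1 : p 1 = p' 1) (h2 : p 2 = p' 2) : L.transpose.mulVec p = L.transpose.mulVec p' := by
  ext k
  simp [Matrix.mulVec, dotProduct, Fin.sum_univ_four, hL, h0, h1, h2]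

theorem dual_ellipticAbsolute (hA : IsSplitProjection A N o) (h3 : o 3 ≠ 0) :
    dual 1 (ellipticAbsolute A) = zeroSet (pullback A absoluteForm) := by
  obtain ⟨L, hA, hL⟩ := hA.exists_plane_section h3
  have h3' : (o 3 : ℂ) ≠ 0 := by exact_mod_cast h3
  have hhom := isHomogeneous_pullback L.transpose isHomogeneous_absoluteForm
  have hsq := squarefree_pullback_transpose_absoluteForm hA h3 hL
  rw [ellipticAbsolute_eq hA h3 hL]
  refine Set.Subset.antisymm (dual_zeroSet_subset hhom two_ne_zero hsq
    (isHomogeneous_pullback A isHomogeneous_absoluteForm) fun w hw _ => ?_) fun H hH => ?_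
  · rw [eval_pullback_transpose_absoluteForm] at hw
    -- Lᵀ ignores the last coordinate. It can be chosen so that the plane passes through o, and then
    -- Aᵀ recovers that plane from its line.
    let z : ℂ := -(L.mulVec w 0 * o 0 + L.mulVec w 1 * o 1 + L.mulVec w 2 * o 2) / o 3
    have hz : ∑ i, ![L.mulVec w 0, L.mulVec w 1, L.mulVec w 2, z] i * (o i : ℂ) = 0 := by
      simp [Fin.sum_univ_four, z, h3']
    rw [grad_pullback, grad_absoluteForm, Matrix.transpose_transpose, Matrix.mulVec_smul,
      eval_smul_of_isHomogeneous (isHomogeneous_pullback A isHomogeneous_absoluteForm),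
      transpose_mulVec_congr hL (p' := ![L.mulVec w 0, L.mulVec w 1, L.mulVec w 2, z])
        (by simp) (by simp) (by simp),
      eval_pullback, hA.transpose_mulVec hz, eval_absoluteForm]
    simp [hw]
  · refine subset_zariskiClosure _ ?_
    have hH' : eval H.rep (pullback A absoluteForm) = 0 := hH
    rw [eval_pullback, eval_absoluteForm] at hH'
    have hh := hA.transpose_mulVec_transpose_mulVec H.rep
    have hho := hA.transpose_mulVec_dot_center H.rep
    generalize A.transpose.mulVec H.rep = h at *
    have hLA := hA.mulVec_mulVec_of_plane h3 hL (p := ![h 0, h 1, h 2, 0]) (by simp)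
    refine mem_tangents_zeroSet hhom two_ne_zero hsq (v := A.mulVec ![h 0, h 1, h 2, 0])
      ?_ ?_ two_ne_zero ?_
    · rw [eval_pullback_transpose_absoluteForm, hLA]
      simpa using hH'
    · intro h0
      rw [h0, Matrix.mulVec_zero] at hLA
      apply H.rep_nonzero
      rw [← hh, transpose_mulVec_congr hL (p' := 0), Matrix.mulVec_zero]
      · simpa using (congrFun hLA 0).symm
      · simpa using (congrFun hLA 1).symm
      · simpa using (congrFun hLA 2).symm
    · rw [grad_pullback, grad_absoluteForm, Matrix.transpose_transpose, Matrix.mulVec_smul, hLA,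
        ← hh]
      congr 1
      exact transpose_mulVec_congr hL (by simp) (by simp) (by simp)

end EllipticAbsolute

/-! ### Tangency -/

theorem grad_sq_add_mul {n : ℕ} {l f k : MvPolynomial (Fin (n + 1)) ℂ} {v : Fin (n + 1) → ℂ}
    (hl : eval v l = 0) (hf : eval v f = 0) :
    grad (l ^ 2 + f * k) v = eval v k • grad f v := by
  ext i
  simp [grad, Derivation.leibniz, Derivation.leibniz_pow, hl, hf]

theorem grad_dualTorusForm_of_absolute {v : Fin 4 → ℂ} (hq : v 0 ^ 2 + v 1 ^ 2 + v 2 ^ 2 = 0)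
    (hl : b * v 2 ^ 2 + 4 * v 3 ^ 2 = 0) : grad (dualTorusForm a b) v =
      (4 * b * (b - 4 * a) * v 2 ^ 2 : ℂ) • grad absoluteForm v := by
  have hq' : eval v absoluteForm = 0 := by rw [eval_absoluteForm, hq]
  rw [dualTorusForm_eq, grad_sq_add_mul (by simpa using hl) hq']
  refine congrArg (fun c : ℂ => c • grad absoluteForm v) ?_
  simp only [map_add, map_sub, map_mul, map_pow, eval_C, eval_X, map_ofNat, hq']
  linear_combination (8 * a - 4 * b) * hl

/-- On q = l = 0 the gradient of D = l² + qk is k times that of q, and applying A carries this over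
to the slice. It remains to see that k = 4b(b − 4a)z² and the projected gradient of q are nonzero.
-/
theorem meetTangentially (ha : 0 < a) (hb : 0 < b) (hab : b ≠ 4 * a) (ho : IsGenericCenter a b o)
    (hA : IsSplitProjection A N o) : MeetTangentially (zeroSet (pullback A (dualTorusForm a b)))
      (zeroSet (pullback A absoluteForm)) := by
  rintro p ⟨hp, hp'⟩
  have hhom := isHomogeneous_pullback A (isHomogeneous_dualTorusForm a b)
  have hhom' := isHomogeneous_pullback A isHomogeneous_absoluteForm
  have hsq := (hA.squarefree_and_isRelPrime ha hb hab ho).1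
  have hsq' := squarefree_pullback_absoluteForm hA ho.finite
  have h3 : (o 3 : ℂ) ≠ 0 := by exact_mod_cast ho.finite
  have hD : eval p.rep (pullback A (dualTorusForm a b)) = 0 := hp
  have hq : eval p.rep (pullback A absoluteForm) = 0 := hp'
  have hgD := grad_pullback A (dualTorusForm a b) p.rep
  have hgq := grad_pullback A absoluteForm p.rep
  have hh0 : A.transpose.mulVec p.rep ≠ 0 := by
    intro h0
    have := hA.transpose_mulVec_transpose_mulVec p.rep
    rw [h0, Matrix.mulVec_zero] at this
    exact p.rep_nonzero this.symm
  have hho := hA.transpose_mulVec_dot_center p.rep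
  rw [eval_pullback] at hD hq
  generalize A.transpose.mulVec p.rep = h at *
  rw [dualTorusForm_eq, map_add, map_mul, hq, zero_mul, add_zero, map_pow, sq_eq_zero_iff] at hD
  rw [eval_absoluteForm] at hq
  have hl : b * h 2 ^ 2 + 4 * h 3 ^ 2 = 0 := by simpa using hD
  simp only [Fin.sum_univ_four] at hho
  -- If z = 0, then w = 0, x² + y² = 0 and o₀x + o₁y = 0; as o is off the axis, all coordinates
  -- would vanish.
  have hz : h 2 ≠ 0 := by
    intro hz
    have hw : h 3 = 0 := by simpa [hz] using hl
    rw [hz] at hq hho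
    rw [hw] at hho
    have hx : h 0 = 0 := by
      rw [← sq_eq_zero_iff]
      refine (mul_eq_zero.mp ?_).resolve_left ho.axisSq_ne_zero
      rw [axisSq]
      linear_combination (h 0 * o 0 - h 1 * o 1) * hho + (o 1 : ℂ) ^ 2 * hq
    have hy : h 1 = 0 := by simpa [hx] using hq
    apply hh0
    ext i
    fin_cases i <;> simp [hx, hy, hz, hw]
  have hK : (4 * b * (b - 4 * a) * h 2 ^ 2 : ℂ) ≠ 0 := by
    refine mul_ne_zero (mul_ne_zero (mul_ne_zero (by norm_num) ?_) (sub_ne_zero.mpr ?_))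
      (pow_ne_zero _ hz)
    · exact_mod_cast hb.ne'
    · exact_mod_cast hab
  rw [grad_dualTorusForm_of_absolute hq hl, Matrix.mulVec_smul, ← hgq] at hgD
  -- Otherwise (x, y, z, 0) would be a multiple of o, which is not at infinity, and z would be 0.
  have hgq0 : grad (pullback A absoluteForm) p.rep ≠ 0 := by
    rw [hgq, grad_absoluteForm, Matrix.mulVec_smul]
    refine smul_ne_zero two_ne_zero fun h0 => hz ?_
    obtain ⟨s, hs⟩ := hA.eq_of_mulVec_eq_zero (congrFun h0)
    have hs0 : s = 0 := by simpa [h3] using (hs 3).symm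
    simpa [hs0] using hs 2
  refine ⟨(isNonsingularPoint_zeroSet_iff hhom four_ne_zero hsq).mpr ⟨hp, ?_⟩,
    (isNonsingularPoint_zeroSet_iff hhom' two_ne_zero hsq').mpr ⟨hp', hgq0⟩, ?_⟩
  · rw [hgD]
    exact smul_ne_zero hK hgq0
  · rw [tangentSpace_zeroSet hhom four_ne_zero hsq hp,
      tangentSpace_zeroSet hhom' two_ne_zero hsq' hp', hgD]
    ext v
    have : linearForm ((4 * b * (b - 4 * a) * h 2 ^ 2 : ℂ) • grad (pullback A absoluteForm) p.rep) v
        = (4 * b * (b - 4 * a) * h 2 ^ 2 : ℂ) *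
          linearForm (grad (pullback A absoluteForm) p.rep) v := by
      simp only [linearForm_apply, Pi.smul_apply, smul_eq_mul, Finset.mul_sum, mul_assoc]
    rw [LinearMap.mem_ker, LinearMap.mem_ker, this, mul_eq_zero, or_iff_right hK]

/-! ### General centers -/

theorem exists_form_isGenericCenter (a b : ℝ) : ∃ G : MvPolynomial (Fin 4) ℝ, G ≠ 0 ∧
    (∃ k : ℕ, G.IsHomogeneous k) ∧ ∀ v, eval v G ≠ 0 → IsGenericCenter a b v := by
  let s : MvPolynomial (Fin 4) ℝ := X 0 ^ 2 + X 1 ^ 2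
  let F : MvPolynomial (Fin 4) ℝ := (s + X 2 ^ 2 + C a * X 3 ^ 2) ^ 2 - C b * s * X 3 ^ 2
  let G : MvPolynomial (Fin 4) ℝ := s ^ 2 - C (b - 2 * a) * s * X 3 ^ 2 + C (a ^ 2) * X 3 ^ 4
  let H : MvPolynomial (Fin 4) ℝ := 4 * X 2 ^ 2 - C (b - 4 * a) * X 3 ^ 2
  have hX (i : Fin 4) (k : ℕ) : (X i ^ k : MvPolynomial (Fin 4) ℝ).IsHomogeneous k :=
    isHomogeneous_X_pow i k
  have hs : s.IsHomogeneous 2 := (hX 0 2).add (hX 1 2)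
  have hF : F.IsHomogeneous 4 :=
    (((hs.add (hX 2 2)).add ((hX 3 2).C_mul a)).pow 2).sub ((hs.C_mul b).mul (hX 3 2))
  have hG : G.IsHomogeneous 4 :=
    ((hs.pow 2).sub ((hs.C_mul _).mul (hX 3 2))).add ((hX 3 4).C_mul _)
  have hH : H.IsHomogeneous 2 := ((hX 2 2).C_mul 4).sub ((hX 3 2).C_mul _)
  have hne {f : MvPolynomial (Fin 4) ℝ} (v : Fin 4 → ℝ) (h : eval v f ≠ 0) : f ≠ 0 := by
    rintro rfl
    exact h (map_zero _)
  refine ⟨X 2 * s * X 3 * H * F * G, ?_, ⟨_, (((((isHomogeneous_X _ 2).mul hs).mul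
    (isHomogeneous_X _ 3)).mul hH).mul hF).mul hG⟩, fun v hv => ?_⟩
  · refine mul_ne_zero (mul_ne_zero (mul_ne_zero (mul_ne_zero (mul_ne_zero (X_ne_zero 2) ?_)
      (X_ne_zero 3)) ?_) ?_) ?_
    · exact hne ![1, 0, 0, 0] (by simp [s])
    · exact hne ![0, 0, 1, 0] (by simp [H])
    · exact hne ![1, 0, 0, 0] (by simp [F, s])
    · exact hne ![1, 0, 0, 0] (by simp [G, s])
  · simp only [map_mul, mul_ne_zero_iff] at hv
    obtain ⟨⟨⟨⟨⟨h2, hs⟩, h3⟩, hH⟩, hF⟩, hG⟩ := hv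
    simp [s, H, F, G] at h2 hs h3 hH hF hG
    exact ⟨h2, hs, h3, fun h => hH (sub_eq_zero.mpr h), hF, hG⟩

end TorusPicture

end

theorem mainTheorem1 (a b : ℝ) (ha : 0 < a) (hb : 0 < b) (hab : b ≠ 4 * a) :
    -- the dual of the torus
    TorusPicture.dual 2 (TorusPicture.torus a b) =
      TorusPicture.zeroSet (TorusPicture.dualTorusForm a b) ∧
    -- its intersection with the dual of the Euclidean absolute is a quartic curve
    TorusPicture.dual 2 (TorusPicture.torus a b) ∩
        TorusPicture.dual 1 TorusPicture.euclideanAbsolute =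
      TorusPicture.zeroSet (MvPolynomial.X 0 ^ 2 + MvPolynomial.X 1 ^ 2 + MvPolynomial.X 2 ^ 2) ∩
        TorusPicture.zeroSet
          (MvPolynomial.C (b : ℂ) * MvPolynomial.X 2 ^ 2 + 4 * MvPolynomial.X 3 ^ 2) ∧
    TorusPicture.HasCurveDegree 4
      (TorusPicture.dual 2 (TorusPicture.torus a b) ∩
        TorusPicture.dual 1 TorusPicture.euclideanAbsolute) ∧
    -- every component of this curve is counted with multiplicity two
    (∀ (P : Ideal (MvPolynomial (Fin 4) ℂ)) [P.IsPrime],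
      P ∈ (TorusPicture.homogeneousIdeal (TorusPicture.dual 2 (TorusPicture.torus a b)) ⊔
          TorusPicture.homogeneousIdeal
            (TorusPicture.dual 1 TorusPicture.euclideanAbsolute)).minimalPrimes →
      TorusPicture.multiplicityAlong (TorusPicture.dual 2 (TorusPicture.torus a b))
        (TorusPicture.dual 1 TorusPicture.euclideanAbsolute) P = 2) ∧
    -- the dual picture from a generic center
    TorusPicture.ForGenericPoint (fun o =>
      ∀ M : Matrix (Fin 3) (Fin 4) ℝ, TorusPicture.IsProjectionFrom M o →
        TorusPicture.IsPlaneCurveOfDegree 4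
          (TorusPicture.dualPicture (TorusPicture.complexify M) (TorusPicture.torus a b)) ∧
        TorusPicture.projImage (TorusPicture.complexify M).transpose
            (TorusPicture.dualPicture (TorusPicture.complexify M) (TorusPicture.torus a b)) =
          TorusPicture.dual 2 (TorusPicture.torus a b) ∩ TorusPicture.planesThrough o ∧
        TorusPicture.projImage (TorusPicture.complexify M).transpose
            (TorusPicture.dual 1 (TorusPicture.ellipticAbsolute (TorusPicture.complexify M))) =
          TorusPicture.dual 1 TorusPicture.euclideanAbsolute ∩ TorusPicture.planesThrough o ∧
        TorusPicture.MeetTangentially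
          (TorusPicture.dualPicture (TorusPicture.complexify M) (TorusPicture.torus a b))
          (TorusPicture.dual 1
            (TorusPicture.ellipticAbsolute (TorusPicture.complexify M)))) := by
  have hdual := TorusPicture.dual_torus ha hb hab
  have habs := TorusPicture.dual_euclideanAbsolute
  have hinter := TorusPicture.zeroSet_dualTorusForm_inter a b
  refine ⟨hdual, ?_, ?_, fun P _ hP => TorusPicture.multiplicityAlong_duals ha hb hab P hP, ?_⟩
  · rw [hdual, habs, hinter]
    rfl
  · rw [hdual, habs, hinter]
    exact TorusPicture.hasCurveDegree_inter hb.ne'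
  · obtain ⟨G, hG0, hG, hgen⟩ := TorusPicture.exists_form_isGenericCenter a b
    refine ⟨G, hG0, hG, fun o ho M hM => ?_⟩
    have ho := hgen _ ho
    obtain ⟨N, hA⟩ := hM.exists_isSplitProjection
    have hsq := (hA.squarefree_and_isRelPrime ha hb hab ho).1
    rw [TorusPicture.dualPicture_torus ha hb hab ho hA,
      TorusPicture.dual_ellipticAbsolute hA ho.finite, hdual, habs]
    exact ⟨⟨_, hsq.ne_zero, TorusPicture.isHomogeneous_pullback _
        (TorusPicture.isHomogeneous_dualTorusForm a b), hsq, rfl⟩,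
      hA.projImage_zeroSet_pullback (TorusPicture.isHomogeneous_dualTorusForm a b),
      hA.projImage_zeroSet_pullback TorusPicture.isHomogeneous_absoluteForm,
      TorusPicture.meetTangentially ha hb hab ho hA⟩
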